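/- A $d$-dimensional 1-VASS-MDP $S=\langle Q,Q_1,Q_P,T,\tau\rangle$ consists of a finite set $Q$ of control-states partitioned into $Q_1$ (Player 1) and $Q_P$ (Player P, probabilistic), a finite set $T\subseteq Q\times\mathbb Z^d\times Q$ of transitions such that $z=0$ for every $(q,z,q')\in T$ with $q\in Q_P$, and weights $\tau(t)\in\mathbb N$ that are positive on the transitions leaving $Q_P$. Its configurations are the pairs $\langle q,v\rangle\in C=Q\times\mathbb N^d$; a transition $t=(q,z,q')$ is enabled in $\langle q,v\rangle$ if $v+z\ge 0$, and then gives a step $\langle q,v\rangle\to\langle q',v+z\rangle$. In a configuration of $Q_1$ that is not a deadlock, a (history-dependent) strategy $\sigma$ of Player 1 chooses a successor; in a configuration of $Q_P$ that is not a deadlock, an enabled transition is drawn with probability proportional to its weight; a play that meets a deadlock ends there. Let $\mathbb P(M_S,c,\sigma,\cdot)$ be the resulting probability measure on the maximal plays from $c$, let $\Diamond q_F$ be the event that the control-state $q_F\in Q$ is visited, and let $$V^1_{AS}=\{c\in C\mid \exists\sigma.\ \mathbb P(M_S,c,\sigma,\Diamond q_F)=1\}.$$ Formulae of the positive $\mu$-calculus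 are built from control-states $q$ (true in $\langle q,v\rangle$ for all $v$) and variables by $\wedge,\vee,\Diamond,\Box,\mu X,\nu X$, interpreted as usual over $(C,\to)$, with $Q_i$ standing for $\bigvee_{q\in Q_i}q$. The fragment $L^{sv}_\mu$ consists of those formulae in which $\Box$ occurs only in the form $Q_P\wedge\Box\varphi$. Put $$\mathrm{InvPre}(X,Y)=(Q_1\wedge\Diamond(X\wedge Y))\vee(\Diamond Y\wedge Q_P\wedge\Box X).$$ **Theorem.** 1. The almost-sure reachability problem for 1-VASS-MDPs (given a 1-VASS-MDP $S$ of any dimension, a configuration $c_0$ and a control-state $q_F$, is $c_0\in V^1_{AS}$?) is decidable. 2. For every 1-VASS-MDP $S$ and every control-state $q_F$: - the formula $\nu X.\mu Y.(q_F\vee \mathrm{InvPre}(X,Y))$ belongs to $L^{sv}_\mu$, and $V^1_{AS}$ equals its denotation; - $V^1_{AS}$ is upward closed for the order $\langle q,v\rangle\le\langle q',v'\rangle\iff q=q'\wedge v\le v'$; - there are $N\in\mathbb N$ and one strategy $\sigma$ of Player 1 such that for every $c\in V^1_{AS}$ we have $\mathbb P(M_S,c,\sigma,\Diamond q_F)=1$,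 and there is a play $c_0c_1c_2\cdots$ from $c_0=c$ respecting $\sigma$ and an index $i\le N$ such that $c_i$ has control-state $q_F$, $c_j\in V^1_{AS}$ for all $j\le i$, and, for every $j<i$ such that $c_j$ is a configuration of Player P, all successors of $c_j$ lie in $V^1_{AS}$. -/

import Mathlib

open MeasureTheory ProbabilityTheory
open scoped ENNReal

/-! ### VASS and VASS-MDPs -/

/-- A transition `(q, z, q')` of a `d`-dimensional VASS over the control-states `Q`. -/
abbrev VTrans (Q : Type*) (d : ℕ) := Q × (Fin d → ℤ) × Q

/-- A configuration `⟨q, v⟩` in `Q × ℕ^d`. -/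
@[ext]
structure Config (Q : Type*) (d : ℕ) where
  state : Q
  count : Fin d → ℕ

/-- A `d`-dimensional VASS-MDP `⟨Q, Q₁, Q_P, T, τ⟩`. The states of Player P are those outside `Q₁`.
Only the weights of the transitions that leave states of Player P matter, hence only these are
required to be positive. -/
structure VASSMDP (Q : Type*) (d : ℕ) where
  Q₁ : Finset Q
  T : Finset (VTrans Q d)
  τ : VTrans Q d → ℕ
  τ_pos : ∀ t ∈ T, t.1 ∉ Q₁ → 0 < τ t

/-- The control-states of Player P. -/
def VASSMDP.QP {Q : Type*} [Fintype Q] [DecidableEq Q] {d : ℕ} (S : VASSMDP Q d) : Finset Q :=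
  Finset.univ \ S.Q₁

/-- The transitions leaving states of `Q₂` do not change the counters. For a partition `Q₁`, `Q₂`
of the control-states, this says that the VASS `⟨Q, T⟩` is `(Q₁, Q₂)`-single-sided. -/
def IsSingleSided {Q : Type*} {d : ℕ} (T : Finset (VTrans Q d)) (Q₂ : Finset Q) : Prop :=
  ∀ t ∈ T, t.1 ∈ Q₂ → t.2.1 = 0

/-- 1-VASS-MDPs: only Player 1 can change the counters. -/
def VASSMDP.IsOneVASSMDP {Q : Type*} [Fintype Q] [DecidableEq Q] {d : ℕ} (S : VASSMDP Q d) : Prop :=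
  IsSingleSided S.T S.QP

/-! ### Configurations and moves -/

namespace Config

variable {Q : Type*} {d : ℕ}

/-- Same control-state and componentwise order on the counters. -/
instance : LE (Config Q d) := ⟨fun c c' => c.state = c'.state ∧ c.count ≤ c'.count⟩

/-- All sets of configurations are measurable. -/
instance : MeasurableSpace (Config Q d) := ⊤

instance : DiscreteMeasurableSpace (Config Q d) := ⟨fun _ => trivial⟩

instance [Finite Q] : Countable (Config Q d) :=
  Function.Injective.countable (f := fun c : Config Q d => (c.state, c.count))
    (fun a b h => by cases a; cases b; simpa using h)

/-- `t` leaves the control-state of `c` and keeps all counters nonnegative. -/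
def Enabled (c : Config Q d) (t : VTrans Q d) : Prop :=
  t.1 = c.state ∧ ∀ i, 0 ≤ (c.count i : ℤ) + t.2.1 i

/-- The configuration reached by firing `t` in `c` (used when `t` is enabled in `c`). -/
def fire (c : Config Q d) (t : VTrans Q d) : Config Q d :=
  ⟨t.2.2, fun i => ((c.count i : ℤ) + t.2.1 i).toNat⟩

end Config

/-- The transition relation `c → c'` on the configurations of the VASS `⟨Q, T⟩`. -/
def VStep {Q : Type*} {d : ℕ} (T : Finset (VTrans Q d)) (c c' : Config Q d) : Prop :=
  ∃ t ∈ T, c.Enabled t ∧ c' = c.fire t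

/-- A configuration without successor. -/
def VDeadlock {Q : Type*} {d : ℕ} (T : Finset (VTrans Q d)) (c : Config Q d) : Prop :=
  ∀ c', ¬ VStep T c c'

/-! ### The MDP induced by a VASS-MDP: strategies, plays, probabilities -/

namespace VASSMDP

variable {Q : Type*} {d : ℕ}

open Classical in
/-- The transitions that are enabled in `c`. -/
noncomputable def enabled (S : VASSMDP Q d) (c : Config Q d) : Finset (VTrans Q d) :=
  {t ∈ S.T | c.Enabled t}

/-- The distribution `p(c)` for a configuration `c` of Player P that is not a deadlock:
`p(c)(c')` is the total weight of the enabled transitions leading from `c` to `c'`, divided by the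
total weight of all transitions enabled in `c`. -/
noncomputable def prob (S : VASSMDP Q d) (c : Config Q d) : Measure (Config Q d) :=
  (∑ t ∈ S.enabled c, (S.τ t : ℝ≥0∞))⁻¹ •
    ∑ t ∈ S.enabled c, (S.τ t : ℝ≥0∞) • Measure.dirac (c.fire t)

/-- A strategy of Player 1: to a finite sequence `ρ · c` with `c` a configuration of Player 1 that
is not a deadlock it assigns a successor of `c`. (Values at other `c` are never used.) -/
structure Strategy (S : VASSMDP Q d) where
  next : List (Config Q d) → Config Q d → Config Q d
  next_valid : ∀ ρ c, c.state ∈ S.Q₁ → ¬ VDeadlock S.T c → VStep S.T c (next ρ c)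

open Classical in
/-- The law of the next configuration after `ρ · c` under the strategy `σ`. Plays that end in a
deadlock are represented by repeating the deadlock configuration forever. -/
noncomputable def nextLaw (S : VASSMDP Q d) (σ : S.Strategy) (ρ : List (Config Q d))
    (c : Config Q d) : Measure (Config Q d) :=
  if VDeadlock S.T c then Measure.dirac c
  else if c.state ∈ S.Q₁ then Measure.dirac (σ.next ρ c)
  else S.prob c

instance (S : VASSMDP Q d) (σ : S.Strategy) (ρ : List (Config Q d)) (c : Config Q d) :
    IsProbabilityMeasure (S.nextLaw σ ρ c) := by
  unfold nextLaw
  split_ifs with h1 h2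
  · infer_instance
  · infer_instance
  · refine ⟨?_⟩
    simp only [prob, Measure.smul_apply, Measure.coe_finsetSum, Finset.sum_apply, smul_eq_mul,
      measure_univ, mul_one]
    apply ENNReal.inv_mul_cancel
    · intro h0
      simp only [VDeadlock, not_forall, not_not] at h1
      obtain ⟨_, t, ht, hen, -⟩ := h1
      have h3 := (Finset.sum_eq_zero_iff.mp h0) t (by simp [enabled, ht, hen])
      have h4 := S.τ_pos t ht (by rw [hen.1]; exact h2)
      simp only [Nat.cast_eq_zero] at h3
      omega
    · exact ENNReal.sum_ne_top.mpr fun t _ => ENNReal.natCast_ne_top _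

/-- The transition kernels of the process: from the first `n + 1` configurations of a play to the
next one. -/
noncomputable def kernel [Finite Q] (S : VASSMDP Q d) (σ : S.Strategy) (n : ℕ) :
    Kernel ((i : Finset.Iic n) → Config Q d) (Config Q d) where
  toFun h := S.nextLaw σ
    (List.ofFn fun i : Fin n => h ⟨i, Finset.mem_Iic.mpr i.2.le⟩)
    (h ⟨n, Finset.mem_Iic.mpr le_rfl⟩)
  measurable' := measurable_of_countable _

instance [Finite Q] (S : VASSMDP Q d) (σ : S.Strategy) (n : ℕ) : IsMarkovKernel (S.kernel σ n) :=
  ⟨fun _ => inferInstanceAs (IsProbabilityMeasure (S.nextLaw σ _ _))⟩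

/-- The probability measure `ℙ(M_S, c, σ, ·)` on the plays. -/
noncomputable def playMeasure [Finite Q] (S : VASSMDP Q d) (c : Config Q d) (σ : S.Strategy) :
    Measure (ℕ → Config Q d) :=
  Kernel.traj (X := fun _ => Config Q d) (S.kernel σ) 0 (fun _ => c)

/-- The (maximal) plays that start in `c` and respect `σ`; a play that ends in a deadlock is
prolonged by repeating its last configuration. -/
def Outcome (S : VASSMDP Q d) (c : Config Q d) (σ : S.Strategy) : Set (ℕ → Config Q d) :=
  {ω | ω 0 = c ∧ ∀ k,
    (VDeadlock S.T (ω k) → ω (k + 1) = ω k) ∧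
    (¬ VDeadlock S.T (ω k) → (ω k).state ∈ S.Q₁ →
      ω (k + 1) = σ.next (List.ofFn fun i : Fin k => ω i) (ω k)) ∧
    (¬ VDeadlock S.T (ω k) → (ω k).state ∉ S.Q₁ → VStep S.T (ω k) (ω (k + 1)))}

/-- The event `◇ q_F`. -/
def Reach (d : ℕ) (qF : Q) : Set (ℕ → Config Q d) := {ω | ∃ i, (ω i).state = qF}

/-- The configurations from which Player 1 has a strategy to reach `qF` with probability one. -/
def almostSureSet [Finite Q] (S : VASSMDP Q d) (qF : Q) : Set (Config Q d) :=
  {c | ∃ σ : S.Strategy, S.playMeasure c σ (Reach d qF) = 1}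

end VASSMDP

/-! ### The positive mu-calculus over VASS -/

/-- Formulae of the positive mu-calculus, with control-states as atomic propositions and
variables named by natural numbers. -/
inductive MuForm (Q : Type*) where
  | atom (q : Q)
  | var (x : ℕ)
  | and (φ ψ : MuForm Q)
  | or (φ ψ : MuForm Q)
  | dia (φ : MuForm Q)
  | box (φ : MuForm Q)
  | mu (x : ℕ) (φ : MuForm Q)
  | nu (x : ℕ) (φ : MuForm Q)

namespace MuForm

variable {Q : Type*}

/-- The denotation of a formula over the configurations of the VASS `⟨Q, T⟩`, in an
environment `ε`. -/
def interp {d : ℕ} (T : Finset (VTrans Q d)) :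
    MuForm Q → (ℕ → Set (Config Q d)) → Set (Config Q d)
  | atom q, _ => {c | c.state = q}
  | var x, ε => ε x
  | and φ ψ, ε => interp T φ ε ∩ interp T ψ ε
  | or φ ψ, ε => interp T φ ε ∪ interp T ψ ε
  | dia φ, ε => {c | ∃ c', VStep T c c' ∧ c' ∈ interp T φ ε}
  | box φ, ε => {c | ∀ c', VStep T c c' → c' ∈ interp T φ ε}
  | mu x φ, ε => ⋂₀ {A | interp T φ (Function.update ε x A) ⊆ A}
  | nu x φ, ε => ⋃₀ {A | A ⊆ interp T φ (Function.update ε x A)}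

/-- The denotation in the environment `ε₀` that maps every variable to the empty set. -/
def denot {d : ℕ} (T : Finset (VTrans Q d)) (φ : MuForm Q) : Set (Config Q d) :=
  interp T φ (fun _ => ∅)

/-- The disjunction of a list of control-states; the empty disjunction is `μ Z. Z` (false). -/
def disjList : List Q → MuForm Q
  | [] => mu 2 (var 2)
  | [q] => atom q
  | q :: r :: l => or (atom q) (disjList (r :: l))

/-- The formula `⋁_{q ∈ A} q`, written `A` in formulae. -/
noncomputable def disj (A : Finset Q) : MuForm Q := disjList A.toList

/-- The fragment `L^sv_μ` for `(Q₁, Q₂)`-single-sided VASS: the operator `□` occurs only in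
subformulae `Q₂ ∧ □ φ`. -/
inductive InLsv (Q₂ : Finset Q) : MuForm Q → Prop
  | atom (q : Q) : InLsv Q₂ (atom q)
  | var (x : ℕ) : InLsv Q₂ (var x)
  | and {φ ψ : MuForm Q} : InLsv Q₂ φ → InLsv Q₂ ψ → InLsv Q₂ (and φ ψ)
  | or {φ ψ : MuForm Q} : InLsv Q₂ φ → InLsv Q₂ ψ → InLsv Q₂ (or φ ψ)
  | dia {φ : MuForm Q} : InLsv Q₂ φ → InLsv Q₂ (dia φ)
  | guardedBox {φ : MuForm Q} : InLsv Q₂ φ → InLsv Q₂ (and (disj Q₂) (box φ))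
  | mu (x : ℕ) {φ : MuForm Q} : InLsv Q₂ φ → InLsv Q₂ (mu x φ)
  | nu (x : ℕ) {φ : MuForm Q} : InLsv Q₂ φ → InLsv Q₂ (nu x φ)

/-- `InvPre(φ, ψ) = (Q₁ ∧ ◇ (φ ∧ ψ)) ∨ (◇ ψ ∧ (Q_P ∧ □ φ))`. -/
noncomputable def invPre (Q₁ QP : Finset Q) (φ ψ : MuForm Q) : MuForm Q :=
  or (and (disj Q₁) (dia (and φ ψ))) (and (dia ψ) (and (disj QP) (box φ)))

/-- `ν X. μ Y. (q_F ∨ InvPre(X, Y))`, where `X` is variable `0` and `Y` is variable `1`. -/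
noncomputable def almostSureForm (Q₁ QP : Finset Q) (qF : Q) : MuForm Q :=
  nu 0 (mu 1 (or (atom qF) (invPre Q₁ QP (var 0) (var 1))))

end MuForm

/-! ### The decision problem -/

/-- Inputs of the decision problem: number of control-states, dimension, ownership of the
control-states by Player 1, list of weighted transitions, initial configuration, target. -/
abbrev Code : Type :=
  ℕ × ℕ × List Bool × List ((ℕ × List ℤ × ℕ) × ℕ) × (ℕ × List ℕ) × ℕ

/-- `w` is a code of the VASS-MDP `S` with control-states `0, …, n - 1`, the initial configuration
`c₀` and the target state `qF`. The transitions may be listed in any order. -/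
def Encodes {n d : ℕ} (w : Code) (S : VASSMDP (Fin n) d) (c₀ : Config (Fin n) d)
    (qF : Fin n) : Prop :=
  ∃ L : List (VTrans (Fin n) d), L.toFinset = S.T ∧
    w = (n, d, List.ofFn (fun q : Fin n => decide (q ∈ S.Q₁)),
      L.map (fun t => (((t.1 : ℕ), List.ofFn t.2.1, (t.2.2 : ℕ)), S.τ t)),
      ((c₀.state : ℕ), List.ofFn c₀.count), (qF : ℕ))

/-- The almost-sure reachability problem for 1-VASS-MDPs, as a set of codes: `w` encodes a
1-VASS-MDP, an initial configuration and a control-state such that Player 1 has a strategy that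
reaches the control-state from the initial configuration with probability one. -/
def AlmostSureReachability (w : Code) : Prop :=
  ∃ (n d : ℕ) (S : VASSMDP (Fin n) d) (c₀ : Config (Fin n) d) (qF : Fin n),
    S.IsOneVASSMDP ∧ Encodes w S c₀ qF ∧ c₀ ∈ S.almostSureSet qF

/-!
Let `W = ν X. μ Y. (q_F ∨ InvPre(X, Y))`. Since transitions of Player P do not change the counters,
all stages of the least fixed point are upward closed, and by Dickson's lemma it is reached after
finitely many of them. A configuration in the `n`-th stage has rank at most `n`. The strategy that
always lowers the rank never leaves `W` and, with the help of Player P, reaches `q_F` in boundedly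
many steps; as the probability of this help is bounded below on `W`, it reaches `q_F` almost surely.
Conversely, the almost surely winning configurations form a post-fixed point.

A finite set of minimal configurations with their ranks witnesses `c ∈ W`. For the witnesses of
`c ∉ W`, truncate the counters at the largest entry of a minimal element of `W`, and let Player 1
play on the finitely many losing truncated configurations an energy game, won if the untruncated
counters stay nonnegative and Player P intervenes infinitely often. Player 1 cannot win it, since
from the positions with the fewest truncated counters the ranks of the game would put actual
configurations into `W`. In such a game the opponent has a memoryless winning strategy: two winning
plays can be interleaved with separate credits. In its graph no cycle of nonnegative effect contains
an intervention, and by the Farkas lemma this is witnessed by a lexicographic ranking with natural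
coefficients. Both kinds of witnesses can be enumerated, hence membership in `W` is decidable.
-/

section FixedPoints

/-- Coinduction up to the greatest fixed point itself for `ν x. μ y. f x y`: it suffices that each
member of a ranked family is obtained from the whole family in the outer variable and from members
of smaller rank in the inner one. -/
theorem le_gfp_lfp_of_ranked {α ι : Type*} [CompleteLattice α] [Preorder ι] [WellFoundedLT ι]
    {f : α →o α →o α} {w : α} (hw : w = (OrderHom.lfp.comp f).gfp) {x : ι → α}
    (hx : ∀ i, x i ≤ f (w ⊔ ⨆ j, x j) (w ⊔ ⨆ j < i, x j)) (i : ι) : x i ≤ w := by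
  set z := w ⊔ ⨆ j, x j
  have hw_le : w ≤ (f z).lfp := calc
    w = (f w).lfp := hw ▸ (OrderHom.map_gfp _).symm
    _ ≤ (f z).lfp := OrderHom.lfp.mono (f.mono le_sup_left)
  have hx_le (i : ι) : x i ≤ (f z).lfp := by
    induction i using WellFoundedLT.induction with
    | _ i ih =>
      calc
        x i ≤ f z (w ⊔ ⨆ j < i, x j) := hx i
        _ ≤ f z (f z).lfp := (f z).mono (sup_le hw_le (iSup₂_le ih))
        _ = (f z).lfp := (f z).map_lfp
  calc
    x i ≤ z := le_sup_of_le_right (le_iSup x i)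
    _ ≤ (OrderHom.lfp.comp f).gfp := OrderHom.le_gfp _ (sup_le hw_le (iSup_le hx_le))
    _ = w := hw.symm

variable {α : Type*} [Preorder α] {f : Set α →o Set α}

theorem isUpperSet_lfp (hf : ∀ s, IsUpperSet s → IsUpperSet (f s)) : IsUpperSet f.lfp := by
  -- The largest upper set contained in the least fixed point is a prefixed point.
  set k : Set α := {x | Set.Ici x ⊆ f.lfp}
  have hk : IsUpperSet k := fun x y hxy hx => (Set.Ici_subset_Ici.2 hxy).trans hx
  have hk_lfp : k ⊆ f.lfp := fun x hx => hx (Set.self_mem_Ici (a := x))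
  have hfk : f k ⊆ k := fun x hx y hxy => f.map_le_lfp hk_lfp (hf k hk hxy hx)
  exact (hk_lfp.antisymm (f.lfp_le hfk)) ▸ hk

theorem isUpperSet_gfp (hf : ∀ s, IsUpperSet s → IsUpperSet (f s)) : IsUpperSet f.gfp := by
  set u : UpperSet α := upperClosure (OrderHom.gfp f)
  have hgfp : OrderHom.gfp f ⊆ u := subset_upperClosure
  have hfu : (u : Set α) ⊆ f u := upperClosure_min (f.gfp_le_map hgfp) (hf u u.upper)
  have heq : OrderHom.gfp f = u := hgfp.antisymm (f.le_gfp hfu)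
  exact heq ▸ u.upper

end FixedPoints

section WellQuasiOrder

variable {α : Type*} [PartialOrder α] [WellQuasiOrderedLE α]

theorem exists_finset_subset_upperClosure (s : Set α) :
    ∃ b : Finset α, ↑b ⊆ s ∧ s ⊆ upperClosure (b : Set α) := by
  have hfin : {x | Minimal (· ∈ s) x}.Finite :=
    WellQuasiOrderedLE.finite_of_isAntichain (setOfPred_minimal_antichain _)
  refine ⟨hfin.toFinset, fun x hx => ?_, fun x hx => ?_⟩
  · exact (hfin.mem_toFinset.1 hx).prop
  · obtain ⟨y, hyx, hy⟩ := exists_minimal_le_of_wellFoundedLT (· ∈ s) x hx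
    exact ⟨y, hfin.mem_toFinset.2 hy, hyx⟩

theorem exists_iUnion_eq_of_isUpperSet {u : ℕ → Set α} (hmono : Monotone u)
    (hu : ∀ n, IsUpperSet (u n)) : ∃ n, ⋃ k, u k = u n := by
  obtain ⟨b, hb, hub⟩ := exists_finset_subset_upperClosure (⋃ k, u k)
  choose! r hr using fun x (hx : x ∈ b) => Set.mem_iUnion.1 (hb hx)
  refine ⟨b.sup r, (Set.subset_iUnion u _).antisymm' fun x hx => ?_⟩
  obtain ⟨y, hy, hyx⟩ := hub hx
  exact hu _ hyx (hmono (Finset.le_sup hy) (hr y hy))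

end WellQuasiOrder

namespace MuForm

variable {Q : Type*} {d : ℕ}

lemma interp_disjList (T : Finset (VTrans Q d)) (l : List Q) (ε : ℕ → Set (Config Q d)) :
    interp T (disjList l) ε = {c | c.state ∈ l} := by
  induction l using disjList.induct with
  | case1 => simpa [disjList, interp] using Set.sInter_eq_empty_iff.2 fun _ => ⟨∅, by simp⟩
  | case2 q => ext; simp [disjList, interp]
  | case3 q r l ih => ext; simp [disjList, interp, ih]

lemma interp_disj (T : Finset (VTrans Q d)) (A : Finset Q) (ε : ℕ → Set (Config Q d)) :
    interp T (disj A) ε = {c | c.state ∈ A} := by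
  simp [disj, interp_disjList]

lemma inLsv_disjList (Q₂ : Finset Q) : ∀ l : List Q, InLsv Q₂ (disjList l)
  | [] => .mu _ (.var _)
  | [q] => .atom q
  | _ :: r :: l => .or (.atom _) (inLsv_disjList Q₂ (r :: l))

lemma inLsv_almostSureForm (Q₁ QP : Finset Q) (qF : Q) : InLsv QP (almostSureForm Q₁ QP qF) :=
  .nu _ (.mu _ (.or (.atom _) (.or (.and (inLsv_disjList _ _) (.dia (.and (.var _) (.var _))))
    (.and (.dia (.var _)) (.guardedBox (.var _))))))

end MuForm

namespace Config

variable {Q : Type*} {d : ℕ}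

instance : PartialOrder (Config Q d) where
  le_refl _ := ⟨rfl, le_rfl⟩
  le_trans _ _ _ h h' := ⟨h.1.trans h'.1, h.2.trans h'.2⟩
  le_antisymm _ _ h h' := Config.ext h.1 (h.2.antisymm h'.2)

instance [Finite Q] : WellQuasiOrderedLE (Config Q d) where
  wqo u := by
    have hstate : WellQuasiOrdered (Eq : Q → Q → Prop) := Finite.wellQuasiOrdered _
    have hcount : WellQuasiOrdered ((· ≤ ·) : (Fin d → ℕ) → (Fin d → ℕ) → Prop) :=
      wellQuasiOrdered_le
    exact hstate.prod hcount fun n => ((u n).state, (u n).count)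

end Config

namespace VASSMDP

variable {Q : Type*} {d : ℕ}

/-- The operator `(X, Y) ↦ q_F ∨ InvPre(X, Y)` on sets of configurations. -/
def reachStep (S : VASSMDP Q d) (qF : Q) :
    Set (Config Q d) →o Set (Config Q d) →o Set (Config Q d) where
  toFun X :=
    { toFun Y := {c | c.state = qF ∨
        (c.state ∈ S.Q₁ ∧ ∃ c', VStep S.T c c' ∧ c' ∈ X ∧ c' ∈ Y) ∨
        (c.state ∉ S.Q₁ ∧ (∃ c', VStep S.T c c' ∧ c' ∈ Y) ∧ ∀ c', VStep S.T c c' → c' ∈ X)}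
      monotone' _ _ hY _ := by
        rintro (h | ⟨h, c', hstep, hX, h'⟩ | ⟨h, ⟨c', hstep, h'⟩, hX⟩)
        exacts [.inl h, .inr (.inl ⟨h, c', hstep, hX, hY h'⟩),
          .inr (.inr ⟨h, ⟨c', hstep, hY h'⟩, hX⟩)] }
  monotone' _ _ hX Y _ := by
    rintro (h | ⟨h, c', hstep, h', hY⟩ | ⟨h, hY, h'⟩)
    exacts [.inl h, .inr (.inl ⟨h, c', hstep, hX h', hY⟩),
      .inr (.inr ⟨h, hY, fun c' hstep => hX (h' c' hstep)⟩)]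

/-- The winning set `ν X. μ Y. (q_F ∨ InvPre(X, Y))`. -/
def winSet (S : VASSMDP Q d) (qF : Q) : Set (Config Q d) :=
  (OrderHom.lfp.comp (S.reachStep qF)).gfp

/-- The approximants of `winSet` as the least fixed point of `reachStep` with `winSet` in the outer
variable: level `n` consists of the configurations from which Player 1 can force, within `winSet`, a
visit of `qF` in fewer than `n` moves if Player P cooperates. -/
def winLevel (S : VASSMDP Q d) (qF : Q) (n : ℕ) : Set (Config Q d) :=
  (S.reachStep qF (S.winSet qF))^[n] ∅

lemma denot_almostSureForm [Fintype Q] [DecidableEq Q] (S : VASSMDP Q d) (qF : Q) :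
    MuForm.denot S.T (MuForm.almostSureForm S.Q₁ S.QP qF) = S.winSet qF := by
  have interp_body (X Y : Set (Config Q d)) :
      MuForm.interp S.T (.or (.atom qF) (MuForm.invPre S.Q₁ S.QP (.var 0) (.var 1)))
        (Function.update (Function.update (fun _ => ∅) 0 X) 1 Y) = S.reachStep qF X Y := by
    ext c
    simp only [MuForm.interp, MuForm.invPre, MuForm.interp_disj, QP, Set.mem_union,
      Set.mem_inter_iff, Set.mem_ofPred_eq, Finset.mem_sdiff, Finset.mem_univ, true_and,
      Function.update_self, ne_eq, zero_ne_one, not_false_eq_true, Function.update_of_ne,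
      and_left_comm (b := c.state ∉ S.Q₁)]
    rfl
  simp only [MuForm.denot, MuForm.almostSureForm, MuForm.interp.eq_7, MuForm.interp.eq_8,
    interp_body]
  rfl

lemma exists_step_ge {T : Finset (VTrans Q d)} {c c' e : Config Q d} (h : VStep T c c')
    (hce : c ≤ e) : ∃ e', VStep T e e' ∧ c' ≤ e' := by
  obtain ⟨t, ht, hen, rfl⟩ := h
  have hcount (i : Fin d) : c.count i ≤ e.count i := hce.2 i
  refine ⟨e.fire t, ⟨t, ht, ⟨hen.1.trans hce.1, fun i => ?_⟩, rfl⟩, rfl, fun i => ?_⟩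
  · linarith [hen.2 i, Int.ofNat_le.2 (hcount i)]
  · exact Int.toNat_le_toNat (by gcongr; exact hcount i)

section Levels

variable (S : VASSMDP Q d) (qF : Q)

lemma lfp_reachStep_winSet : (S.reachStep qF (S.winSet qF)).lfp = S.winSet qF :=
  (OrderHom.lfp.comp (S.reachStep qF)).map_gfp

lemma reachStep_winSet_winSet : S.reachStep qF (S.winSet qF) (S.winSet qF) = S.winSet qF := by
  have h := (S.reachStep qF (S.winSet qF)).map_lfp
  rwa [lfp_reachStep_winSet] at h

lemma winLevel_succ (n : ℕ) :
    S.winLevel qF (n + 1) = S.reachStep qF (S.winSet qF) (S.winLevel qF n) :=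
  Function.iterate_succ_apply' _ _ _

lemma winLevel_mono : Monotone (S.winLevel qF) :=
  (S.reachStep qF (S.winSet qF)).mono.monotone_iterate_of_le_map (Set.empty_subset _)

lemma winLevel_subset_winSet (n : ℕ) : S.winLevel qF n ⊆ S.winSet qF := by
  induction n with
  | zero => exact Set.empty_subset _
  | succ n ih =>
    have hlfp := S.lfp_reachStep_winSet qF
    calc
      S.winLevel qF (n + 1) = S.reachStep qF (S.winSet qF) (S.winLevel qF n) :=
        S.winLevel_succ qF n
      _ ⊆ (S.reachStep qF (S.winSet qF)).lfp := OrderHom.map_le_lfp _ (ih.trans_eq hlfp.symm)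
      _ = S.winSet qF := hlfp

lemma iUnion_winLevel : ⋃ n, S.winLevel qF n = S.winSet qF := by
  refine (Set.iUnion_subset (S.winLevel_subset_winSet qF)).antisymm ?_
  rw [← lfp_reachStep_winSet]
  refine OrderHom.lfp_le _ fun c hc => ?_
  suffices ∃ n, c ∈ S.reachStep qF (S.winSet qF) (S.winLevel qF n) by
    obtain ⟨n, hn⟩ := this
    exact Set.mem_iUnion.2 ⟨n + 1, (S.winLevel_succ qF n).symm ▸ hn⟩
  rcases hc with hF | ⟨hq, c', hstep, hW, hL⟩ | ⟨hq, ⟨c', hstep, hL⟩, hW⟩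
  · exact ⟨0, .inl hF⟩
  · obtain ⟨n, hn⟩ := Set.mem_iUnion.1 hL
    exact ⟨n, .inr (.inl ⟨hq, c', hstep, hW, hn⟩)⟩
  · obtain ⟨n, hn⟩ := Set.mem_iUnion.1 hL
    exact ⟨n, .inr (.inr ⟨hq, ⟨c', hstep, hn⟩, hW⟩)⟩

end Levels

namespace IsOneVASSMDP

variable [Fintype Q] [DecidableEq Q] {S : VASSMDP Q d} {qF : Q}

lemma effect_eq_zero (hS : S.IsOneVASSMDP) {t : VTrans Q d} (ht : t ∈ S.T) (hq : t.1 ∉ S.Q₁) :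
    t.2.1 = 0 :=
  hS t ht (by simp [QP, hq])

lemma enabled_of_state_notMem (hS : S.IsOneVASSMDP) {t : VTrans Q d} (ht : t ∈ S.T)
    {c : Config Q d} (hst : t.1 = c.state) (hc : c.state ∉ S.Q₁) : c.Enabled t :=
  ⟨hst, fun i => by simp [hS.effect_eq_zero ht (hst ▸ hc)]⟩

lemma exists_step_le (hS : S.IsOneVASSMDP) {c e e' : Config Q d} (h : VStep S.T e e')
    (hc : c.state ∉ S.Q₁) (hce : c ≤ e) : ∃ c', VStep S.T c c' ∧ c' ≤ e' := by
  obtain ⟨t, ht, hen, rfl⟩ := h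
  have hstate : t.1 = c.state := hen.1.trans hce.1.symm
  have hz := hS.effect_eq_zero ht (hstate ▸ hc)
  refine ⟨c.fire t, ⟨t, ht, hS.enabled_of_state_notMem ht hstate hc, rfl⟩, rfl, fun i => ?_⟩
  simpa [Config.fire, hz] using hce.2 i

lemma isUpperSet_reachStep (hS : S.IsOneVASSMDP) {X Y : Set (Config Q d)} (hX : IsUpperSet X)
    (hY : IsUpperSet Y) : IsUpperSet (S.reachStep qF X Y) := by
  rintro c e hce (h | ⟨h, c', hstep, hcX, hcY⟩ | ⟨h, ⟨c', hstep, hcY⟩, hcX⟩)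
  · exact .inl (hce.1.symm.trans h)
  · obtain ⟨e', hstep', hle⟩ := exists_step_ge hstep hce
    exact .inr (.inl ⟨hce.1 ▸ h, e', hstep', hX hle hcX, hY hle hcY⟩)
  · obtain ⟨e', hstep', hle⟩ := exists_step_ge hstep hce
    refine .inr (.inr ⟨hce.1 ▸ h, ⟨e', hstep', hY hle hcY⟩, fun e'' he'' => ?_⟩)
    obtain ⟨c'', hc'', hle'⟩ := hS.exists_step_le he'' h hce
    exact hX hle' (hcX c'' hc'')

theorem isUpperSet_winSet (hS : S.IsOneVASSMDP) : IsUpperSet (S.winSet qF) :=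
  isUpperSet_gfp fun _ hX => isUpperSet_lfp fun _ hY => hS.isUpperSet_reachStep hX hY

lemma isUpperSet_winLevel (hS : S.IsOneVASSMDP) (n : ℕ) : IsUpperSet (S.winLevel qF n) := by
  induction n with
  | zero => exact isUpperSet_empty
  | succ n ih => exact S.winLevel_succ qF n ▸ hS.isUpperSet_reachStep hS.isUpperSet_winSet ih

theorem exists_winLevel_eq_winSet (hS : S.IsOneVASSMDP) :
    ∃ N, S.winLevel qF N = S.winSet qF := by
  obtain ⟨N, hN⟩ := exists_iUnion_eq_of_isUpperSet (S.winLevel_mono qF) hS.isUpperSet_winLevel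
  exact ⟨N, hN ▸ S.iUnion_winLevel qF⟩

end IsOneVASSMDP

end VASSMDP

section IonescuTulcea

open Preorder Finset

section Succ

variable {X : ℕ → Type*} [∀ n, MeasurableSpace (X n)]
  {κ : (n : ℕ) → Kernel ((i : Iic n) → X i) (X (n + 1))} [∀ n, IsMarkovKernel (κ n)] {a k : ℕ}

lemma map_traj_frestrictLe_prodMk (hak : a ≤ k) (x₀ : (i : Iic a) → X i) :
    (Kernel.traj κ a x₀).map (fun ω => (frestrictLe k ω, ω (k + 1))) =
      (Kernel.traj κ a x₀).map (frestrictLe k) ⊗ₘ κ k := by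
  rw [Kernel.traj_map_frestrictLe_apply, Kernel.partialTraj_compProd_eq_map_traj hak]

lemma lintegral_traj_frestrictLe_prodMk (hak : a ≤ k) (x₀ : (i : Iic a) → X i)
    {f : ((i : Iic k) → X i) × X (k + 1) → ℝ≥0∞} (hf : Measurable f) :
    ∫⁻ ω, f (frestrictLe k ω, ω (k + 1)) ∂Kernel.traj κ a x₀ =
      ∫⁻ ω, ∫⁻ y, f (frestrictLe k ω, y) ∂κ k (frestrictLe k ω) ∂Kernel.traj κ a x₀ := by
  rw [← lintegral_map (g := fun ω : (n : ℕ) → X n => (frestrictLe k ω, ω (k + 1))) hf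
      (by fun_prop), map_traj_frestrictLe_prodMk hak, Measure.lintegral_compProd hf,
    lintegral_map (hf.lintegral_kernel_prod_right') (by fun_prop)]

lemma ae_traj_of_ae_kernel (hak : a ≤ k) (x₀ : (i : Iic a) → X i)
    {p : ((i : Iic k) → X i) → X (k + 1) → Prop} (hp : MeasurableSet {z : _ × _ | p z.1 z.2})
    (h : ∀ x, ∀ᵐ y ∂κ k x, p x y) :
    ∀ᵐ ω ∂Kernel.traj κ a x₀, p (frestrictLe k ω) (ω (k + 1)) := by
  have hprod : ∀ᵐ z ∂((Kernel.traj κ a x₀).map (frestrictLe k) ⊗ₘ κ k), p z.1 z.2 :=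
    (Measure.ae_compProd_iff hp).2 (.of_forall h)
  rw [← map_traj_frestrictLe_prodMk hak] at hprod
  exact ae_of_ae_map (by fun_prop) hprod

omit [∀ n, MeasurableSpace (X n)] in
lemma cylinder_succ_eq_preimage (ω : (n : ℕ) → X n) (k : ℕ) :
    PiNat.cylinder ω (k + 1) = frestrictLe k ⁻¹' {frestrictLe k ω} := by
  ext η
  simp [PiNat.cylinder, funext_iff]

lemma traj_cylinder_succ [∀ n, MeasurableSingletonClass (X n)] (hak : a ≤ k)
    (x₀ : (i : Iic a) → X i) (ω : (n : ℕ) → X n) :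
    Kernel.traj κ a x₀ (PiNat.cylinder ω (k + 2)) =
      κ k (frestrictLe k ω) {ω (k + 1)} * Kernel.traj κ a x₀ (PiNat.cylinder ω (k + 1)) := by
  have hpre : PiNat.cylinder ω (k + 2) = (fun η => (frestrictLe k η, η (k + 1))) ⁻¹'
      ({frestrictLe k ω} ×ˢ {ω (k + 1)}) := by
    ext η
    have hk := Set.ext_iff.1 (cylinder_succ_eq_preimage ω k) η
    simp only [PiNat.cylinder, Set.mem_ofPred_eq, Set.mem_preimage, Set.mem_singleton_iff] at hk
    simp only [PiNat.cylinder, Set.mem_ofPred_eq, Set.mem_preimage, Set.mem_prod,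
      Set.mem_singleton_iff, ← hk]
    exact Nat.forall_lt_succ_right
  rw [hpre, ← Measure.map_apply (by fun_prop)
      ((measurableSet_singleton _).prod (measurableSet_singleton _)),
    map_traj_frestrictLe_prodMk hak, Measure.compProd_apply_prod (measurableSet_singleton _)
      (measurableSet_singleton _), lintegral_singleton,
    Measure.map_apply (by fun_prop) (measurableSet_singleton _), cylinder_succ_eq_preimage]

lemma traj_cylinder_succ_self [∀ n, MeasurableSingletonClass (X n)] (ω : (n : ℕ) → X n) (a : ℕ) :
    Kernel.traj κ a (frestrictLe a ω) (PiNat.cylinder ω (a + 1)) = 1 := by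
  rw [cylinder_succ_eq_preimage, ← Measure.map_apply (by fun_prop) (measurableSet_singleton _),
    Kernel.traj_map_frestrictLe_apply, Kernel.partialTraj_self, Kernel.id_apply]
  simp

end Succ

section Drift

variable {E : Type*} [MeasurableSpace E] {κ : (n : ℕ) → Kernel (Iic n → E) E}
  [∀ n, IsMarkovKernel (κ n)] {B : Set E} {g : E → ℝ≥0∞}

lemma measurableSet_forall_le_mem (hB : MeasurableSet B) (k : ℕ) :
    MeasurableSet {ω : ℕ → E | ∀ i ≤ k, ω i ∈ B} := by
  measurability

lemma setLIntegral_traj_forall_le_mem_succ {a k : ℕ} (hak : a ≤ k) (hB : MeasurableSet B)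
    (hg : Measurable g) (x₀ : Iic a → E) :
    ∫⁻ ω in {ω | ∀ i ≤ k + 1, ω i ∈ B}, g (ω (k + 1)) ∂Kernel.traj (X := fun _ => E) κ a x₀ =
      ∫⁻ ω in {ω | ∀ i ≤ k, ω i ∈ B}, ∫⁻ y in B, g y ∂κ k (frestrictLe k ω)
        ∂Kernel.traj (X := fun _ => E) κ a x₀ := by
  set H : Set (Iic k → E) := Set.univ.pi fun _ => B
  have mem_H (ω : ℕ → E) : frestrictLe (π := fun _ => E) k ω ∈ H ↔ ∀ i ≤ k, ω i ∈ B := by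
    simp [H, Set.mem_pi]
  have hf : Measurable ((H ×ˢ B).indicator fun z => g z.2) :=
    (hg.comp measurable_snd).indicator ((MeasurableSet.univ_pi fun _ => hB).prod hB)
  have hstep := lintegral_traj_frestrictLe_prodMk (X := fun _ => E) (κ := κ) hak x₀ hf
  rw [← lintegral_indicator (measurableSet_forall_le_mem hB _),
    ← lintegral_indicator (measurableSet_forall_le_mem hB _)]
  classical
  convert! hstep using 2
  · ext ω
    have mem_succ : (∀ i ≤ k + 1, ω i ∈ B) ↔ (∀ i ≤ k, ω i ∈ B) ∧ ω (k + 1) ∈ B := by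
      simp only [Nat.le_succ_iff, or_imp, forall_and, forall_eq]
    simp [Set.indicator_apply, mem_H, mem_succ]
  · ext ω
    by_cases hω : ∀ i ≤ k, ω i ∈ B
    · rw [Set.indicator_of_mem (s := {ω : ℕ → E | ∀ i ≤ k, ω i ∈ B}) hω, ← lintegral_indicator hB]
      simp [Set.indicator_apply, (mem_H ω).2 hω]
    · rw [Set.indicator_of_notMem (s := {ω : ℕ → E | ∀ i ≤ k, ω i ∈ B}) hω]
      simp [mt (mem_H ω).1 hω]

/-- The Foster–Lyapunov criterion: as long as the process stays in `B`, the expectation of the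
potential `g` drops by the fixed amount `ε` in every step, which cannot go on forever. -/
theorem traj_forall_mem_eq_zero_of_drift (hB : MeasurableSet B) (hg : Measurable g) {ε : ℝ≥0∞}
    (hε : ε ≠ 0) {x₀ : Iic 0 → E} (hx₀ : g (x₀ ⟨0, mem_Iic.2 le_rfl⟩) ≠ ∞)
    (hdrift : ∀ n (h : Iic n → E), (∀ i, h i ∈ B) →
      ∫⁻ y in B, g y ∂κ n h + ε ≤ g (h ⟨n, mem_Iic.2 le_rfl⟩)) :
    Kernel.traj (X := fun _ => E) κ 0 x₀ {ω | ∀ n, ω n ∈ B} = 0 := by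
  set μ := Kernel.traj (X := fun _ => E) κ 0 x₀
  set P : ℝ≥0∞ := μ {ω | ∀ n, ω n ∈ B}
  let u (n : ℕ) : ℝ≥0∞ := ∫⁻ ω in {ω | ∀ i ≤ n, ω i ∈ B}, g (ω n) ∂μ
  have u_succ (n : ℕ) : u (n + 1) + ε * P ≤ u n := by
    have hP : P ≤ μ {ω | ∀ i ≤ n, ω i ∈ B} := measure_mono fun ω hω i _ => hω i
    calc
      u (n + 1) + ε * P ≤ u (n + 1) + ε * μ {ω | ∀ i ≤ n, ω i ∈ B} := by gcongr
      _ = ∫⁻ ω in {ω | ∀ i ≤ n, ω i ∈ B}, (∫⁻ y in B, g y ∂κ n (frestrictLe n ω) + ε) ∂μ := by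
        rw [lintegral_add_right _ measurable_const, setLIntegral_const]
        exact congrArg (· + _) (setLIntegral_traj_forall_le_mem_succ n.zero_le hB hg x₀)
      _ ≤ u n := setLIntegral_mono' (measurableSet_forall_le_mem hB n) fun ω hω =>
        hdrift n (frestrictLe n ω) fun i => hω i (mem_Iic.1 i.2)
  have u_zero : u 0 ≤ g (x₀ ⟨0, mem_Iic.2 le_rfl⟩) := by
    calc
      u 0 ≤ ∫⁻ ω, g (ω 0) ∂μ := setLIntegral_le_lintegral _ _
      _ = g (x₀ ⟨0, mem_Iic.2 le_rfl⟩) := by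
        rw [Kernel.lintegral_traj (X := fun _ => E) x₀ (f := fun ω => g (ω 0)) (by fun_prop)]
        simp [Function.updateFinset]
  have u_add_le (n : ℕ) : u n + n * (ε * P) ≤ u 0 := by
    induction n with
    | zero => simp
    | succ n ih =>
      calc
        u (n + 1) + (n + 1 : ℕ) * (ε * P) = u (n + 1) + ε * P + n * (ε * P) := by
          push_cast; ring
        _ ≤ u n + n * (ε * P) := by gcongr; exact u_succ n
        _ ≤ u 0 := ih
  by_contra hP
  obtain ⟨n, hn⟩ := ENNReal.exists_nat_mul_gt (mul_ne_zero hε hP) hx₀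
  exact absurd ((le_add_self.trans (u_add_le n)).trans u_zero) hn.not_ge

end Drift

end IonescuTulcea

namespace VASSMDP

variable {Q : Type*} {d : ℕ}

section NextLaw

variable {S : VASSMDP Q d} {σ : S.Strategy} {ρ : List (Config Q d)} {x y : Config Q d}

/-- `y` is a possible next configuration after `ρ · x` in a play that respects `σ`, with the
convention of `Outcome` that deadlocks are repeated. -/
def IsMove (S : VASSMDP Q d) (σ : S.Strategy) (ρ : List (Config Q d)) (x y : Config Q d) : Prop :=
  (VDeadlock S.T x → y = x) ∧ (¬ VDeadlock S.T x → x.state ∈ S.Q₁ → y = σ.next ρ x) ∧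
    (¬ VDeadlock S.T x → x.state ∉ S.Q₁ → VStep S.T x y)

lemma mem_enabled {t : VTrans Q d} : t ∈ S.enabled x ↔ t ∈ S.T ∧ x.Enabled t := by
  simp [enabled]

lemma ae_nextLaw_isMove : ∀ᵐ y ∂S.nextLaw σ ρ x, S.IsMove σ ρ x y := by
  rw [nextLaw]
  split_ifs with hdead hplayer
  · rw [ae_dirac_eq]
    exact ⟨fun _ => rfl, fun h => (h hdead).elim, fun h => (h hdead).elim⟩
  · rw [ae_dirac_eq]
    exact ⟨fun h => (hdead h).elim, fun _ _ => rfl, fun _ h => (h hplayer).elim⟩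
  · have hstep : ∀ᵐ y ∂S.prob x, VStep S.T x y := by
      refine Measure.ae_smul_measure ((ae_finsetSum_measure_iff).2 fun t ht =>
        Measure.ae_smul_measure ?_ _) _
      rw [ae_dirac_eq]
      exact ⟨t, (mem_enabled.1 ht).1, (mem_enabled.1 ht).2, rfl⟩
    filter_upwards [hstep] with y hy
    exact ⟨fun h => (hdead h).elim, fun _ h => (hplayer h).elim, fun _ _ => hy⟩

lemma le_prob_singleton (h : VStep S.T x y) (hx : x.state ∉ S.Q₁) :
    (∑ t ∈ S.T, (S.τ t : ℝ≥0∞) + 1)⁻¹ ≤ S.prob x {y} := by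
  obtain ⟨t, ht, hen, rfl⟩ := h
  have htx : t ∈ S.enabled x := mem_enabled.2 ⟨ht, hen⟩
  have hτ : 1 ≤ S.τ t := S.τ_pos t ht (hen.1 ▸ hx)
  calc
    (∑ t ∈ S.T, (S.τ t : ℝ≥0∞) + 1)⁻¹ ≤ (∑ t ∈ S.enabled x, (S.τ t : ℝ≥0∞))⁻¹ * 1 := by
      rw [mul_one]
      gcongr
      exact le_add_right (Finset.sum_le_sum_of_subset fun t ht => (mem_enabled.1 ht).1)
    _ ≤ (∑ t ∈ S.enabled x, (S.τ t : ℝ≥0∞))⁻¹ *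
        (∑ t ∈ S.enabled x, (S.τ t : ℝ≥0∞) • Measure.dirac (x.fire t)) {x.fire t} := by
      gcongr
      calc
        (1 : ℝ≥0∞) ≤ ((S.τ t : ℝ≥0∞) • Measure.dirac (x.fire t)) {x.fire t} := by
          simpa using mod_cast hτ
        _ ≤ _ := by
          rw [Measure.coe_finsetSum, Finset.sum_apply]
          exact Finset.single_le_sum
            (f := fun s => ((S.τ s : ℝ≥0∞) • Measure.dirac (x.fire s)) {x.fire t})
            (fun _ _ => zero_le) htx

lemma le_nextLaw_singleton (h : S.IsMove σ ρ x y) :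
    (∑ t ∈ S.T, (S.τ t : ℝ≥0∞) + 1)⁻¹ ≤ S.nextLaw σ ρ x {y} := by
  rw [nextLaw]
  split_ifs with hdead hplayer
  · simp [h.1 hdead]
  · simp [h.2.1 hdead hplayer]
  · exact le_prob_singleton (h.2.2 hdead hplayer) hplayer

lemma inv_sum_weight_add_one_ne_zero (S : VASSMDP Q d) :
    (∑ t ∈ S.T, (S.τ t : ℝ≥0∞) + 1)⁻¹ ≠ 0 := by
  simp [ENNReal.sum_eq_top]

lemma not_vDeadlock_of_step {T : Finset (VTrans Q d)} (h : VStep T x y) : ¬ VDeadlock T x :=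
  fun hdead => hdead y h

lemma isMove_of_step (h : VStep S.T x y) (hx : x.state ∉ S.Q₁) : S.IsMove σ ρ x y :=
  ⟨fun hdead => (hdead y h).elim, fun _ h' => (hx h').elim, fun _ _ => h⟩

end NextLaw

section PlayMeasure

variable (S : VASSMDP Q d) (c : Config Q d) (σ : S.Strategy)

/-- The sequences that behave like plays from `c` respecting `σ` during the first `k` moves. -/
def OutcomeUpTo (k : ℕ) : Set (ℕ → Config Q d) :=
  {ω | ω 0 = c ∧ ∀ i < k, S.IsMove σ (List.ofFn fun j : Fin i => ω j) (ω i) (ω (i + 1))}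

variable {S c σ}

lemma outcome_subset_outcomeUpTo (k : ℕ) : S.Outcome c σ ⊆ S.OutcomeUpTo c σ k :=
  fun _ h => ⟨h.1, fun i _ => h.2 i⟩

lemma update_mem_outcomeUpTo {ω : ℕ → Config Q d} {k : ℕ} {y : Config Q d}
    (hω : ω ∈ S.OutcomeUpTo c σ k) (hy : S.IsMove σ (List.ofFn fun j : Fin k => ω j) (ω k) y) :
    Function.update ω (k + 1) y ∈ S.OutcomeUpTo c σ (k + 1) := by
  have hup (i : ℕ) (hi : i ≤ k) : Function.update ω (k + 1) y i = ω i :=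
    Function.update_of_ne (by lia) _ _
  refine ⟨(hup 0 k.zero_le).trans hω.1, fun i hi => ?_⟩
  have hhist : (List.ofFn fun j : Fin i => Function.update ω (k + 1) y j) =
      List.ofFn fun j : Fin i => ω j :=
    congrArg List.ofFn (funext fun j => hup j (by lia))
  rw [hhist, hup i (by lia)]
  rcases (Nat.lt_succ_iff.1 hi).eq_or_lt with rfl | hik
  · rwa [Function.update_self]
  · rw [hup (i + 1) hik]
    exact hω.2 i hik

lemma measurableSet_reach (qF : Q) : MeasurableSet (Reach d qF) := by
  have hpre : Reach d qF = ⋃ i, (fun ω : ℕ → Config Q d => ω i) ⁻¹' {x | x.state = qF} := by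
    ext
    simp [Reach]
  rw [hpre]
  exact .iUnion fun i => measurableSet_preimage (measurable_pi_apply i) .of_discrete

variable [Finite Q]

instance : IsProbabilityMeasure (S.playMeasure c σ) := by
  unfold playMeasure
  infer_instance

lemma playMeasure_cylinder_ne_zero {ω : ℕ → Config Q d} {k : ℕ} (h : ω ∈ S.OutcomeUpTo c σ k) :
    S.playMeasure c σ (PiNat.cylinder ω (k + 1)) ≠ 0 := by
  induction k with
  | zero =>
    have hc : (fun _ => c) = Preorder.frestrictLe (π := fun _ => Config Q d) 0 ω := by
      funext i
      simp [Nat.le_zero.1 (Finset.mem_Iic.1 i.2), h.1]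
    rw [playMeasure, hc, traj_cylinder_succ_self]
    exact one_ne_zero
  | succ k ih =>
    rw [playMeasure, traj_cylinder_succ k.zero_le]
    have hmove := le_nextLaw_singleton (h.2 k k.lt_succ_self)
    exact mul_ne_zero
      ((S.inv_sum_weight_add_one_ne_zero.bot_lt.trans_le hmove).ne')
      (ih ⟨h.1, fun i hi => h.2 i (hi.trans k.lt_succ_self)⟩)

lemma ae_mem_outcome : ∀ᵐ ω ∂S.playMeasure c σ, ω ∈ S.Outcome c σ := by
  have hstart : ∀ᵐ ω ∂S.playMeasure c σ, ω 0 = c := by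
    have hcyl := traj_cylinder_succ_self (X := fun _ => Config Q d) (κ := S.kernel σ)
      (fun _ => c) 0
    have hset : PiNat.cylinder (fun _ => c) (0 + 1) = {ω : ℕ → Config Q d | ω 0 = c} := by
      simp [PiNat.cylinder]
    rw [hset] at hcyl
    exact (mem_ae_iff_prob_eq_one
      (measurableSet_eq_fun (measurable_pi_apply 0) measurable_const)).2 hcyl
  have hmove (k : ℕ) : ∀ᵐ ω ∂S.playMeasure c σ,
      S.IsMove σ (List.ofFn fun i : Fin k => ω i) (ω k) (ω (k + 1)) :=
    ae_traj_of_ae_kernel (X := fun _ => Config Q d) (κ := S.kernel σ)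
      (p := fun h y => S.IsMove σ (List.ofFn fun i : Fin k => h ⟨i, Finset.mem_Iic.2 i.2.le⟩)
        (h ⟨k, Finset.mem_Iic.2 le_rfl⟩) y)
      k.zero_le _ (Set.to_countable _).measurableSet fun _ => ae_nextLaw_isMove
  filter_upwards [hstart, ae_all_iff.2 hmove] with ω h0 h
  exact ⟨h0, h⟩

/-- A property of plays that holds almost surely is met by a play extending any given finite one. -/
lemma exists_mem_outcome_of_ae {p : Set (ℕ → Config Q d)} (hp : S.playMeasure c σ p = 1)
    (hpm : MeasurableSet p) {ω : ℕ → Config Q d} {k : ℕ} (hω : ω ∈ S.OutcomeUpTo c σ k) :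
    ∃ η ∈ S.Outcome c σ, η ∈ p ∧ ∀ i ≤ k, η i = ω i := by
  have hfreq : ∃ᵐ η ∂S.playMeasure c σ, η ∈ PiNat.cylinder ω (k + 1) :=
    frequently_ae_mem_iff.2 (playMeasure_cylinder_ne_zero hω)
  obtain ⟨η, hcyl, hη, hηp⟩ :=
    (hfreq.and_eventually (ae_mem_outcome.and ((mem_ae_iff_prob_eq_one hpm).2 hp))).exists
  exact ⟨η, hη, hηp, fun i hi => hcyl i (Nat.lt_succ_of_le hi)⟩

end PlayMeasure

section AlmostSureSubset

variable (S : VASSMDP Q d) (c : Config Q d) (σ : S.Strategy) (qF : Q)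

/-- The configurations that a play from `c` respecting `σ` can visit no later than it first visits
`qF`. -/
def visitedBefore : Set (Config Q d) :=
  {x | ∃ k, ∃ ω ∈ S.OutcomeUpTo c σ k, (∀ i < k, (ω i).state ≠ qF) ∧ ω k = x}

variable {S c σ qF}

lemma mem_visitedBefore_of_outcome {ω : ℕ → Config Q d} (hω : ω ∈ S.Outcome c σ) {k : ℕ}
    (hk : ∀ i < k, (ω i).state ≠ qF) : ω k ∈ S.visitedBefore c σ qF :=
  ⟨k, ω, outcome_subset_outcomeUpTo k hω, hk, rfl⟩

lemma mem_lfp_of_outcome_succ_mem {ω : ℕ → Config Q d} (hω : ω ∈ S.Outcome c σ) {k : ℕ}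
    (hk : ∀ i ≤ k, (ω i).state ≠ qF)
    (hnext : ω (k + 1) ∈ (S.reachStep qF (S.visitedBefore c σ qF)).lfp) :
    ω k ∈ (S.reachStep qF (S.visitedBefore c σ qF)).lfp := by
  obtain ⟨hdead, hplayer, hprob⟩ := hω.2 k
  by_cases hd : VDeadlock S.T (ω k)
  · exact hdead hd ▸ hnext
  rw [← OrderHom.map_lfp]
  by_cases hq : (ω k).state ∈ S.Q₁
  · refine .inr (.inl ⟨hq, ω (k + 1), ?_, ?_, hnext⟩)
    · exact hplayer hd hq ▸ σ.next_valid _ _ hq hd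
    · exact mem_visitedBefore_of_outcome hω fun i hi => hk i (Nat.lt_succ_iff.1 hi)
  · refine .inr (.inr ⟨hq, ⟨ω (k + 1), hprob hd hq, hnext⟩, fun y hy => ?_⟩)
    refine ⟨k + 1, _, update_mem_outcomeUpTo (outcome_subset_outcomeUpTo k hω)
      (isMove_of_step hy hq),
      fun i hi => ?_, Function.update_self ..⟩
    rw [Function.update_of_ne hi.ne]
    exact hk i (Nat.lt_succ_iff.1 hi)

theorem almostSureSet_subset_winSet [Finite Q] : S.almostSureSet qF ⊆ S.winSet qF := by
  rintro c ⟨σ, hσ⟩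
  suffices hpost : S.visitedBefore c σ qF ≤ (S.reachStep qF (S.visitedBefore c σ qF)).lfp from
    OrderHom.le_gfp (OrderHom.lfp.comp (S.reachStep qF)) hpost
      ⟨0, fun _ => c, ⟨rfl, fun _ h => (Nat.not_lt_zero _ h).elim⟩,
        fun _ h => (Nat.not_lt_zero _ h).elim, rfl⟩
  classical
  rintro x ⟨k, ω₀, hω₀, hk, rfl⟩
  obtain ⟨ω, hω, hreach, heq⟩ := exists_mem_outcome_of_ae hσ (measurableSet_reach qF) hω₀
  have hkm : k ≤ Nat.find hreach := (Nat.le_find_iff hreach k).2 fun i hi => heq i hi.le ▸ hk i hi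
  rw [← heq k le_rfl]
  refine Nat.decreasingInduction' (fun j hj _ hnext => mem_lfp_of_outcome_succ_mem hω
    (fun i hi => Nat.find_min hreach (hi.trans_lt hj)) hnext) hkm ?_
  rw [← OrderHom.map_lfp]
  exact .inl (Nat.find_spec hreach)

end AlmostSureSubset

end VASSMDP

theorem lintegral_add_mul_measure_singleton_le_one {E : Type*} [MeasurableSpace E]
    [MeasurableSingletonClass E] {ν : Measure E} [IsProbabilityMeasure ν] {f : E → ℝ≥0∞}
    (hf : ∀ᵐ y ∂ν, f y ≤ 1) {y : E} {b : ℝ≥0∞} (hb : f y + b ≤ 1) :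
    ∫⁻ z, f z ∂ν + b * ν {y} ≤ 1 := by
  calc
    ∫⁻ z, f z ∂ν + b * ν {y} = ∫⁻ z, f z + Set.indicator {y} (fun _ => b) z ∂ν := by
      rw [lintegral_add_right _ (measurable_const.indicator (measurableSet_singleton y)),
        lintegral_indicator_const (measurableSet_singleton y)]
    _ ≤ ∫⁻ _, 1 ∂ν := by
      refine lintegral_mono_ae (hf.mono fun z hz => ?_)
      by_cases hzy : z = y
      · simpa [hzy] using hb
      · simpa [hzy] using hz
    _ = 1 := by simp

namespace VASSMDP

variable {Q : Type*} {d : ℕ}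

section Rank

variable (S : VASSMDP Q d) (qF : Q)

/-- The least `n` with `c` in the level `n` of the winning set (`0` outside the winning set). -/
noncomputable def winRank (c : Config Q d) : ℕ := sInf {n | c ∈ S.winLevel qF n}

/-- `c'` is a successor of `c` in the winning set of smaller rank. -/
def RankStep (c c' : Config Q d) : Prop :=
  VStep S.T c c' ∧ c' ∈ S.winSet qF ∧ S.winRank qF c' < S.winRank qF c

variable {S qF} {c : Config Q d}

lemma mem_winLevel_winRank (hc : c ∈ S.winSet qF) : c ∈ S.winLevel qF (S.winRank qF c) := by
  rw [← iUnion_winLevel] at hc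
  exact Nat.sInf_mem (s := {n | c ∈ S.winLevel qF n}) (Set.mem_iUnion.1 hc)

lemma winRank_le {n : ℕ} (hc : c ∈ S.winLevel qF n) : S.winRank qF c ≤ n :=
  Nat.sInf_le hc

lemma exists_winRank_eq_succ (hc : c ∈ S.winSet qF) : ∃ n, S.winRank qF c = n + 1 := by
  refine Nat.exists_eq_succ_of_ne_zero fun h0 => ?_
  have hmem := mem_winLevel_winRank hc
  rw [h0] at hmem
  exact hmem

lemma mem_reachStep_winRank_lt (hc : c ∈ S.winSet qF) :
    c ∈ S.reachStep qF (S.winSet qF)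
      {c' | c' ∈ S.winSet qF ∧ S.winRank qF c' < S.winRank qF c} := by
  obtain ⟨n, hn⟩ := exists_winRank_eq_succ hc
  have hmem := mem_winLevel_winRank hc
  rw [hn, winLevel_succ] at hmem
  have hsub : S.winLevel qF n ⊆ {c' | c' ∈ S.winSet qF ∧ S.winRank qF c' < S.winRank qF c} :=
    fun c' hc' => ⟨S.winLevel_subset_winSet qF n hc', hn ▸ Nat.lt_succ_of_le (winRank_le hc')⟩
  exact (S.reachStep qF _).mono hsub hmem

lemma exists_rankStep (hc : c ∈ S.winSet qF) (hF : c.state ≠ qF) : ∃ c', S.RankStep qF c c' := by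
  rcases mem_reachStep_winRank_lt hc with h | ⟨-, c', hstep, -, h⟩ | ⟨-, ⟨c', hstep, h⟩, -⟩
  exacts [absurd h hF, ⟨c', hstep, h⟩, ⟨c', hstep, h⟩]

lemma mem_winSet_of_step (hc : c ∈ S.winSet qF) (hF : c.state ≠ qF) (hq : c.state ∉ S.Q₁)
    {c' : Config Q d} (hstep : VStep S.T c c') : c' ∈ S.winSet qF := by
  rcases mem_reachStep_winRank_lt hc with h | ⟨h, -⟩ | ⟨-, -, h⟩
  exacts [absurd h hF, absurd h hq, h c' hstep]

variable (S qF)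

open Classical in
/-- A successor of `c`, of smaller rank if possible (`c` itself if `c` is a deadlock). -/
noncomputable def rankSucc (c : Config Q d) : Config Q d :=
  if h : ∃ c', S.RankStep qF c c' then h.choose
  else if h : ∃ c', VStep S.T c c' then h.choose else c

variable {S qF}

lemma rankStep_rankSucc (hc : c ∈ S.winSet qF) (hF : c.state ≠ qF) :
    S.RankStep qF c (S.rankSucc qF c) := by
  have h := exists_rankStep hc hF
  rw [rankSucc, dif_pos h]
  exact h.choose_spec

lemma step_rankSucc (hc : ¬ VDeadlock S.T c) : VStep S.T c (S.rankSucc qF c) := by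
  simp only [VDeadlock, not_forall, not_not] at hc
  rw [rankSucc]
  split_ifs with h
  exacts [h.choose_spec.1, hc.choose_spec]

lemma rankSucc_of_deadlock (hc : VDeadlock S.T c) : S.rankSucc qF c = c := by
  rw [rankSucc, dif_neg (fun ⟨c', h⟩ => hc c' h.1), dif_neg (fun ⟨c', h⟩ => hc c' h)]

variable (S qF)

/-- The memoryless strategy that decreases the rank. -/
noncomputable def rankStrategy : S.Strategy where
  next _ c := S.rankSucc qF c
  next_valid _ _ _ h := step_rankSucc h

variable {S qF}

lemma isMove_rankSucc {ρ : List (Config Q d)} :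
    S.IsMove (S.rankStrategy qF) ρ c (S.rankSucc qF c) :=
  ⟨rankSucc_of_deadlock, fun _ _ => rfl, fun h _ => step_rankSucc h⟩

lemma iterate_rankSucc_mem_outcome :
    (fun k => (S.rankSucc qF)^[k] c) ∈ S.Outcome c (S.rankStrategy qF) := by
  refine ⟨rfl, fun k => ?_⟩
  simp only [Function.iterate_succ_apply']
  exact isMove_rankSucc

lemma winRank_iterate_rankSucc_add_le (hc : c ∈ S.winSet qF) {k : ℕ}
    (hk : ∀ i < k, ((S.rankSucc qF)^[i] c).state ≠ qF) :
    (S.rankSucc qF)^[k] c ∈ S.winSet qF ∧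
      S.winRank qF ((S.rankSucc qF)^[k] c) + k ≤ S.winRank qF c := by
  induction k with
  | zero => exact ⟨hc, le_rfl⟩
  | succ k ih =>
    obtain ⟨hmem, hle⟩ := ih fun i hi => hk i (hi.trans k.lt_succ_self)
    obtain ⟨-, hmem', hlt⟩ := rankStep_rankSucc hmem (hk k k.lt_succ_self)
    rw [Function.iterate_succ_apply']
    exact ⟨hmem', by lia⟩

lemma exists_iterate_rankSucc_state_eq (hc : c ∈ S.winSet qF) :
    ∃ k, ((S.rankSucc qF)^[k] c).state = qF := by
  by_contra! h
  have hle := (winRank_iterate_rankSucc_add_le hc (k := S.winRank qF c + 1) fun i _ => h i).2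
  lia

theorem exists_outcome_rankStrategy (hc : c ∈ S.winSet qF) :
    ∃ ω ∈ S.Outcome c (S.rankStrategy qF), ∃ i ≤ S.winRank qF c, (ω i).state = qF ∧
      (∀ j ≤ i, ω j ∈ S.winSet qF) ∧
      ∀ j < i, (ω j).state ∉ S.Q₁ → ∀ c', VStep S.T (ω j) c' → c' ∈ S.winSet qF := by
  classical
  have hreach := exists_iterate_rankSucc_state_eq hc
  have hbefore {j : ℕ} (hj : j ≤ Nat.find hreach) :=
    winRank_iterate_rankSucc_add_le hc fun i hi => Nat.find_min hreach (hi.trans_le hj)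
  refine ⟨_, iterate_rankSucc_mem_outcome, Nat.find hreach, ?_, Nat.find_spec hreach,
    fun j hj => (hbefore hj).1, fun j hj hq c' => ?_⟩
  · exact le_of_add_le_right (hbefore le_rfl).2
  · exact mem_winSet_of_step (hbefore hj.le).1 (Nat.find_min hreach hj) hq

end Rank

section AlmostSure

variable {S : VASSMDP Q d} {qF : Q} {c : Config Q d}

lemma ae_nextLaw_rankStrategy_mem_winSet (hc : c ∈ S.winSet qF) (hF : c.state ≠ qF)
    {ρ : List (Config Q d)} : ∀ᵐ y ∂S.nextLaw (S.rankStrategy qF) ρ c, y ∈ S.winSet qF := by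
  have hrank := rankStep_rankSucc hc hF
  have hdead := not_vDeadlock_of_step hrank.1
  filter_upwards [ae_nextLaw_isMove] with y hy
  by_cases hq : c.state ∈ S.Q₁
  · exact hy.2.1 hdead hq ▸ hrank.2.1
  · exact mem_winSet_of_step hc hF hq (hy.2.2 hdead hq)

open Classical in
/-- A potential that the strategy `rankStrategy` decreases on average: it is bounded by `1` on the
winning set, and there the further from `1` the smaller the rank. Halving the lower bound on the
transition probabilities makes a rank decrease outweigh all the other moves. -/
noncomputable def rankPotential (S : VASSMDP Q d) (qF : Q) (c : Config Q d) : ℝ≥0∞ :=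
  if c ∈ S.winSet qF then 1 - ((∑ t ∈ S.T, (S.τ t : ℝ≥0∞) + 1)⁻¹ / 2) ^ S.winRank qF c else ∞

lemma half_pow_add_half_pow_le {p : ℝ≥0∞} (hp : p ≤ 1) {k m n : ℕ} (hkm : k < m) (hkn : k < n) :
    (p / 2) ^ m + (p / 2) ^ n ≤ (p / 2) ^ k * p := by
  have hhalf : p / 2 ≤ 1 := ENNReal.half_le_self.trans hp
  calc
    (p / 2) ^ m + (p / 2) ^ n ≤ (p / 2) ^ (k + 1) + (p / 2) ^ (k + 1) := by
      gcongr ?_ + ?_ <;> exact pow_le_pow_right_of_le_one' hhalf ‹_›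
    _ = (p / 2) ^ k * p := by rw [pow_succ, ← mul_add, ENNReal.add_halves]

lemma lintegral_rankPotential_add_le {N : ℕ} (hN : S.winLevel qF N = S.winSet qF)
    (hF : c.state ≠ qF) (ρ : List (Config Q d)) :
    ∫⁻ y, S.rankPotential qF y ∂S.nextLaw (S.rankStrategy qF) ρ c +
      ((∑ t ∈ S.T, (S.τ t : ℝ≥0∞) + 1)⁻¹ / 2) ^ N ≤ S.rankPotential qF c := by
  by_cases hc : c ∈ S.winSet qF
  swap
  · simp [rankPotential, hc]
  set p := (∑ t ∈ S.T, (S.τ t : ℝ≥0∞) + 1)⁻¹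
  have hp_le : p ≤ 1 := ENNReal.inv_le_one.2 le_add_self
  have hhalf : p / 2 ≤ 1 := ENNReal.half_le_self.trans hp_le
  obtain ⟨-, hmem, hlt⟩ := rankStep_rankSucc hc hF
  set c' := S.rankSucc qF c
  have hbound : ∀ᵐ y ∂S.nextLaw (S.rankStrategy qF) ρ c, S.rankPotential qF y ≤ 1 := by
    filter_upwards [ae_nextLaw_rankStrategy_mem_winSet hc hF] with y hy
    simp [rankPotential, hy]
  have hc' : S.rankPotential qF c' + (p / 2) ^ S.winRank qF c' ≤ 1 := by
    rw [rankPotential, if_pos hmem, tsub_add_cancel_of_le (pow_le_one' hhalf _)]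
  have hprob : p ≤ S.nextLaw (S.rankStrategy qF) ρ c {c'} := le_nextLaw_singleton isMove_rankSucc
  rw [rankPotential, if_pos hc]
  have hne_top : (p / 2) ^ S.winRank qF c ≠ ∞ :=
    ENNReal.pow_ne_top (hhalf.trans_lt ENNReal.one_lt_top).ne
  refine ENNReal.le_sub_of_add_le_right hne_top ?_
  calc
    ∫⁻ y, S.rankPotential qF y ∂S.nextLaw (S.rankStrategy qF) ρ c + (p / 2) ^ N +
        (p / 2) ^ S.winRank qF c
      ≤ ∫⁻ y, S.rankPotential qF y ∂S.nextLaw (S.rankStrategy qF) ρ c +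
        (p / 2) ^ S.winRank qF c' * p := by
        rw [add_assoc]
        gcongr
        exact half_pow_add_half_pow_le hp_le (hlt.trans_le (winRank_le (hN ▸ hc))) hlt
    _ ≤ ∫⁻ y, S.rankPotential qF y ∂S.nextLaw (S.rankStrategy qF) ρ c +
        (p / 2) ^ S.winRank qF c' * S.nextLaw (S.rankStrategy qF) ρ c {c'} := by gcongr
    _ ≤ 1 := lintegral_add_mul_measure_singleton_le_one hbound hc'

theorem playMeasure_rankStrategy [Finite Q] {N : ℕ} (hN : S.winLevel qF N = S.winSet qF)
    (hc : c ∈ S.winSet qF) : S.playMeasure c (S.rankStrategy qF) (Reach d qF) = 1 := by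
  have hcompl : (Reach d qF)ᶜ = {ω | ∀ n, ω n ∈ {x : Config Q d | x.state ≠ qF}} := by
    ext
    simp [Reach]
  rw [← prob_compl_eq_zero_iff (measurableSet_reach qF), hcompl]
  refine traj_forall_mem_eq_zero_of_drift (g := S.rankPotential qF) .of_discrete .of_discrete
    (pow_ne_zero N (ENNReal.half_pos S.inv_sum_weight_add_one_ne_zero).ne') ?_ fun n h hh => ?_
  · simp [rankPotential, hc]
  · exact (add_le_add_left (setLIntegral_le_lintegral _ _) _).trans
      (lintegral_rankPotential_add_le hN (hh ⟨n, Finset.mem_Iic.2 le_rfl⟩) _)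

theorem IsOneVASSMDP.almostSureSet_eq_winSet [Fintype Q] [DecidableEq Q] (hS : S.IsOneVASSMDP) :
    S.almostSureSet qF = S.winSet qF := by
  obtain ⟨N, hN⟩ := hS.exists_winLevel_eq_winSet (qF := qF)
  exact almostSureSet_subset_winSet.antisymm fun c hc =>
    ⟨S.rankStrategy qF, playMeasure_rankStrategy hN hc⟩

end AlmostSure

end VASSMDP

/-! ### Energy games -/

namespace EnergyGame

variable {N ι : Type*}

/-- A choice of the opponent in an energy game: whether choosing it is an accepting event, and the
moves (a weight and a target) among which the player may answer. -/
abbrev Choice (N ι : Type*) := Bool × Finset ((ι → ℤ) × N)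

/-- From the credit `s.1` and the rank `s.2`, the player can answer the choice `o` by a move into
`X` that keeps the credit nonnegative, and that decreases the rank unless `o` is accepting. -/
def CanAnswer (X : N → Set ((ι → ℕ) × ℕ)) (o : Choice N ι) (s : (ι → ℕ) × ℕ) : Prop :=
  ∃ m ∈ o.2, ∃ s' ∈ X m.2, (∀ i, (s'.1 i : ℤ) = s.1 i + m.1 i) ∧ (o.1 = false → s'.2 < s.2)

/-- A family of credits and ranks in which the player can stay, whatever the opponent chooses among
the choices `A`: the player wins from each of them, with infinitely many accepting events. -/
def IsWinFamily (A : N → Finset (Choice N ι)) (X : N → Set ((ι → ℕ) × ℕ)) : Prop :=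
  ∀ n, ∀ s ∈ X n, ∀ o ∈ A n, CanAnswer X o s

/-- The player wins the energy game with choices `A` from some node and some initial credit. -/
def Winnable (A : N → Finset (Choice N ι)) : Prop :=
  ∃ X, IsWinFamily A X ∧ ∃ n, (X n).Nonempty

lemma CanAnswer.add_right {X Y : N → Set ((ι → ℕ) × ℕ)} {o : Choice N ι} {s t : (ι → ℕ) × ℕ}
    (h : CanAnswer X o s) (hXY : ∀ n, ∀ s ∈ X n, s + t ∈ Y n) : CanAnswer Y o (s + t) := by
  obtain ⟨m, hm, s', hs', hcredit, hrank⟩ := h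
  refine ⟨m, hm, s' + t, hXY _ _ hs', fun i => ?_, fun ho => Nat.add_lt_add_right (hrank ho) _⟩
  simp only [Prod.fst_add, Pi.add_apply, Nat.cast_add, hcredit i]
  ring

section Memoryless

open scoped Pointwise

variable [DecidableEq N] {A : N → Finset (Choice N ι)} {n₀ : N}

lemma IsWinFamily.of_update {C : Finset (Choice N ι)} {X : N → Set ((ι → ℕ) × ℕ)}
    (hX : IsWinFamily (Function.update A n₀ C) X) (h : X n₀ = ∅) : IsWinFamily A X := by
  intro n s hs o ho
  have hn : n ≠ n₀ := by
    rintro rfl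
    exact Set.notMem_empty s (h ▸ hs)
  exact hX n s hs o (by rwa [Function.update_of_ne hn])

/-- The player interleaves two plays, with a separate credit for each: while one of them is under
way, the other one waits at `n₀`. -/
lemma IsWinFamily.add {A₁ A₂ : Finset (Choice N ι)} {X₁ X₂ : N → Set ((ι → ℕ) × ℕ)}
    (hA : ∀ o ∈ A n₀, o ∈ A₁ ∨ o ∈ A₂) (h₁ : IsWinFamily (Function.update A n₀ A₁) X₁)
    (h₂ : IsWinFamily (Function.update A n₀ A₂) X₂) :
    IsWinFamily A fun n => (X₁ n + X₂ n₀) ∪ (X₁ n₀ + X₂ n) := by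
  set Z : N → Set ((ι → ℕ) × ℕ) := fun n => (X₁ n + X₂ n₀) ∪ (X₁ n₀ + X₂ n)
  have left {n s₁ s₂ o} (hs₁ : s₁ ∈ X₁ n) (hs₂ : s₂ ∈ X₂ n₀)
      (ho : o ∈ Function.update A n₀ A₁ n) : CanAnswer Z o (s₁ + s₂) :=
    (h₁ n s₁ hs₁ o ho).add_right fun _ _ hs => .inl (Set.add_mem_add hs hs₂)
  have right {n s₁ s₂ o} (hs₁ : s₁ ∈ X₁ n₀) (hs₂ : s₂ ∈ X₂ n)
      (ho : o ∈ Function.update A n₀ A₂ n) : CanAnswer Z o (s₁ + s₂) :=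
    add_comm s₂ s₁ ▸ (h₂ n s₂ hs₂ o ho).add_right fun _ s hs =>
      .inr (add_comm s s₁ ▸ Set.add_mem_add hs₁ hs)
  intro n s hs o ho
  by_cases hn : n = n₀
  · subst hn
    obtain ⟨s₁, hs₁, s₂, hs₂, rfl⟩ : s ∈ X₁ n + X₂ n := hs.elim id id
    rcases hA o ho with ho | ho
    · exact left hs₁ hs₂ (by rwa [Function.update_self])
    · exact right hs₁ hs₂ (by rwa [Function.update_self])
  · rcases hs with ⟨s₁, hs₁, s₂, hs₂, rfl⟩ | ⟨s₁, hs₁, s₂, hs₂, rfl⟩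
    · exact left hs₁ hs₂ (by rwa [Function.update_of_ne hn])
    · exact right hs₁ hs₂ (by rwa [Function.update_of_ne hn])

lemma Winnable.of_update {A₁ A₂ : Finset (Choice N ι)} (hA : ∀ o ∈ A n₀, o ∈ A₁ ∨ o ∈ A₂)
    (h₁ : Winnable (Function.update A n₀ A₁)) (h₂ : Winnable (Function.update A n₀ A₂)) :
    Winnable A := by
  obtain ⟨X₁, hX₁, hne₁⟩ := h₁
  obtain ⟨X₂, hX₂, hne₂⟩ := h₂
  rcases (X₁ n₀).eq_empty_or_nonempty with h₁ | h₁
  · exact ⟨X₁, hX₁.of_update h₁, hne₁⟩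
  rcases (X₂ n₀).eq_empty_or_nonempty with h₂ | h₂
  · exact ⟨X₂, hX₂.of_update h₂, hne₂⟩
  exact ⟨_, hX₁.add hA hX₂, n₀, (h₁.add h₂).inl⟩

end Memoryless

theorem exists_memoryless_of_not_winnable [Finite N] {A : N → Finset (Choice N ι)}
    (hne : ∀ n, (A n).Nonempty) (hA : ¬ Winnable A) :
    ∃ f : N → Choice N ι, (∀ n, f n ∈ A n) ∧ ¬ Winnable fun n => {f n} := by
  classical
  obtain ⟨B, hBA, ⟨hB, hBw⟩, hmin⟩ := exists_minimal_le_of_wellFoundedLT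
    (fun B : N → Finset (Choice N ι) => (∀ n, (B n).Nonempty) ∧ ¬ Winnable B) A ⟨hne, hA⟩
  have winnable_of_ssubset {n C} (hC : C ⊂ B n) (hCne : C.Nonempty) :
      Winnable (Function.update B n C) := by
    by_contra hw
    refine (update_lt_self_iff.2 hC).not_ge (hmin ⟨fun n' => ?_, hw⟩ (update_le_self_iff.2 hC.le))
    rcases eq_or_ne n' n with rfl | hn
    · rwa [Function.update_self]
    · rw [Function.update_of_ne hn]
      exact hB n'
  choose f hf using hB
  have heq (n : N) : B n = {f n} := by
    by_contra hn
    have hss : {f n} ⊂ B n := (Finset.singleton_subset_iff.2 (hf n)).ssubset_of_ne (Ne.symm hn)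
    have herase : ((B n).erase (f n)).Nonempty := by
      rw [Finset.erase_nonempty (hf n)]
      refine (Finset.Nonempty.exists_eq_singleton_or_nontrivial ⟨_, hf n⟩).resolve_left ?_
      rintro ⟨o, ho⟩
      obtain rfl : f n = o := Finset.mem_singleton.1 (ho ▸ hf n)
      exact hn ho
    refine hBw (.of_update (fun o ho => ?_)
      (winnable_of_ssubset hss (Finset.singleton_nonempty _))
      (winnable_of_ssubset (Finset.erase_ssubset (hf n)) herase))
    by_cases h : o = f n <;> simp [h, ho]
  exact ⟨f, fun n => hBA n (hf n), by rwa [← funext heq]⟩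

/-- An edge of a graph with weights in `ι → ℤ` and with accepting edges. -/
structure Edge (N ι : Type*) where
  src : N
  weight : ι → ℤ
  tgt : N
  acc : Bool

/-- `l` is a walk from `a` to `b` with edges in `E`. -/
def IsWalk (E : Set (Edge N ι)) : N → List (Edge N ι) → N → Prop
  | a, [], b => a = b
  | a, e :: l, b => e ∈ E ∧ e.src = a ∧ IsWalk E e.tgt l b

/-- The total weight of a collection of edges. -/
def effect (F : Multiset (Edge N ι)) : ι → ℤ := (F.map Edge.weight).sum

/-- The graph has a closed walk of nonnegative total weight through an accepting edge. -/
def HasAcceptingCycle (E : Set (Edge N ι)) : Prop :=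
  ∃ e ∈ E, e.acc = true ∧ ∃ l : List (Edge N ι),
    IsWalk E e.tgt l e.src ∧ 0 ≤ effect (Multiset.ofList (e :: l))

/-- The graph of the moves of the player against an opponent that always makes the choice `f n` at
the node `n`. -/
def graph (f : N → Choice N ι) : Set (Edge N ι) :=
  {e | (e.weight, e.tgt) ∈ (f e.src).2 ∧ e.acc = (f e.src).1}

lemma finite_graph [Finite N] (f : N → Choice N ι) : (graph f).Finite := by
  have hsub : graph f ⊆ ⋃ n, (fun m : (ι → ℤ) × N => ⟨n, m.1, m.2, (f n).1⟩) '' (f n).2 := by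
    rintro ⟨n, z, n', a⟩ ⟨hm, ha⟩
    obtain rfl : a = (f n).1 := ha
    exact Set.mem_iUnion.2 ⟨n, (z, n'), hm, rfl⟩
  exact (Set.finite_iUnion fun n => (f n).2.finite_toSet.image _).subset hsub

/-- The sum of the absolute values of the weights along a walk: a credit for which no counter
becomes negative. -/
def cost (l : List (Edge N ι)) (i : ι) : ℕ := (l.map fun e => (e.weight i).natAbs).sum

@[simp] lemma effect_zero : effect (0 : Multiset (Edge N ι)) = 0 := rfl

@[simp] lemma effect_coe_cons (e : Edge N ι) (l : List (Edge N ι)) :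
    effect (Multiset.ofList (e :: l)) = e.weight + effect (Multiset.ofList l) := by
  simp [effect]

@[simp] lemma cost_cons (e : Edge N ι) (l : List (Edge N ι)) (i : ι) :
    cost (e :: l) i = (e.weight i).natAbs + cost l i := by
  simp [cost]

theorem winnable_of_hasAcceptingCycle {f : N → Choice N ι} (h : HasAcceptingCycle (graph f)) :
    Winnable fun n => {f n} := by
  obtain ⟨e, he, hacc, l, hl, heff⟩ := h
  -- The player follows a walk back to `e`, with a credit left for another round of the cycle.
  refine ⟨fun n => {s | ∃ w, IsWalk (graph f) n w e.src ∧ s.2 = w.length ∧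
    (∀ i, cost w i ≤ s.1 i) ∧ ∀ i, (cost (e :: l) i : ℤ) ≤ s.1 i + effect (Multiset.ofList w) i},
    ?_, e.src, (cost (e :: l), 0), [], rfl, rfl, by simp [cost], by simp⟩
  rintro n ⟨u, -⟩ ⟨w, hw, rfl, hcost, hround⟩ _ ho
  obtain rfl := Finset.mem_singleton.1 ho
  cases w with
  | nil =>
    obtain rfl : n = e.src := hw
    refine ⟨_, he.1, (fun i => (u i + e.weight i).toNat, l.length), ⟨l, hl, rfl, fun i => ?_,
      fun i => ?_⟩, fun i => ?_, fun h => by simp [← he.2, hacc] at h⟩ <;>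
    · have := hround i
      have := heff i
      simp only [Multiset.coe_nil, effect_zero, effect_coe_cons, Pi.zero_apply, cost_cons,
        Pi.add_apply] at *
      omega
  | cons a w =>
    obtain ⟨ha, rfl, hw⟩ := hw
    refine ⟨_, ha.1, (fun i => (u i + a.weight i).toNat, w.length), ⟨w, hw, rfl, fun i => ?_,
      fun i => ?_⟩, fun i => ?_, fun _ => by simp⟩ <;>
    · have := hround i
      have := hcost i
      simp only [effect_coe_cons, cost_cons, Pi.add_apply] at *
      omega

end EnergyGame

/-! ### Closed walks and circulations -/

namespace EnergyGame

variable {N ι : Type*} {E : Set (Edge N ι)} {F G : Multiset (Edge N ι)} {a b c : N}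
  {l : List (Edge N ι)}

lemma isWalk_append {l' : List (Edge N ι)} :
    IsWalk E a (l ++ l') b ↔ ∃ c, IsWalk E a l c ∧ IsWalk E c l' b := by
  induction l generalizing a with
  | nil => simp [IsWalk]
  | cons e l ih => simp [IsWalk, ih, and_assoc]

lemma IsWalk.mono {E' : Set (Edge N ι)} (hE : E ⊆ E') (h : IsWalk E a l b) : IsWalk E' a l b := by
  induction l generalizing a with
  | nil => exact h
  | cons e l ih => exact ⟨hE h.1, h.2.1, ih h.2.2⟩

lemma HasAcceptingCycle.mono {E' : Set (Edge N ι)} (hE : E ⊆ E') (h : HasAcceptingCycle E) :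
    HasAcceptingCycle E' := by
  obtain ⟨e, he, hacc, l, hl, heff⟩ := h
  exact ⟨e, hE he, hacc, l, hl.mono hE, heff⟩

lemma IsWalk.map_src_add (h : IsWalk E a l b) :
    (Multiset.ofList l).map Edge.src + {b} = (Multiset.ofList l).map Edge.tgt + {a} := by
  induction l generalizing a with
  | nil =>
    obtain rfl : a = b := h
    rfl
  | cons e l ih =>
    obtain ⟨-, rfl, h⟩ := h
    rw [← Multiset.cons_coe, Multiset.map_cons, Multiset.map_cons, Multiset.cons_add, ih h,
      Multiset.cons_add, ← Multiset.singleton_add, ← Multiset.singleton_add]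
    abel

lemma exists_walk_le_of_map_src_add (hF : ∀ e ∈ F, e ∈ E)
    (h : F.map Edge.src + {b} = F.map Edge.tgt + {a}) :
    ∃ l : List (Edge N ι), IsWalk E a l b ∧ (l : Multiset (Edge N ι)) ≤ F := by
  induction hs : F.card generalizing F a with
  | zero =>
    obtain rfl := Multiset.card_eq_zero.1 hs
    exact ⟨[], by simpa [IsWalk] using h.symm, by simp⟩
  | succ s ih =>
    by_cases hab : a = b
    · exact ⟨[], hab, by simp⟩
    have ha : a ∈ F.map Edge.src + {b} := by simp [h]
    obtain ⟨e, he, rfl⟩ : ∃ e ∈ F, e.src = a := by simpa [hab] using ha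
    obtain ⟨F, rfl⟩ := Multiset.exists_cons_of_mem he
    have hbal : F.map Edge.src + {b} = F.map Edge.tgt + {e.tgt} := by
      rw [Multiset.map_cons, Multiset.map_cons, ← Multiset.singleton_add,
        ← Multiset.singleton_add] at h
      refine add_left_cancel (a := {e.src}) ?_
      rw [← add_assoc, h]
      abel
    obtain ⟨l, hl, hle⟩ := ih (fun g hg => hF g (Multiset.mem_cons_of_mem hg)) hbal
      (by simpa using hs)
    exact ⟨e :: l, ⟨hF e he, rfl, hl⟩, Multiset.cons_le_cons e hle⟩

/-- Every node is left as often as it is entered. -/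
def IsCirculation (F : Multiset (Edge N ι)) : Prop := F.map Edge.src = F.map Edge.tgt

lemma IsCirculation.add (hF : IsCirculation F) (hG : IsCirculation G) : IsCirculation (F + G) := by
  rw [IsCirculation, Multiset.map_add, Multiset.map_add, hF, hG]

lemma IsCirculation.sum {κ : Type*} {s : Finset κ} {f : κ → Multiset (Edge N ι)}
    (h : ∀ i ∈ s, IsCirculation (f i)) : IsCirculation (∑ i ∈ s, f i) :=
  Finset.sum_induction f IsCirculation (fun _ _ => .add) rfl h

lemma IsCirculation.of_add (h : IsCirculation (F + G)) (hF : IsCirculation F) :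
    IsCirculation G := by
  rw [IsCirculation, Multiset.map_add, Multiset.map_add, hF] at h
  exact add_left_cancel h

lemma IsWalk.isCirculation (h : IsWalk E a l a) : IsCirculation (l : Multiset (Edge N ι)) :=
  add_right_cancel h.map_src_add

lemma IsCirculation.exists_closed_walk_le (h : IsCirculation F) (hF : ∀ e ∈ F, e ∈ E)
    {e : Edge N ι} (he : e ∈ F) :
    ∃ l, IsWalk E e.tgt l e.src ∧ Multiset.ofList (e :: l) ≤ F := by
  obtain ⟨F, rfl⟩ := Multiset.exists_cons_of_mem he
  have hbal : F.map Edge.src + {e.src} = F.map Edge.tgt + {e.tgt} := by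
    rw [IsCirculation, Multiset.map_cons, Multiset.map_cons, ← Multiset.singleton_add,
      ← Multiset.singleton_add] at h
    rw [add_comm, h, add_comm]
  obtain ⟨l, hl, hle⟩ := exists_walk_le_of_map_src_add
    (fun g hg => hF g (Multiset.mem_cons_of_mem hg)) hbal
  exact ⟨l, hl, Multiset.cons_le_cons e hle⟩

lemma exists_closed_walk_coe_eq_add (hl : IsWalk E a l a) (hF : IsCirculation F)
    (hFl : ∀ e ∈ F, e ∈ l) (hFE : ∀ e ∈ F, e ∈ E) :
    ∃ w, IsWalk E a w a ∧ Multiset.ofList w = ↑l + F := by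
  induction hs : F.card using Nat.strong_induction_on generalizing F l with
  | _ s ih =>
    rcases Multiset.empty_or_exists_mem F with rfl | ⟨e, he⟩
    · exact ⟨l, hl, by simp⟩
    obtain ⟨r, hr, hrF⟩ := hF.exists_closed_walk_le hFE he
    obtain ⟨F, rfl⟩ := Multiset.le_iff_exists_add.1 hrF
    obtain ⟨l₁, l₂, rfl⟩ := List.append_of_mem (hFl e he)
    obtain ⟨_, h₁, heE, rfl, h₂⟩ := isWalk_append.1 hl
    have hround : IsWalk E e.src (e :: r) e.src := ⟨heE, rfl, hr⟩
    have hlong : IsWalk E a (l₁ ++ ((e :: r) ++ e :: l₂)) a :=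
      isWalk_append.2 ⟨_, h₁, isWalk_append.2 ⟨_, hround, heE, rfl, h₂⟩⟩
    have hcard : F.card < s := by
      rw [← hs, Multiset.card_add, Multiset.coe_card, List.length_cons]
      omega
    obtain ⟨w, hw, heq⟩ := ih F.card hcard hlong (hF.of_add hround.isCirculation)
      (fun g hg => by
        have := hFl g (Multiset.mem_add.2 (.inr hg))
        simp only [List.mem_append, List.mem_cons] at this ⊢
        tauto)
      (fun g hg => hFE g (Multiset.mem_add.2 (.inr hg))) rfl
    refine ⟨w, hw, ?_⟩
    rw [heq]
    simp only [← Multiset.coe_add, ← Multiset.cons_coe, ← Multiset.singleton_add]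
    abel

/-- The node `b` can be reached from the node `a`. -/
def Conn (E : Set (Edge N ι)) (a b : N) : Prop := ∃ l, IsWalk E a l b

lemma Conn.refl (a : N) : Conn E a a := ⟨[], rfl⟩

lemma Conn.trans (h : Conn E a b) (h' : Conn E b c) : Conn E a c := by
  obtain ⟨l, hl⟩ := h
  obtain ⟨l', hl'⟩ := h'
  exact ⟨l ++ l', isWalk_append.2 ⟨b, hl, hl'⟩⟩

lemma Conn.of_mem {e : Edge N ι} (he : e ∈ E) : Conn E e.src e.tgt := ⟨[e], he, rfl, rfl⟩

lemma Conn.symm (hE : ∀ e ∈ E, Conn E e.tgt e.src) (h : Conn E a b) : Conn E b a := by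
  obtain ⟨l, hl⟩ := h
  induction l generalizing a with
  | nil =>
    obtain rfl : a = b := hl
    exact .refl a
  | cons e l ih =>
    obtain ⟨he, rfl, hl⟩ := hl
    exact (ih hl).trans (hE e he)

lemma exists_closed_walk_forall_mem (hE : ∀ e ∈ E, ∀ g ∈ E, Conn E e.tgt g.src)
    {e₀ : Edge N ι} (he₀ : e₀ ∈ E) {s : Finset (Edge N ι)} (hs : ∀ e ∈ s, e ∈ E) :
    ∃ w, IsWalk E e₀.src w e₀.src ∧ ∀ e ∈ s, e ∈ w := by
  classical
  induction s using Finset.induction_on with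
  | empty => exact ⟨[], rfl, by simp⟩
  | insert e s _ ih =>
    obtain ⟨w, hw, hsw⟩ := ih fun g hg => hs g (Finset.mem_insert_of_mem hg)
    have he : e ∈ E := hs e (Finset.mem_insert_self e s)
    obtain ⟨l, hl⟩ := (Conn.of_mem he₀).trans (hE e₀ he₀ e he)
    obtain ⟨l', hl'⟩ := hE e he e₀ he₀
    refine ⟨l ++ e :: (l' ++ w),
      isWalk_append.2 ⟨_, hl, he, rfl, isWalk_append.2 ⟨_, hl', hw⟩⟩, fun g hg => ?_⟩
    rcases Finset.mem_insert.1 hg with rfl | hg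
    · simp
    · simp [hsw g hg]

lemma effect_add (F G : Multiset (Edge N ι)) : effect (F + G) = effect F + effect G := by
  simp [effect]

lemma effect_nsmul (k : ℕ) (F : Multiset (Edge N ι)) : effect (k • F) = k • effect F := by
  simp [effect, Multiset.map_nsmul, Multiset.sum_nsmul]

lemma effect_sum_nonneg {κ : Type*} {s : Finset κ} {f : κ → Multiset (Edge N ι)}
    (h : ∀ i ∈ s, 0 ≤ effect (f i)) : 0 ≤ effect (∑ i ∈ s, f i) :=
  Finset.sum_induction f (0 ≤ effect ·) (fun F G hF hG => effect_add F G ▸ add_nonneg hF hG)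
    le_rfl h

/-- A closed walk through all edges is completed to a closed walk that passes every edge as often as
a multiple of the circulation does. -/
lemma hasAcceptingCycle_of_isCirculation (hconn : ∀ e ∈ E, ∀ g ∈ E, Conn E e.tgt g.src)
    (hF : IsCirculation F) (heff : 0 ≤ effect F) (hFE : ∀ e, e ∈ F ↔ e ∈ E) {e₀ : Edge N ι}
    (he₀ : e₀ ∈ E) (hacc : e₀.acc = true) : HasAcceptingCycle E := by
  classical
  obtain ⟨w, hw, hcov⟩ := exists_closed_walk_forall_mem hconn he₀ (s := F.toFinset)
    fun e he => (hFE e).1 (Multiset.mem_toFinset.1 he)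
  have hFw (e : Edge N ι) (he : e ∈ F) : e ∈ w := hcov e (Multiset.mem_toFinset.2 he)
  have hwE (e : Edge N ι) (he : e ∈ w) : e ∈ E := by
    obtain ⟨l₁, l₂, rfl⟩ := List.append_of_mem he
    obtain ⟨_, -, he, -⟩ := isWalk_append.1 hw
    exact he
  have hle : (w : Multiset (Edge N ι)) ≤ w.length • F := by
    refine Multiset.le_iff_count.2 fun e => ?_
    by_cases he : e ∈ w
    · rw [Multiset.count_nsmul]
      exact (Multiset.count_le_card e _).trans
        (Nat.le_mul_of_pos_right _ (Multiset.count_pos.2 ((hFE e).2 (hwE e he))))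
    · simp [he]
  obtain ⟨G, hG⟩ := Multiset.le_iff_exists_add.1 hle
  have hGF (e : Edge N ι) (he : e ∈ G) : e ∈ F :=
    Multiset.mem_of_mem_nsmul (hG ▸ Multiset.mem_add.2 (.inr he))
  have hGcirc : IsCirculation G := by
    refine IsCirculation.of_add (F := w) (hG ▸ ?_) hw.isCirculation
    rw [IsCirculation, Multiset.map_nsmul, Multiset.map_nsmul, hF]
  obtain ⟨w', hw', heq⟩ := exists_closed_walk_coe_eq_add hw hGcirc (fun e he => hFw e (hGF e he))
    fun e he => (hFE e).1 (hGF e he)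
  have hmem : e₀ ∈ (w' : Multiset (Edge N ι)) :=
    heq ▸ Multiset.mem_add.2 (.inl (hFw e₀ ((hFE e₀).2 he₀)))
  obtain ⟨l₁, l₂, rfl⟩ := List.append_of_mem hmem
  obtain ⟨_, h₁, -, rfl, h₂⟩ := isWalk_append.1 hw'
  refine ⟨e₀, he₀, hacc, l₂ ++ l₁, isWalk_append.2 ⟨_, h₂, h₁⟩, ?_⟩
  have hperm : Multiset.ofList (e₀ :: (l₂ ++ l₁)) = Multiset.ofList (l₁ ++ e₀ :: l₂) :=
    Multiset.coe_eq_coe.2 (List.perm_append_comm (l₁ := e₀ :: l₂))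
  rw [hperm, heq, ← hG, effect_nsmul]
  exact nsmul_nonneg heff _

end EnergyGame

/-! ### The Farkas lemma -/

section Farkas

variable {K V κ : Type*} [Field K] [LinearOrder K] [IsStrictOrderedRing K] [AddCommGroup V]
  [Module K V] {a : κ → Module.Dual K V} {b : Module.Dual K V}

lemma apply_nonneg_of_mem_hull {s : Set κ} {x : V} (h : ∀ i ∈ s, 0 ≤ a i x)
    (hb : b ∈ PointedCone.hull K (a '' s)) : 0 ≤ b x := by
  induction hb using Submodule.span_induction with
  | mem b hb =>
    obtain ⟨i, hi, rfl⟩ := hb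
    exact h i hi
  | zero => rfl
  | add b c _ _ hb hc => exact add_nonneg hb hc
  | smul r b _ hb => exact mul_nonneg r.2 hb

theorem mem_hull_of_forall_nonneg {s : Finset κ} (h : ∀ x, (∀ i ∈ s, 0 ≤ a i x) → 0 ≤ b x) :
    b ∈ PointedCone.hull K (a '' s) := by
  classical
  induction s using Finset.induction_on generalizing a b with
  | empty =>
    obtain rfl : b = 0 := LinearMap.ext fun x =>
      le_antisymm (by simpa using h (-x) (by simp)) (h x (by simp))
    exact zero_mem _
  | insert j s _ ih =>
    have hmono : PointedCone.hull K (a '' s) ≤ PointedCone.hull K (a '' ↑(insert j s)) :=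
      Submodule.span_mono (Set.image_mono (Finset.coe_subset.2 (Finset.subset_insert j s)))
    by_cases hs : ∀ x, (∀ i ∈ s, 0 ≤ a i x) → 0 ≤ b x
    · exact hmono (ih hs)
    push Not at hs
    obtain ⟨x₀, hx₀, hbx₀⟩ := hs
    have hjx₀ : a j x₀ < 0 := by
      by_contra! hj0
      exact (h x₀ (Finset.forall_mem_insert .. |>.2 ⟨hj0, hx₀⟩)).not_gt hbx₀
    -- Project the functionals along `a j` to those that vanish at `x₀`.
    let π : Module.Dual K V →ₗ[K] Module.Dual K V :=
      LinearMap.id - ((Module.Dual.eval K V x₀).smulRight ((a j x₀)⁻¹ • a j))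
    have hπ (f : Module.Dual K V) (x : V) : π f x = f (x - (a j x / a j x₀) • x₀) := by
      simp only [π, LinearMap.sub_apply, LinearMap.id_apply, LinearMap.smulRight_apply,
        Module.Dual.eval_apply, LinearMap.smul_apply, smul_eq_mul, map_sub, map_smul]
      ring
    have hproj : π b ∈ PointedCone.hull K ((π ∘ a) '' s) := by
      refine ih fun x hx => ?_
      rw [hπ]
      refine h _ (Finset.forall_mem_insert .. |>.2 ⟨?_, fun i hi => (hπ _ _) ▸ hx i hi⟩)
      simp [hjx₀.ne]
    obtain ⟨f, hf, hfb⟩ : π b ∈ (PointedCone.hull K (a '' s)).map π := by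
      rwa [PointedCone.map, PointedCone.hull, Submodule.map_span, Set.image_image]
    have hb : b = f + ((b x₀ - f x₀) / a j x₀) • a j := by
      ext x
      have hx : π f x = π b x := LinearMap.congr_fun hfb x
      simp only [hπ, map_sub, map_smul, smul_eq_mul] at hx
      simp only [LinearMap.add_apply, LinearMap.smul_apply, smul_eq_mul]
      linear_combination -hx
    rw [hb]
    refine add_mem (hmono hf) (PointedCone.smul_mem _ ?_ ?_)
    · exact div_nonneg_of_nonpos (by linarith [apply_nonneg_of_mem_hull hx₀ hf]) hjx₀.le
    · exact Submodule.subset_span ⟨j, Finset.mem_coe.2 (Finset.mem_insert_self j s), rfl⟩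

end Farkas

/-! ### Lexicographic rankings -/

lemma exists_common_denominator {κ : Type*} (s : Finset κ) (r : κ → ℚ) :
    ∃ k : ℕ, 0 < k ∧ ∀ i ∈ s, ∃ z : ℤ, (z : ℚ) = k * r i := by
  refine ⟨∏ i ∈ s, (r i).den, Finset.prod_pos fun i _ => (r i).den_pos, fun i hi => ?_⟩
  obtain ⟨m, hm⟩ := Finset.dvd_prod_of_mem (fun i => (r i).den) hi
  refine ⟨m * (r i).num, ?_⟩
  rw [hm, Int.cast_mul, ← Rat.den_mul_eq_num]
  push_cast
  ring

lemma exists_nat_eq_mul_of_nonneg {k : ℕ} {r : ℚ} (hr : 0 ≤ r) (h : ∃ z : ℤ, (z : ℚ) = k * r) :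
    ∃ n : ℕ, (n : ℚ) = k * r := by
  obtain ⟨z, hz⟩ := h
  have h0 : 0 ≤ z := by exact_mod_cast hz ▸ mul_nonneg (Nat.cast_nonneg k) hr
  lift z to ℕ using h0
  exact ⟨z, by exact_mod_cast hz⟩

namespace EnergyGame

variable {N ι : Type*} [Fintype ι]

/-- The decrease of the potential `∑ i, y i * u i + p n` of the node `n` with counters `u` when the
edge `e` is traversed. -/
def Edge.drop {R : Type*} [CommRing R] (y : ι → R) (p : N → R) (e : Edge N ι) : R :=
  p e.src - p e.tgt - ∑ i, y i * e.weight i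

section CommRing

variable {R : Type*} [CommRing R]

lemma sum_map_drop_single_zero [DecidableEq ι] (F : Multiset (Edge N ι)) (i : ι) :
    (F.map (Edge.drop (Pi.single i (1 : R)) 0)).sum = -(effect F i : R) := by
  induction F using Multiset.induction_on with
  | empty => simp
  | cons e F ih =>
    rw [Multiset.map_cons, Multiset.sum_cons, ih]
    simp only [Edge.drop, Pi.zero_apply, sub_self, Pi.single_apply, ite_mul, one_mul, zero_mul,
      Finset.sum_ite_eq', Finset.mem_univ, ↓reduceIte, zero_sub, effect, Multiset.map_cons,
      Multiset.sum_cons, Pi.add_apply, Int.cast_add, neg_add_rev]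
    ring

lemma sum_map_drop_zero_single [DecidableEq N] (F : Multiset (Edge N ι)) (n : N) :
    (F.map (Edge.drop 0 (Pi.single n (1 : R)))).sum =
      (F.map Edge.src).count n - (F.map Edge.tgt).count n := by
  induction F using Multiset.induction_on with
  | empty => simp
  | cons e F ih =>
    rw [Multiset.map_cons, Multiset.sum_cons, ih]
    simp only [Edge.drop, Pi.single_apply, Pi.zero_apply, zero_mul, Finset.sum_const_zero, sub_zero,
      Multiset.map_cons, Multiset.count_cons, eq_comm (a := n), Nat.cast_add, Nat.cast_ite,
      Nat.cast_one, Nat.cast_zero]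
    ring

lemma drop_mul (k : R) (y : ι → R) (p : N → R) (e : Edge N ι) :
    e.drop (fun i => k * y i) (fun n => k * p n) = k * e.drop y p := by
  simp only [Edge.drop, mul_sub, Finset.mul_sum, mul_assoc]

lemma cast_drop (y : ι → ℤ) (p : N → ℤ) (e : Edge N ι) :
    ((e.drop y p : ℤ) : R) = e.drop (fun i => (y i : R)) fun n => (p n : R) := by
  simp [Edge.drop]

/-- The decrease along an edge as a linear functional of the potential. -/
def dropMap (e : Edge N ι) : Module.Dual R ((ι → R) × (N → R)) where
  toFun x := e.drop x.1 x.2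
  map_add' x x' := by
    simp only [Edge.drop, Prod.fst_add, Prod.snd_add, Pi.add_apply, add_mul,
      Finset.sum_add_distrib]
    ring
  map_smul' k x := drop_mul k x.1 x.2 e

end CommRing

lemma exists_combination_drop {K : Type*} [Field K] [LinearOrder K] [IsStrictOrderedRing K]
    {E : Finset (Edge N ι)} {e₀ : Edge N ι}
    (h : ∀ (y : ι → K) (p : N → K), 0 ≤ y → (∀ e ∈ E, 0 ≤ e.drop y p) → e₀.drop y p ≤ 0) :
    ∃ (u : Edge N ι → K) (v : ι → K), 0 ≤ u ∧ 0 ≤ v ∧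
      ∀ y p, e₀.drop y p + ∑ e ∈ E, u e * e.drop y p = -∑ i, v i * y i := by
  classical
  let a : Edge N ι ⊕ ι → Module.Dual K ((ι → K) × (N → K)) :=
    Sum.elim dropMap fun i => LinearMap.proj i ∘ₗ LinearMap.fst K _ _
  have hmem : -dropMap e₀ ∈ PointedCone.hull K (a '' ↑(E.disjSum (Finset.univ : Finset ι))) := by
    refine mem_hull_of_forall_nonneg fun x hx =>
      neg_nonneg.2 (h x.1 x.2 (fun i => ?_) fun e he => ?_)
    · exact hx (.inr i) (by simp)
    · exact hx (.inl e) (by simp [he])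
  obtain ⟨c, hc⟩ := (Submodule.mem_span_image_finset_iff_exists_fun' _).1 hmem
  refine ⟨fun e => c (.inl e), fun i => c (.inr i), fun e => (c (.inl e)).2,
    fun i => (c (.inr i)).2, fun y p => ?_⟩
  have hyp : ∑ e ∈ E, (c (.inl e) : K) * e.drop y p + ∑ i, (c (.inr i) : K) * y i =
      -e₀.drop y p := by
    have hyp := LinearMap.congr_fun hc (y, p)
    rw [Finset.sum_disjSum, LinearMap.add_apply, LinearMap.sum_apply, LinearMap.sum_apply] at hyp
    exact hyp
  linear_combination hyp

lemma exists_circulation_of_forall_drop_nonpos {E : Finset (Edge N ι)} {e₀ : Edge N ι}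
    (he₀ : e₀ ∈ E)
    (h : ∀ (y : ι → ℚ) (p : N → ℚ), 0 ≤ y → (∀ e ∈ E, 0 ≤ e.drop y p) → e₀.drop y p ≤ 0) :
    ∃ F : Multiset (Edge N ι), (∀ e ∈ F, e ∈ E) ∧ IsCirculation F ∧ 0 ≤ effect F ∧ e₀ ∈ F := by
  classical
  obtain ⟨u, v, hu, hv, huv⟩ := exists_combination_drop h
  obtain ⟨k, hk, hku⟩ := exists_common_denominator E u
  choose! m hm using fun e he => exists_nat_eq_mul_of_nonneg (hu e) (hku e he)
  let F := Multiset.replicate k e₀ + E.val.bind fun e => Multiset.replicate (m e) e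
  have hsum (y : ι → ℚ) (p : N → ℚ) :
      (F.map (Edge.drop y p)).sum = -(k * ∑ i, v i * y i) := by
    calc (F.map (Edge.drop y p)).sum = k * e₀.drop y p + ∑ e ∈ E, (m e : ℚ) * e.drop y p := by
          simp only [F, Multiset.map_add, Multiset.map_bind, Multiset.map_replicate,
            Multiset.sum_add, Multiset.sum_bind, Multiset.sum_replicate, nsmul_eq_mul]
          rfl
      _ = k * (e₀.drop y p + ∑ e ∈ E, u e * e.drop y p) := by
          rw [mul_add, Finset.mul_sum]
          congr 1
          exact Finset.sum_congr rfl fun e he => by rw [hm e he, mul_assoc]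
      _ = -(k * ∑ i, v i * y i) := by rw [huv, mul_neg]
  refine ⟨F, fun e he => ?_, Multiset.ext.2 fun n => ?_, fun i => ?_, ?_⟩
  · rcases Multiset.mem_add.1 he with he | he
    · exact Multiset.eq_of_mem_replicate he ▸ he₀
    · obtain ⟨g, hg, he⟩ := Multiset.mem_bind.1 he
      exact Multiset.eq_of_mem_replicate he ▸ hg
  · have hn := (sum_map_drop_zero_single F n).symm.trans (hsum 0 (Pi.single n 1))
    simp only [Pi.zero_apply, mul_zero, Finset.sum_const_zero, neg_zero, sub_eq_zero] at hn
    exact_mod_cast hn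
  · have hi := (sum_map_drop_single_zero F i).symm.trans (hsum (Pi.single i 1) 0)
    simp only [Pi.single_apply, mul_ite, mul_one, mul_zero, Finset.sum_ite_eq', Finset.mem_univ,
      if_true, neg_inj] at hi
    have heff : (0 : ℚ) ≤ effect F i := hi ▸ mul_nonneg (Nat.cast_nonneg k) (hv i)
    exact Int.cast_nonneg_iff.1 heff
  · exact Multiset.mem_add.2 (.inl (Multiset.mem_replicate.2 ⟨hk.ne', rfl⟩))

lemma exists_integral_potential [Finite N] {y : ι → ℚ} (hy : 0 ≤ y) (p : N → ℚ) :
    ∃ k : ℕ, 0 < k ∧ ∃ (y' : ι → ℕ) (p' : N → ℤ), ∀ e : Edge N ι,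
      ((e.drop (fun i => (y' i : ℤ)) p' : ℤ) : ℚ) = k * e.drop y p := by
  have := Fintype.ofFinite N
  obtain ⟨k, hk, hz⟩ := exists_common_denominator (Finset.univ : Finset (ι ⊕ N)) (Sum.elim y p)
  choose y' hy' using fun i => exists_nat_eq_mul_of_nonneg (hy i) (hz (.inl i) (Finset.mem_univ _))
  choose p' hp' using fun n => hz (.inr n) (Finset.mem_univ _)
  refine ⟨k, hk, y', p', fun e => ?_⟩
  rw [cast_drop, ← drop_mul]
  simp [hy', hp']

lemma exists_potential_of_connected [Finite N] {E : Finset (Edge N ι)}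
    (hconn : ∀ e ∈ E, ∀ g ∈ E, Conn (E : Set (Edge N ι)) e.tgt g.src) {e₀ : Edge N ι}
    (he₀ : e₀ ∈ E) (hacc : e₀.acc = true) (h : ¬HasAcceptingCycle (E : Set (Edge N ι))) :
    ∃ (y : ι → ℕ) (p : N → ℤ), (∀ e ∈ E, 0 ≤ e.drop (fun i => (y i : ℤ)) p) ∧
      ∃ e ∈ E, 0 < e.drop (fun i => (y i : ℤ)) p := by
  obtain ⟨e₁, he₁, y, p, hy, hE, hpos⟩ : ∃ e₁ ∈ E, ∃ (y : ι → ℚ) (p : N → ℚ), 0 ≤ y ∧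
      (∀ e ∈ E, 0 ≤ e.drop y p) ∧ 0 < e₁.drop y p := by
    by_contra! hno
    choose! F hFE hF heff hmem using fun e he =>
      exists_circulation_of_forall_drop_nonpos he (hno e he)
    refine h (hasAcceptingCycle_of_isCirculation hconn (F := ∑ e ∈ E, F e) (.sum hF)
      (effect_sum_nonneg heff) (fun e => ?_) he₀ hacc)
    rw [Multiset.mem_sum]
    exact ⟨fun ⟨g, hg, he⟩ => hFE g hg e he, fun he => ⟨e, he, hmem e he⟩⟩
  obtain ⟨k, hk, y', p', hdrop⟩ := exists_integral_potential hy p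
  have hk : (0 : ℚ) < k := by exact_mod_cast hk
  refine ⟨y', p', fun e he => ?_, e₁, he₁, ?_⟩
  · exact_mod_cast (hdrop e).symm ▸ mul_nonneg hk.le (hE e he)
  · exact_mod_cast (hdrop e₁).symm ▸ mul_pos hk hpos

/-- A family of affine functions of the counters with natural coefficients, one for each node. -/
structure AffineFamily (N ι : Type*) where
  coeff : N → ι → ℕ
  offset : N → ℕ

namespace AffineFamily

variable (f : AffineFamily N ι) (e : Edge N ι)

/-- The value of the function of the node `n`. -/
def value (n : N) (u : ι → ℕ) : ℕ := ∑ i, f.coeff n i * u i + f.offset n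

/-- The decrease of the value along an edge whose two ends have the same coefficients. -/
def drop : ℤ := e.drop (fun i => (f.coeff e.src i : ℤ)) fun n => f.offset n

/-- The value does not change along the edge, whatever the counters are. -/
def IsConstantAlong : Prop := f.coeff e.src = f.coeff e.tgt ∧ f.drop e = 0

/-- The value decreases along the edge by an amount that does not depend on the counters. -/
def DecreasesAlong : Prop := f.coeff e.src = f.coeff e.tgt ∧ 0 < f.drop e

variable {f e} {u v : ι → ℕ}

lemma value_tgt_add_drop (hf : f.coeff e.src = f.coeff e.tgt)
    (huv : ∀ i, (v i : ℤ) = u i + e.weight i) :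
    (f.value e.tgt v + f.drop e : ℤ) = f.value e.src u := by
  simp only [value, drop, Edge.drop, ← hf, Nat.cast_add, Nat.cast_sum, Nat.cast_mul, huv,
    mul_add, Int.cast_id, Finset.sum_add_distrib]
  ring

lemma IsConstantAlong.value_eq (h : f.IsConstantAlong e)
    (huv : ∀ i, (v i : ℤ) = u i + e.weight i) : f.value e.tgt v = f.value e.src u := by
  have := value_tgt_add_drop h.1 huv
  have := h.2
  omega

lemma DecreasesAlong.value_lt (h : f.DecreasesAlong e)
    (huv : ∀ i, (v i : ℤ) = u i + e.weight i) : f.value e.tgt v < f.value e.src u := by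
  have := value_tgt_add_drop h.1 huv
  have := h.2
  omega

end AffineFamily

section Ranking

variable {m : ℕ} (r : Fin m → AffineFamily N ι)

/-- The lexicographic ranking by the functions `r` decreases along the edge, or it does not change
and the edge is not accepting. -/
def LexDecreases (e : Edge N ι) : Prop :=
  (∃ j, (∀ i < j, (r i).IsConstantAlong e) ∧ (r j).DecreasesAlong e) ∨
    ((∀ i, (r i).IsConstantAlong e) ∧ e.acc = false)

/-- The lexicographic rank of the node `n` with counters `u`. -/
def lexRank (n : N) (u : ι → ℕ) : Lex (Fin m → ℕ) := toLex fun i => (r i).value n u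

variable {r}

lemma LexDecreases.lexRank_lt_or_eq {e : Edge N ι} {u v : ι → ℕ} (h : LexDecreases r e)
    (huv : ∀ i, (v i : ℤ) = u i + e.weight i) :
    lexRank r e.tgt v < lexRank r e.src u ∨
      lexRank r e.tgt v = lexRank r e.src u ∧ e.acc = false := by
  rcases h with ⟨j, hconst, hdec⟩ | ⟨hconst, hacc⟩
  · exact .inl ⟨j, fun i hi => (hconst i hi).value_eq huv, hdec.value_lt huv⟩
  · exact .inr ⟨funext fun i => (hconst i).value_eq huv, hacc⟩

end Ranking

variable {E : Finset (Edge N ι)}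

lemma exists_affineFamily_of_not_conn {e₁ : Edge N ι} (he₁ : e₁ ∈ E)
    (h : ¬Conn (E : Set (Edge N ι)) e₁.tgt e₁.src) :
    ∃ f : AffineFamily N ι, (∀ e ∈ E, f.IsConstantAlong e ∨ f.DecreasesAlong e) ∧
      ∃ e ∈ E, f.DecreasesAlong e := by
  classical
  let f : AffineFamily N ι :=
    ⟨0, fun n => if Conn (E : Set (Edge N ι)) e₁.tgt n then 0 else 1⟩
  have hdrop (e : Edge N ι) : f.drop e = f.offset e.src - f.offset e.tgt := by
    simp [AffineFamily.drop, Edge.drop, f]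
  refine ⟨f, fun e he => ?_, e₁, he₁, rfl, ?_⟩
  · have hle : 0 ≤ f.drop e := by
      rw [hdrop]
      by_cases hc : Conn (E : Set (Edge N ι)) e₁.tgt e.src
      · simp [f, hc, hc.trans (.of_mem he)]
      · simp only [f, hc, if_false]
        split_ifs <;> simp
    exact hle.eq_or_lt.imp (⟨rfl, ·.symm⟩) (⟨rfl, ·⟩)
  · rw [hdrop]
    simp [f, h, Conn.refl]

omit [Fintype ι] in
lemma Conn.restrict {E : Set (Edge N ι)} {C : Set N} (hC : ∀ e ∈ E, e.src ∈ C → e.tgt ∈ C)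
    {a b : N} (h : Conn E a b) (ha : a ∈ C) : Conn {e ∈ E | e.src ∈ C} a b := by
  obtain ⟨l, hl⟩ := h
  induction l generalizing a with
  | nil => exact ⟨[], hl⟩
  | cons e l ih =>
    obtain ⟨he, rfl, hl⟩ := hl
    exact (Conn.of_mem (E := {e ∈ E | e.src ∈ C}) ⟨he, ha⟩).trans (ih (hC e he ha) hl)

lemma exists_affineFamily_of_forall_conn [Finite N]
    (hE : ∀ e ∈ E, Conn (E : Set (Edge N ι)) e.tgt e.src) {e₀ : Edge N ι} (he₀ : e₀ ∈ E)
    (hacc : e₀.acc = true) (h : ¬HasAcceptingCycle (E : Set (Edge N ι))) :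
    ∃ f : AffineFamily N ι, (∀ e ∈ E, f.IsConstantAlong e ∨ f.DecreasesAlong e) ∧
      ∃ e ∈ E, f.DecreasesAlong e := by
  classical
  -- Restrict to the strongly connected component of `e₀`.
  let C : Set N := {n | Conn (E : Set (Edge N ι)) e₀.src n}
  have hmem {e} (he : e ∈ E) : e.tgt ∈ C ↔ e.src ∈ C :=
    ⟨fun hc => hc.trans (hE e he), fun hc => hc.trans (.of_mem he)⟩
  let F : Finset (Edge N ι) := {e ∈ E | e.src ∈ C}
  have hFE : (F : Set (Edge N ι)) ⊆ E := Finset.coe_subset.2 (Finset.filter_subset _ E)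
  have hconn (e) (he : e ∈ F) (g) (hg : g ∈ F) : Conn (F : Set (Edge N ι)) e.tgt g.src := by
    obtain ⟨he, hec⟩ := Finset.mem_filter.1 he
    have htgt : e.tgt ∈ C := (hmem he).2 hec
    rw [Finset.coe_filter]
    exact ((Conn.symm hE htgt).trans (Finset.mem_filter.1 hg).2).restrict
      (fun g hg => (hmem hg).2) htgt
  obtain ⟨y, p, hle, e₁, he₁, hlt⟩ := exists_potential_of_connected hconn
    (Finset.mem_filter.2 ⟨he₀, .refl _⟩) hacc fun h' => h (h'.mono hFE)
  obtain ⟨b, hb⟩ := (Set.finite_range p).bddBelow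
  let f : AffineFamily N ι :=
    ⟨fun n => if n ∈ C then y else 0, fun n => if n ∈ C then (p n - b).toNat else 0⟩
  have hcoeff {e} (he : e ∈ E) : f.coeff e.src = f.coeff e.tgt := by simp only [f, hmem he]
  have hdrop {e} (he : e ∈ F) : f.drop e = e.drop (fun i => (y i : ℤ)) p := by
    obtain ⟨he, hc⟩ := Finset.mem_filter.1 he
    have hsrc : b ≤ p e.src := hb ⟨_, rfl⟩
    have htgt : b ≤ p e.tgt := hb ⟨_, rfl⟩
    simp only [AffineFamily.drop, Edge.drop, f, hmem he, hc, if_true]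
    omega
  have he₁E : e₁ ∈ E := (Finset.mem_filter.1 he₁).1
  refine ⟨f, fun e he => ?_, e₁, he₁E, hcoeff he₁E, (hdrop he₁).symm ▸ hlt⟩
  by_cases hc : e.src ∈ C
  · have heF : e ∈ F := Finset.mem_filter.2 ⟨he, hc⟩
    have hle : 0 ≤ f.drop e := (hdrop heF).symm ▸ hle e heF
    exact hle.eq_or_lt.imp (⟨hcoeff he, ·.symm⟩) (⟨hcoeff he, ·⟩)
  · exact .inl ⟨hcoeff he, by simp [AffineFamily.drop, Edge.drop, f, hmem he, hc]⟩

/-- Remove the edges along which a new affine family decreases, and recurse on the others. -/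
theorem exists_lexDecreases_of_not_hasAcceptingCycle [Finite N]
    (h : ¬HasAcceptingCycle (E : Set (Edge N ι))) :
    ∃ (m : ℕ) (r : Fin m → AffineFamily N ι), ∀ e ∈ E, LexDecreases r e := by
  classical
  induction hs : E.card using Nat.strong_induction_on generalizing E with
  | _ s ih =>
    by_cases! hacc : ∀ e ∈ E, e.acc ≠ true
    · exact ⟨0, Fin.elim0, fun e he => .inr ⟨Fin.rec0, by simpa using hacc e he⟩⟩
    obtain ⟨e₀, he₀, hacc⟩ := hacc
    obtain ⟨f, hf, e₁, he₁, hlt⟩ : ∃ f : AffineFamily N ι,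
        (∀ e ∈ E, f.IsConstantAlong e ∨ f.DecreasesAlong e) ∧ ∃ e ∈ E, f.DecreasesAlong e := by
      by_cases! hall : ∀ e ∈ E, Conn (E : Set (Edge N ι)) e.tgt e.src
      · exact exists_affineFamily_of_forall_conn hall he₀ hacc h
      · obtain ⟨e₁, he₁, hne⟩ := hall
        exact exists_affineFamily_of_not_conn he₁ hne
    have hFE : E.filter f.IsConstantAlong ⊂ E :=
      Finset.filter_ssubset.2 ⟨e₁, he₁, fun hc => hlt.2.ne' hc.2⟩
    obtain ⟨m, r, hr⟩ := ih _ (hs ▸ Finset.card_lt_card hFE)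
      (fun h' => h (h'.mono (Finset.coe_subset.2 hFE.1))) rfl
    refine ⟨m + 1, Fin.cons f r, fun e he => ?_⟩
    rcases hf e he with hc | hd
    · rcases hr e (Finset.mem_filter.2 ⟨he, hc⟩) with ⟨j, hj, hdec⟩ | ⟨hall, hacc⟩
      · exact .inl ⟨j.succ, Fin.cases (fun _ => hc) fun i hi => hj i (Fin.succ_lt_succ_iff.1 hi),
          hdec⟩
      · exact .inr ⟨Fin.cases hc hall, hacc⟩
    · exact .inl ⟨0, fun i hi => absurd hi (Fin.not_lt_zero i), hd⟩

end EnergyGame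

/-! ### Certificates for configurations outside the winning set -/

/-- A downward closed set of configurations: a control-state with exclusive bounds on the counters,
where the bound `0` stands for no bound. -/
@[ext]
structure Region (Q : Type*) (d : ℕ) where
  state : Q
  bound : Fin d → ℕ

namespace Region

variable {Q : Type*} {d : ℕ}

/-- The configurations in the region. -/
def toSet (x : Region Q d) : Set (Config Q d) :=
  {c | c.state = x.state ∧ ∀ i, x.bound i = 0 ∨ c.count i < x.bound i}

/-- `t` is enabled in some configuration of the region. -/
def Enabled (x : Region Q d) (t : VTrans Q d) : Prop :=
  t.1 = x.state ∧ ∀ i, x.bound i = 0 ∨ 0 < (x.bound i : ℤ) + t.2.1 i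

/-- Firing `t` in the configurations of the region `x` leads into the region `y`. -/
def Step (x : Region Q d) (t : VTrans Q d) (y : Region Q d) : Prop :=
  t.2.2 = y.state ∧
    ∀ i, y.bound i = 0 ∨ (x.bound i ≠ 0 ∧ (x.bound i : ℤ) + t.2.1 i ≤ y.bound i)

variable {x y : Region Q d} {t : VTrans Q d} {c : Config Q d}

lemma enabled_of_mem_toSet (hc : c ∈ x.toSet) (ht : c.Enabled t) : x.Enabled t := by
  refine ⟨ht.1.trans hc.1, fun i => ?_⟩
  have := hc.2 i
  have := ht.2 i
  omega

lemma Step.fire_mem_toSet (h : x.Step t y) (hc : c ∈ x.toSet) (ht : c.Enabled t) :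
    c.fire t ∈ y.toSet := by
  refine ⟨h.1, fun i => ?_⟩
  have := h.2 i
  have := hc.2 i
  have := ht.2 i
  simp only [Config.fire]
  omega

end Region

namespace VASSMDP

open EnergyGame

section Certificates

variable {Q : Type*} {d : ℕ} {N : Type*} {m : ℕ}

/-- Firing `t` leads from the region of the node `n` into the region of `n'`, and the ranking `r`
decreases or, if the step is not accepting, does not change. -/
def CertStep (loc : N → Region Q d) (r : Fin m → AffineFamily N (Fin d)) (t : VTrans Q d)
    (n n' : N) (acc : Bool) : Prop :=
  (loc n).Step t (loc n') ∧ LexDecreases r ⟨n, t.2.1, n', acc⟩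

/-- A spoiling strategy of Player P on the regions `loc n`. At each node, either Player P is content
with any step, or he has an accepting step; the ranking bounds the number of accepting steps. -/
def IsLosingCert (S : VASSMDP Q d) (qF : Q) (loc : N → Region Q d)
    (r : Fin m → AffineFamily N (Fin d)) : Prop :=
  ∀ n, (loc n).state ≠ qF ∧
    ((∀ t ∈ S.T, (loc n).Enabled t → ∃ n', CertStep loc r t n n' false) ∨
      ((loc n).state ∉ S.Q₁ ∧ ∃ t ∈ S.T, t.1 = (loc n).state ∧ ∃ n', CertStep loc r t n n' true))

variable {S : VASSMDP Q d} {qF : Q} {loc : N → Region Q d} {r : Fin m → AffineFamily N (Fin d)}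

lemma CertStep.lexRank_lt_or_eq {t : VTrans Q d} {n n' : N} {acc : Bool}
    (h : CertStep loc r t n n' acc) {c : Config Q d} (ht : c.Enabled t) :
    lexRank r n' (c.fire t).count < lexRank r n c.count ∨
      lexRank r n' (c.fire t).count = lexRank r n c.count ∧ acc = false :=
  h.2.lexRank_lt_or_eq fun i => Int.toNat_of_nonneg (ht.2 i)

variable [Fintype Q] [DecidableEq Q]

lemma IsLosingCert.notMem_reachStep (hS : S.IsOneVASSMDP) (h : IsLosingCert S qF loc r) {n : N}
    {c : Config Q d} (hc : c ∈ (loc n).toSet) {X Y : Set (Config Q d)} (hYX : Y ⊆ X)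
    (hX : ∀ n', ∀ c' ∈ (loc n').toSet, lexRank r n' c'.count < lexRank r n c.count → c' ∉ X)
    (hY : ∀ n', ∀ c' ∈ (loc n').toSet, lexRank r n' c'.count = lexRank r n c.count → c' ∉ Y) :
    c ∉ S.reachStep qF X Y := by
  obtain ⟨hF, hopt⟩ := h n
  have notMem_of_certStep {t n'} (ht : c.Enabled t) (hstep : CertStep loc r t n n' false) :
      c.fire t ∉ Y := by
    have hmem := hstep.1.fire_mem_toSet hc ht
    rcases hstep.lexRank_lt_or_eq ht with hlt | ⟨heq, -⟩
    · exact fun h => hX n' _ hmem hlt (hYX h)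
    · exact hY n' _ hmem heq
  rintro (hF' | hstep)
  · exact hF (hc.1.symm.trans hF')
  rcases hopt with hfree | ⟨hq, t, ht, hst, n', hacc⟩
  · obtain ⟨_, ⟨t, ht, hen, rfl⟩, hmem⟩ : ∃ c', VStep S.T c c' ∧ c' ∈ Y := by
      rcases hstep with ⟨-, c', hstep, -, hmem⟩ | ⟨-, hex, -⟩
      exacts [⟨c', hstep, hmem⟩, hex]
    obtain ⟨n', hn'⟩ := hfree t ht (Region.enabled_of_mem_toSet hc hen)
    exact notMem_of_certStep hen hn' hmem
  · obtain ⟨-, -, hall⟩ := hstep.resolve_left fun h => hq (hc.1 ▸ h.1)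
    have hen : c.Enabled t :=
      hS.enabled_of_state_notMem ht (hst.trans hc.1.symm) (hc.1 ▸ hq)
    have hlt := (hacc.lexRank_lt_or_eq hen).resolve_right (by simp)
    exact hX n' _ (hacc.1.fire_mem_toSet hc hen) hlt (hall _ ⟨t, ht, hen, rfl⟩)

theorem IsLosingCert.notMem_winSet (hS : S.IsOneVASSMDP) (h : IsLosingCert S qF loc r) {n : N}
    {c : Config Q d} (hc : c ∈ (loc n).toSet) : c ∉ S.winSet qF := by
  induction hρ : lexRank r n c.count using WellFoundedLT.induction generalizing n c with
  | _ ρ ih =>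
    rw [← iUnion_winLevel, Set.mem_iUnion, not_exists]
    intro k
    induction k generalizing n c with
    | zero => exact Set.notMem_empty c
    | succ k ihk =>
      subst hρ
      rw [winLevel_succ]
      exact h.notMem_reachStep hS hc (S.winLevel_subset_winSet qF k)
        (fun n' c' hc' hlt => ih _ hlt hc' rfl) fun n' c' hc' heq => ihk hc' heq

end Certificates

end VASSMDP

section Truncation

variable {Q : Type*} {d : ℕ}

/-- Membership in `U` is monotone in the counters, and insensitive to what they are above `M`. -/
def IsDeterminedBelow (U : Set (Config Q d)) (M : ℕ) : Prop :=
  ∀ c ∈ U, ∀ c' : Config Q d, c'.state = c.state →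
    (∀ i, c.count i ≤ c'.count i ∨ M ≤ c'.count i) → c' ∈ U

lemma exists_isDeterminedBelow [Finite Q] {U : Set (Config Q d)} (hU : IsUpperSet U) :
    ∃ M, IsDeterminedBelow U M := by
  obtain ⟨B, hBU, hUB⟩ := exists_finset_subset_upperClosure U
  refine ⟨B.sup fun b => Finset.univ.sup b.count, fun c hc c' hstate hcount => ?_⟩
  obtain ⟨b, hb, hbc⟩ := hUB hc
  have hbM (i : Fin d) : b.count i ≤ B.sup fun b => Finset.univ.sup b.count :=
    (Finset.le_sup (f := b.count) (Finset.mem_univ i)).trans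
      (Finset.le_sup (f := fun b : Config Q d => Finset.univ.sup b.count) hb)
  exact hU (a := b) ⟨hbc.1.trans hstate.symm, fun i =>
    (hcount i).elim (hbc.2 i).trans (hbM i).trans⟩ (hBU hb)

namespace Region

variable {M : ℕ} {x : Region Q d} {t : VTrans Q d} {c : Config Q d} {U : Set (Config Q d)}

/-- The configuration of the region `x` with the largest counters, where the unbounded ones exceed
`M` by `u`. -/
def lift (M : ℕ) (x : Region Q d) (u : Fin d → ℕ) : Config Q d :=
  ⟨x.state, fun i => if x.bound i = 0 then u i + M else x.bound i - 1⟩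

/-- The largest configuration of the region `x` as far as `M` is concerned. -/
abbrev top (M : ℕ) (x : Region Q d) : Config Q d := x.lift M 0

/-- The region reached from `x` by firing `t`, where bounds above `M` are dropped. -/
def fire (M : ℕ) (x : Region Q d) (t : VTrans Q d) : Region Q d :=
  ⟨t.2.2, fun i => if x.bound i = 0 ∨ (M : ℤ) < x.bound i + t.2.1 i then 0
    else (x.bound i + t.2.1 i).toNat⟩

/-- The counters on which the region imposes a bound. -/
def bounded (x : Region Q d) : Finset (Fin d) := {i | x.bound i ≠ 0}

lemma mem_bounded {i : Fin d} : i ∈ x.bounded ↔ x.bound i ≠ 0 := by simp [bounded]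

lemma lift_mem_toSet (u : Fin d → ℕ) : x.lift M u ∈ x.toSet := by
  refine ⟨rfl, fun i => ?_⟩
  simp only [lift]
  split_ifs <;> omega

lemma top_mem (hU : IsDeterminedBelow U M) (hc : c ∈ x.toSet) (hcU : c ∈ U) : x.top M ∈ U := by
  refine hU c hcU _ hc.1.symm fun i => ?_
  have := hc.2 i
  simp only [lift, Pi.zero_apply]
  split_ifs <;> omega

lemma fire_bound_le (i : Fin d) : (x.fire M t).bound i ≤ M := by
  simp only [fire]
  split_ifs <;> omega

lemma bounded_fire_subset : (x.fire M t).bounded ⊆ x.bounded := by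
  intro i
  simp only [mem_bounded, fire]
  contrapose!
  intro h
  simp [h]

lemma Enabled.step_fire (h : x.Enabled t) : x.Step t (x.fire M t) := by
  refine ⟨rfl, fun i => ?_⟩
  have := h.2 i
  simp only [fire]
  split_ifs <;> omega

lemma Enabled.bounded_fire_of_effect_eq_zero (h : x.Enabled t) (hx : ∀ i, x.bound i ≤ M)
    (hz : t.2.1 = 0) : (x.fire M t).bounded = x.bounded := by
  ext i
  have := hx i
  have := h.2 i
  simp only [hz, Pi.zero_apply] at this
  simp only [mem_bounded, fire, hz, Pi.zero_apply]
  split_ifs <;> omega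

lemma Enabled.lift_fire (h : x.Enabled t) (hb : (x.fire M t).bounded = x.bounded)
    {u v : Fin d → ℕ} (hv : ∀ i, (v i : ℤ) = u i + t.2.1 i) :
    (x.lift M u).Enabled t ∧ (x.lift M u).fire t = (x.fire M t).lift M v := by
  constructor
  · refine ⟨h.1, fun i => ?_⟩
    have := h.2 i
    have := hv i
    simp only [lift]
    split_ifs <;> omega
  · ext i
    · rfl
    have hbound : (x.fire M t).bound i ≠ 0 ↔ x.bound i ≠ 0 := by simp only [← mem_bounded, hb]
    have := h.2 i
    have := hv i
    simp only [fire] at hbound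
    simp only [Config.fire, lift, fire]
    split_ifs at hbound ⊢ <;> omega

lemma Enabled.exists_enabled_of_top_fire_mem (h : x.Enabled t) (hU : IsDeterminedBelow U M)
    (hmem : (x.fire M t).top M ∈ U) : ∃ c ∈ x.toSet, c.Enabled t ∧ c.fire t ∈ U := by
  have hen : (x.lift M fun i => (t.2.1 i).natAbs).Enabled t := by
    refine ⟨h.1, fun i => ?_⟩
    have := h.2 i
    simp only [lift]
    split_ifs <;> omega
  refine ⟨_, lift_mem_toSet _, hen, hU _ hmem _ rfl fun i => ?_⟩
  have := h.2 i
  simp only [Config.fire, lift, fire, Pi.zero_apply]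
  split_ifs <;> omega

end Region

end Truncation

namespace VASSMDP

open EnergyGame

section LosingNodes

variable {Q : Type*} {d : ℕ} (S : VASSMDP Q d) (qF : Q) (M : ℕ)

/-- The regions with bounds at most `M` whose largest configuration is not winning. -/
abbrev LosingNode : Type _ :=
  {x : Region Q d // (∀ i, x.bound i ≤ M) ∧ x.top M ∉ S.winSet qF}

variable {S qF M}

/-- Every transition leads from the region `x` to a losing one. -/
def AllLosing (x : LosingNode S qF M) : Prop :=
  ∀ t ∈ S.T, x.1.Enabled t → (x.1.fire M t).top M ∉ S.winSet qF

lemma LosingNode.notMem_reachStep (x : LosingNode S qF M) (hM : IsDeterminedBelow (S.winSet qF) M)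
    {c : Config Q d} (hc : c ∈ x.1.toSet) : c ∉ S.reachStep qF (S.winSet qF) (S.winSet qF) := by
  rw [reachStep_winSet_winSet]
  exact fun hw => x.2.2 (Region.top_mem hM hc hw)

lemma LosingNode.allLosing_of_state_mem (x : LosingNode S qF M)
    (hM : IsDeterminedBelow (S.winSet qF) M) (hq : x.1.state ∈ S.Q₁) : AllLosing x := by
  intro t ht hen hw
  obtain ⟨c, hc, hcen, hcw⟩ := hen.exists_enabled_of_top_fire_mem hM hw
  exact x.notMem_reachStep hM hc
    (.inr (.inl ⟨hc.1 ▸ hq, c.fire t, ⟨t, ht, hcen, rfl⟩, hcw, hcw⟩))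

section Finite

variable [Finite Q]

instance : Finite (LosingNode S qF M) := by
  have hfin : ((Set.univ : Set Q) ×ˢ Set.Iic fun _ : Fin d => M).Finite :=
    Set.finite_univ.prod (Set.finite_Iic _)
  refine (hfin.subset ?_).of_finite_image
    (f := fun x : Region Q d => (x.state, x.bound)) (fun x _ y _ h => ?_) |>.to_subtype
  · rintro _ ⟨x, hx, rfl⟩
    exact ⟨Set.mem_univ _, hx.1⟩
  · exact Region.ext (congrArg Prod.fst h) (congrArg Prod.snd h)

noncomputable instance : Fintype (LosingNode S qF M) := Fintype.ofFinite _

open Classical in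
/-- The moves by transitions that lead from `x` to losing nodes. -/
noncomputable def losingMoves (x : LosingNode S qF M) :
    Finset ((Fin d → ℤ) × LosingNode S qF M) :=
  {m ∈ (S.T.image fun t => t.2.1) ×ˢ Finset.univ |
    ∃ t ∈ S.T, x.1.Enabled t ∧ t.2.1 = m.1 ∧ m.2.1 = x.1.fire M t}

lemma mem_losingMoves {x : LosingNode S qF M} {m : (Fin d → ℤ) × LosingNode S qF M} :
    m ∈ losingMoves x ↔ ∃ t ∈ S.T, x.1.Enabled t ∧ t.2.1 = m.1 ∧ m.2.1 = x.1.fire M t := by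
  simp only [losingMoves, Finset.mem_filter, Finset.mem_product, Finset.mem_image,
    Finset.mem_univ, and_true, and_iff_right_iff_imp]
  rintro ⟨t, ht, -, h, -⟩
  exact ⟨t, ht, h⟩

open Classical in
/-- The energy game on the losing nodes. Player P may let Player 1 choose the transition if none of
them leaves the losing nodes; in his own states he may also choose it, which is accepting. -/
noncomputable def losingChoices (x : LosingNode S qF M) :
    Finset (Choice (LosingNode S qF M) (Fin d)) :=
  (if AllLosing x then {(false, losingMoves x)} else ∅) ∪
    if x.1.state ∈ S.Q₁ then ∅ else (losingMoves x).image fun m => (true, {m})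

lemma mem_losingChoices {x : LosingNode S qF M} {o : Choice (LosingNode S qF M) (Fin d)} :
    o ∈ losingChoices x ↔ (AllLosing x ∧ o = (false, losingMoves x)) ∨
      (x.1.state ∉ S.Q₁ ∧ ∃ m ∈ losingMoves x, o = (true, {m})) := by
  simp only [losingChoices, Finset.mem_union]
  split_ifs with hall hq hq <;> simp [hall, hq, eq_comm]

end Finite

namespace IsOneVASSMDP

variable [Fintype Q] [DecidableEq Q]

lemma region_enabled (hS : S.IsOneVASSMDP) {x : Region Q d} {t : VTrans Q d} (ht : t ∈ S.T)
    (hst : t.1 = x.state) (hq : x.state ∉ S.Q₁) : x.Enabled t := by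
  refine ⟨hst, fun i => ?_⟩
  rw [hS.effect_eq_zero ht (hst ▸ hq), Pi.zero_apply]
  omega

lemma lift_fire (hS : S.IsOneVASSMDP) {x : Region Q d} (hx : ∀ i, x.bound i ≤ M) {t : VTrans Q d}
    (ht : t ∈ S.T) (hst : t.1 = x.state) (hq : x.state ∉ S.Q₁) (u : Fin d → ℕ) :
    (x.lift M u).fire t = (x.fire M t).lift M u := by
  have hz := hS.effect_eq_zero ht (hst ▸ hq)
  have hen := hS.region_enabled ht hst hq
  exact (hen.lift_fire (hen.bounded_fire_of_effect_eq_zero hx hz) fun i => by simp [hz]).2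

lemma fire_lift_mem_winSet (hS : S.IsOneVASSMDP) (hM : IsDeterminedBelow (S.winSet qF) M)
    {x : Region Q d} (hx : ∀ i, x.bound i ≤ M) {t : VTrans Q d} (ht : t ∈ S.T)
    (hst : t.1 = x.state) (hq : x.state ∉ S.Q₁) (hw : (x.fire M t).top M ∈ S.winSet qF)
    (u : Fin d → ℕ) : (x.lift M u).fire t ∈ S.winSet qF := by
  rw [hS.lift_fire hx ht hst hq]
  refine hM _ hw _ rfl fun i => ?_
  simp only [Region.lift, Pi.zero_apply]
  split_ifs <;> omega

lemma losingChoices_nonempty (hS : S.IsOneVASSMDP) (hM : IsDeterminedBelow (S.winSet qF) M)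
    (x : LosingNode S qF M) : (losingChoices x).Nonempty := by
  by_cases hall : AllLosing x
  · exact ⟨_, mem_losingChoices.2 (.inl ⟨hall, rfl⟩)⟩
  have hq : x.1.state ∉ S.Q₁ := mt (x.allLosing_of_state_mem hM) hall
  suffices ∃ m, m ∈ losingMoves x by
    obtain ⟨m, hm⟩ := this
    exact ⟨_, mem_losingChoices.2 (.inr ⟨hq, m, hm, rfl⟩)⟩
  -- Otherwise every transition leads to the winning set, which then contains the top of `x`.
  by_contra! hempty
  have fire_top_mem {t} (ht : t ∈ S.T) (hst : t.1 = x.1.state) :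
      (x.1.top M).fire t ∈ S.winSet qF := by
    rw [hS.lift_fire x.2.1 ht hst hq]
    by_contra hlose
    exact hempty (t.2.1, ⟨_, Region.fire_bound_le, hlose⟩)
      (mem_losingMoves.2 ⟨t, ht, hS.region_enabled ht hst hq, rfl, rfl⟩)
  simp only [AllLosing, not_forall, not_not] at hall
  obtain ⟨t, ht, hen, -⟩ := hall
  refine x.notMem_reachStep hM (Region.lift_mem_toSet 0) (.inr (.inr ⟨hq,
    ⟨_, ⟨t, ht, hS.enabled_of_state_notMem ht hen.1 hq, rfl⟩, fire_top_mem ht hen.1⟩, ?_⟩))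
  rintro _ ⟨t', ht', hen', rfl⟩
  exact fire_top_mem ht' hen'.1

end IsOneVASSMDP

end LosingNodes

section LosingGame

variable {Q : Type*} {d : ℕ} {S : VASSMDP Q d} {qF : Q} {M : ℕ}
  {X : LosingNode S qF M → Set ((Fin d → ℕ) × ℕ)}

/-- A node where the family `X` is nonempty and that bounds the fewest counters. From such nodes, no
bound is dropped any more. -/
def IsTight (X : LosingNode S qF M → Set ((Fin d → ℕ) × ℕ)) (x : LosingNode S qF M) : Prop :=
  (X x).Nonempty ∧ ∀ y, (X y).Nonempty → x.1.bounded.card ≤ y.1.bounded.card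

/-- The configurations that the positions of rank `k` at the tight nodes stand for. -/
def tightConfigs (X : LosingNode S qF M → Set ((Fin d → ℕ) × ℕ)) (k : ℕ) : Set (Config Q d) :=
  {c | ∃ x, IsTight X x ∧ ∃ u, (u, k) ∈ X x ∧ c = x.1.lift M u}

lemma IsTight.lift_fire {x y : LosingNode S qF M} (hx : IsTight X x) {t : VTrans Q d}
    (ht : x.1.Enabled t) (hy : y.1 = x.1.fire M t) {u v : Fin d → ℕ} {k : ℕ} (hv : (v, k) ∈ X y)
    (huv : ∀ i, (v i : ℤ) = u i + t.2.1 i) :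
    (x.1.lift M u).Enabled t ∧ (x.1.lift M u).fire t ∈ tightConfigs X k := by
  have hb : (x.1.fire M t).bounded = x.1.bounded :=
    Finset.eq_of_subset_of_card_le Region.bounded_fire_subset (hy ▸ hx.2 y ⟨_, hv⟩)
  obtain ⟨hen, hfire⟩ := ht.lift_fire hb huv
  refine ⟨hen, y, ⟨⟨_, hv⟩, fun z hz => ?_⟩, v, hv, hy ▸ hfire⟩
  rw [hy, hb]
  exact hx.2 z hz

lemma IsTight.exists_step [Finite Q] {x : LosingNode S qF M} (hx : IsTight X x)
    (hX : IsWinFamily losingChoices X) {u : Fin d → ℕ} {k : ℕ} (hu : (u, k) ∈ X x)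
    (hall : AllLosing x) :
    ∃ c', VStep S.T (x.1.lift M u) c' ∧ ∃ j < k, c' ∈ tightConfigs X j := by
  obtain ⟨m, hm, ⟨v, j⟩, hv, huv, hjk⟩ := hX x _ hu _ (mem_losingChoices.2 (.inl ⟨hall, rfl⟩))
  obtain ⟨t, ht, hen, htm, hy⟩ := mem_losingMoves.1 hm
  obtain ⟨hen', hmem⟩ := hx.lift_fire hen hy hv (htm ▸ huv)
  exact ⟨_, ⟨t, ht, hen', rfl⟩, j, hjk rfl, hmem⟩

variable [Fintype Q] [DecidableEq Q]

lemma IsTight.fire_mem (hS : S.IsOneVASSMDP) (hM : IsDeterminedBelow (S.winSet qF) M)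
    {x : LosingNode S qF M} (hx : IsTight X x) (hX : IsWinFamily losingChoices X)
    {u : Fin d → ℕ} {k : ℕ} (hu : (u, k) ∈ X x) (hq : x.1.state ∉ S.Q₁) {t : VTrans Q d}
    (ht : t ∈ S.T) (hst : t.1 = x.1.state) :
    (x.1.lift M u).fire t ∈ S.winSet qF ∪ ⋃ j, tightConfigs X j := by
  have hen := hS.region_enabled ht hst hq
  by_cases hw : (x.1.fire M t).top M ∈ S.winSet qF
  · exact .inl (hS.fire_lift_mem_winSet hM x.2.1 ht hst hq hw u)
  · let m : (Fin d → ℤ) × LosingNode S qF M := (t.2.1, ⟨_, Region.fire_bound_le, hw⟩)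
    have hm : m ∈ losingMoves x := mem_losingMoves.2 ⟨t, ht, hen, rfl, rfl⟩
    obtain ⟨m', hm', ⟨v, j⟩, hv, huv, -⟩ :=
      hX x _ hu (true, {m}) (mem_losingChoices.2 (.inr ⟨hq, m, hm, rfl⟩))
    obtain rfl := Finset.mem_singleton.1 hm'
    exact .inr (Set.mem_iUnion.2 ⟨j, (hx.lift_fire hen rfl hv huv).2⟩)

lemma tightConfigs_subset_winSet (hS : S.IsOneVASSMDP) (hM : IsDeterminedBelow (S.winSet qF) M)
    (hX : IsWinFamily losingChoices X) (k : ℕ) : tightConfigs X k ⊆ S.winSet qF := by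
  refine le_gfp_lfp_of_ranked (f := S.reachStep qF) (x := tightConfigs X) rfl (fun k => ?_) k
  rintro _ ⟨x, hx, u, hu, rfl⟩
  have exists_step (hall : AllLosing x) : ∃ c', VStep S.T (x.1.lift M u) c' ∧
      c' ∈ ⋃ j < k, tightConfigs X j := by
    obtain ⟨c', hstep, j, hj, hc'⟩ := hx.exists_step hX hu hall
    exact ⟨c', hstep, Set.mem_iUnion₂.2 ⟨j, hj, hc'⟩⟩
  by_cases hq : x.1.state ∈ S.Q₁
  · obtain ⟨c', hstep, hc'⟩ := exists_step (x.allLosing_of_state_mem hM hq)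
    exact .inr (.inl ⟨hq, c', hstep, .inr (Set.iUnion₂_subset_iUnion _ _ hc'), .inr hc'⟩)
  refine .inr (.inr ⟨hq, ?_, ?_⟩)
  · by_cases hall : AllLosing x
    · obtain ⟨c', hstep, hc'⟩ := exists_step hall
      exact ⟨c', hstep, .inr hc'⟩
    · simp only [AllLosing, not_forall, not_not] at hall
      obtain ⟨t, ht, hen, hw⟩ := hall
      exact ⟨_, ⟨t, ht, hS.enabled_of_state_notMem ht hen.1 hq, rfl⟩,
        .inl (hS.fire_lift_mem_winSet hM x.2.1 ht hen.1 hq hw u)⟩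
  · rintro _ ⟨t, ht, hen, rfl⟩
    exact hx.fire_mem hS hM hX hu hq ht hen.1

theorem IsOneVASSMDP.not_winnable_losingChoices (hS : S.IsOneVASSMDP)
    (hM : IsDeterminedBelow (S.winSet qF) M) :
    ¬Winnable (losingChoices : LosingNode S qF M → _) := by
  rintro ⟨X, hX, hne⟩
  obtain ⟨x, hne_x, hmin⟩ := Set.exists_min_image {x | (X x).Nonempty}
    (fun x => x.1.bounded.card) (Set.toFinite _) hne
  obtain ⟨⟨u, k⟩, hu⟩ := hne_x
  have hw : x.1.lift M u ∈ S.winSet qF :=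
    tightConfigs_subset_winSet hS hM hX k ⟨x, ⟨⟨_, hu⟩, hmin⟩, u, hu, rfl⟩
  exact x.2.2 (Region.top_mem hM (Region.lift_mem_toSet u) hw)

end LosingGame

section LosingCert

variable {Q : Type*} {d : ℕ} {S : VASSMDP Q d} {qF : Q} {M : ℕ}

lemma isLosingCert_of_lexDecreases [Finite Q] (hM : IsDeterminedBelow (S.winSet qF) M)
    {f : LosingNode S qF M → Choice (LosingNode S qF M) (Fin d)} (hf : ∀ x, f x ∈ losingChoices x)
    {m : ℕ} {r : Fin m → AffineFamily (LosingNode S qF M) (Fin d)}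
    (hr : ∀ e ∈ graph f, LexDecreases r e) : IsLosingCert S qF Subtype.val r := by
  intro x
  refine ⟨fun h =>
    LosingNode.notMem_reachStep x hM (Region.lift_mem_toSet (M := M) 0) (.inl h), ?_⟩
  have certStep {t} (ht : x.1.Enabled t) {y : LosingNode S qF M} (hy : y.1 = x.1.fire M t)
      {b moves} (hfx : f x = (b, moves)) (hmem : (t.2.1, y) ∈ moves) :
      CertStep Subtype.val r t x y b :=
    ⟨hy ▸ ht.step_fire, hr _ (by simp [graph, hfx, hmem])⟩
  rcases mem_losingChoices.1 (hf x) with ⟨hall, hfx⟩ | ⟨hq, ⟨z, y⟩, hm, hfx⟩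
  · refine .inl fun t ht hen => ?_
    let y : LosingNode S qF M := ⟨_, Region.fire_bound_le, hall t ht hen⟩
    exact ⟨y, certStep hen rfl hfx (mem_losingMoves.2 ⟨t, ht, hen, rfl, rfl⟩)⟩
  · obtain ⟨t, ht, hen, rfl, hy⟩ := mem_losingMoves.1 hm
    exact .inr ⟨hq, t, ht, hen.1, y, certStep hen hy hfx (Finset.mem_singleton_self _)⟩

lemma exists_losingNode (hM : IsDeterminedBelow (S.winSet qF) M) {c : Config Q d}
    (hc : c ∉ S.winSet qF) : ∃ x : LosingNode S qF M, c ∈ x.1.toSet := by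
  let x : Region Q d := ⟨c.state, fun i => if c.count i < M then c.count i + 1 else 0⟩
  refine ⟨⟨x, fun i => ?_, fun hw => hc (hM _ hw _ rfl fun i => ?_)⟩, rfl, fun i => ?_⟩
  · simp only [x]
    split_ifs <;> omega
  · by_cases hi : c.count i < M
    · simp [Region.lift, x, hi, hi.not_ge]
    · exact .inr (not_lt.1 hi)
  · simp only [x]
    split_ifs <;> omega

lemma IsLosingCert.comp_equiv {N N' : Type*} {m : ℕ} {loc : N → Region Q d}
    {r : Fin m → AffineFamily N (Fin d)} (h : IsLosingCert S qF loc r) (φ : N' ≃ N) :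
    IsLosingCert S qF (loc ∘ φ) fun j => ⟨(r j).coeff ∘ φ, (r j).offset ∘ φ⟩ := by
  simp only [IsLosingCert, CertStep, φ.surjective.forall, φ.surjective.exists] at h
  exact h

theorem IsOneVASSMDP.exists_isLosingCert [Fintype Q] [DecidableEq Q] (hS : S.IsOneVASSMDP)
    {c : Config Q d} (hc : c ∉ S.winSet qF) :
    ∃ (K : ℕ) (loc : Fin K → Region Q d) (m : ℕ) (r : Fin m → AffineFamily (Fin K) (Fin d)),
      IsLosingCert S qF loc r ∧ ∃ n, c ∈ (loc n).toSet := by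
  obtain ⟨M, hM⟩ := exists_isDeterminedBelow (hS.isUpperSet_winSet (qF := qF))
  obtain ⟨f, hf, hlose⟩ := exists_memoryless_of_not_winnable (hS.losingChoices_nonempty hM)
    (hS.not_winnable_losingChoices hM)
  have hcycle : ¬HasAcceptingCycle
      ((finite_graph f).toFinset : Set (Edge (LosingNode S qF M) (Fin d))) := by
    rw [Set.Finite.coe_toFinset]
    exact mt winnable_of_hasAcceptingCycle hlose
  obtain ⟨m, r, hr⟩ := exists_lexDecreases_of_not_hasAcceptingCycle hcycle
  have hcert : IsLosingCert S qF Subtype.val r :=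
    isLosingCert_of_lexDecreases hM hf fun e he => hr e ((finite_graph f).mem_toFinset.2 he)
  obtain ⟨x, hx⟩ := exists_losingNode hM hc
  let φ := (Fintype.equivFin (LosingNode S qF M)).symm
  exact ⟨_, _, m, _, hcert.comp_equiv φ, φ.symm x, by simpa [φ] using hx⟩

end LosingCert

end VASSMDP

/-! ### Primitive recursive predicates -/

section PrimrecTools

attribute [fun_prop] Primrec PrimrecPred

attribute [fun_prop] Primrec.id Primrec.const Primrec.comp Primrec.pair Primrec.fst Primrec.snd
  PrimrecPred.and PrimrecPred.or PrimrecPred.not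

variable {α β σ : Type*} [Primcodable α] [Primcodable β] [Primcodable σ]

@[fun_prop]
lemma primrec_prod_fst {f : α → β × σ} (hf : Primrec f) : Primrec fun a => (f a).1 :=
  Primrec.fst.comp hf

@[fun_prop]
lemma primrec_prod_snd {f : α → β × σ} (hf : Primrec f) : Primrec fun a => (f a).2 :=
  Primrec.snd.comp hf

@[fun_prop]
lemma primrec_add_comp {f g : α → ℕ} (hf : Primrec f) (hg : Primrec g) :
    Primrec fun a => f a + g a := Primrec.nat_add.comp hf hg

@[fun_prop]
lemma primrec_mul_comp {f g : α → ℕ} (hf : Primrec f) (hg : Primrec g) :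
    Primrec fun a => f a * g a := Primrec.nat_mul.comp hf hg

@[fun_prop]
lemma primrec_getD_comp {f : α → List β} {g : α → ℕ} (c : β) (hf : Primrec f) (hg : Primrec g) :
    Primrec fun a => (f a).getD (g a) c := (Primrec.list_getD c).comp hf hg

@[fun_prop]
lemma primrec_length_comp {f : α → List β} (hf : Primrec f) :
    Primrec fun a => (f a).length := Primrec.list_length.comp hf

-- The encoding of `ℤ` sends `k ≥ 0` to `2 * k` and `-(k + 1)` to `2 * k + 1`.
lemma primrec_of_int {f : ℤ → ℕ} {g : ℕ → ℕ} (hg : Primrec g) (h₁ : ∀ k : ℕ, g (2 * k) = f k)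
    (h₂ : ∀ k : ℕ, g (2 * k + 1) = f (Int.negSucc k)) : Primrec f := by
  rw [Primrec.dom_denumerable]
  refine (Primrec.nat_iff.1 hg).of_eq fun n => ?_
  obtain ⟨z, rfl⟩ : ∃ z : ℤ, Encodable.encode z = n :=
    ⟨Denumerable.ofNat ℤ n, Denumerable.encode_ofNat n⟩
  rw [Denumerable.ofNat_encode]
  cases z with
  | ofNat k => exact h₁ k
  | negSucc k => exact h₂ k

lemma primrec_int_toNat : Primrec Int.toNat :=
  primrec_of_int (g := fun n => bif n.bodd then 0 else n.div2)
    (Primrec.cond Primrec.nat_bodd (Primrec.const 0) Primrec.nat_div2)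
    (fun k => by simp [Nat.div2_val]) (fun k => by simp)

lemma primrec_int_neg_toNat : Primrec fun z : ℤ => (-z).toNat :=
  primrec_of_int (g := fun n => bif n.bodd then n.div2 + 1 else 0)
    (Primrec.cond Primrec.nat_bodd (Primrec.succ.comp Primrec.nat_div2) (Primrec.const 0))
    (fun k => by simp) (fun k => by simp [Nat.div2_val])

@[fun_prop]
lemma primrec_toNat_comp {f : α → ℤ} (hf : Primrec f) : Primrec fun a => (f a).toNat :=
  primrec_int_toNat.comp hf

@[fun_prop]
lemma primrec_neg_toNat_comp {f : α → ℤ} (hf : Primrec f) : Primrec fun a => (-(f a)).toNat :=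
  primrec_int_neg_toNat.comp hf

@[fun_prop]
lemma primrec_sum_range_comp {f : α → ℕ} {g : α → ℕ → ℕ} (hf : Primrec f)
    (hg : Primrec fun p : α × ℕ => g p.1 p.2) :
    Primrec fun a => ∑ i ∈ Finset.range (f a), g a i := by
  have h : Primrec fun a => ((List.range (f a)).map (g a)).foldr (fun x s => x + s) 0 :=
    Primrec.list_foldr (Primrec.list_map (Primrec.list_range.comp hf) hg) (Primrec.const 0)
      (h := fun _ p => p.1 + p.2) (by unfold Primrec₂; fun_prop)
  refine h.of_eq fun a => ?_
  rw [Finset.sum_eq_multiset_sum, Finset.range_val, Multiset.range, Multiset.map_coe,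
    Multiset.sum_coe, List.sum_eq_foldr]

@[fun_prop]
lemma primrecPred_forall_mem {f : α → List β} {p : α → β → Prop} (hf : Primrec f)
    (hp : PrimrecPred fun x : α × β => p x.1 x.2) : PrimrecPred fun a => ∀ b ∈ f a, p a b := by
  have : PrimrecRel fun (b : β) (a : α) => p a b :=
    PrimrecPred.comp hp (Primrec.snd.pair Primrec.fst)
  exact this.forall_mem_list.comp hf Primrec.id

@[fun_prop]
lemma primrecPred_exists_mem {f : α → List β} {p : α → β → Prop} (hf : Primrec f)
    (hp : PrimrecPred fun x : α × β => p x.1 x.2) : PrimrecPred fun a => ∃ b ∈ f a, p a b := by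
  have : PrimrecRel fun (b : β) (a : α) => p a b :=
    PrimrecPred.comp hp (Primrec.snd.pair Primrec.fst)
  exact this.exists_mem_list.comp hf Primrec.id

@[fun_prop]
lemma primrecPred_forall_lt_comp {f : α → ℕ} {p : α → ℕ → Prop} (hf : Primrec f)
    (hp : PrimrecPred fun x : α × ℕ => p x.1 x.2) : PrimrecPred fun a => ∀ b < f a, p a b :=
  (primrecPred_forall_mem (Primrec.list_range.comp hf) hp).of_eq (by simp)

@[fun_prop]
lemma primrecPred_exists_lt_comp {f : α → ℕ} {p : α → ℕ → Prop} (hf : Primrec f)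
    (hp : PrimrecPred fun x : α × ℕ => p x.1 x.2) : PrimrecPred fun a => ∃ b < f a, p a b :=
  (primrecPred_exists_mem (Primrec.list_range.comp hf) hp).of_eq (by simp)

@[fun_prop]
lemma primrecPred_imp {p q : α → Prop} (hp : PrimrecPred p) (hq : PrimrecPred q) :
    PrimrecPred fun a => p a → q a :=
  (hp.not.or hq).of_eq fun _ => by tauto

@[fun_prop]
lemma primrecPred_eq_comp {f g : α → β} (hf : Primrec f) (hg : Primrec g) :
    PrimrecPred fun a => f a = g a := Primrec.eq.comp hf hg

@[fun_prop]
lemma primrecPred_le_comp {f g : α → ℕ} (hf : Primrec f) (hg : Primrec g) :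
    PrimrecPred fun a => f a ≤ g a := Primrec.nat_le.comp hf hg

@[fun_prop]
lemma primrecPred_lt_comp {f g : α → ℕ} (hf : Primrec f) (hg : Primrec g) :
    PrimrecPred fun a => f a < g a := Primrec.nat_lt.comp hf hg

lemma rePred_exists_of_primrecPred {p : α → β → Prop}
    (hp : PrimrecPred fun x : α × β => p x.1 x.2) : REPred fun a => ∃ b, p a b := by
  classical
  let P : α → ℕ → Prop := fun a n => ∃ b ∈ (Encodable.decode (α := β) n).toList, p a b
  have hP : PrimrecPred fun x : α × ℕ => P x.1 x.2 :=
    primrecPred_exists_mem (Primrec.optionToList.comp (Primrec.decode.comp Primrec.snd))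
      (PrimrecPred.comp hp (by fun_prop : Primrec fun y : (α × ℕ) × β => (y.1.1, y.2)))
  have h : Partrec fun a => Nat.rfind fun n => Part.some (decide (P a n)) :=
    Partrec.rfind hP.computablePred.decide.partrec
  refine h.dom_re.of_eq fun a => ?_
  refine Nat.rfind_dom.trans ?_
  simp only [Part.mem_some_iff, true_eq_decide_iff, Part.some_dom, implies_true, and_true, P]
  constructor
  · rintro ⟨n, b, -, hb⟩
    exact ⟨b, hb⟩
  · rintro ⟨b, hb⟩
    exact ⟨Encodable.encode b, b, by simp, hb⟩

end PrimrecTools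

/-! ### Certificates for codes -/

namespace Code

/-- A weighted transition of a code: source, effect, target and weight. -/
abbrev Trans : Type := (ℕ × List ℤ × ℕ) × ℕ

namespace Trans

/-- The source of a transition of a code. -/
abbrev src (t : Trans) : ℕ := t.1.1

/-- The target of a transition of a code. -/
abbrev tgt (t : Trans) : ℕ := t.1.2.2

/-- The positive part of the effect of `t` on the counter `i`. -/
abbrev inc (t : Trans) (i : ℕ) : ℕ := (t.1.2.1.getD i 0).toNat

/-- The negative part of the effect of `t` on the counter `i`. -/
abbrev dec (t : Trans) (i : ℕ) : ℕ := (-(t.1.2.1.getD i 0)).toNat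

end Trans

section Accessors

variable (w : Code)

/-- The number of control-states of a code. -/
abbrev numStates : ℕ := w.1

/-- The dimension of a code. -/
abbrev dim : ℕ := w.2.1

/-- Whether the control-state `q` of a code belongs to Player 1. -/
abbrev owner (q : ℕ) : Bool := w.2.2.1.getD q false

/-- The weighted transitions of a code. -/
abbrev trans : List Trans := w.2.2.2.1

/-- The control-state of the initial configuration of a code. -/
abbrev initState : ℕ := w.2.2.2.2.1.1

/-- The counter values of the initial configuration of a code. -/
abbrev initCount : List ℕ := w.2.2.2.2.1.2

/-- The target control-state of a code. -/
abbrev target : ℕ := w.2.2.2.2.2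

/-- The code describes a 1-VASS-MDP, an initial configuration and a control-state. -/
def Wf : Prop :=
  w.2.2.1.length = w.numStates ∧
  (∀ e ∈ w.trans, e.src < w.numStates ∧ e.1.2.1.length = w.dim ∧ e.tgt < w.numStates ∧
    (w.owner e.src = true ∨ (0 < e.2 ∧ ∀ z ∈ e.1.2.1, z = 0))) ∧
  (∀ e ∈ w.trans, ∀ e' ∈ w.trans, e.1 = e'.1 → e.2 = e'.2) ∧
  w.initState < w.numStates ∧ w.initCount.length = w.dim ∧ w.target < w.numStates

end Accessors

/-- An entry of a certificate for almost-sure reachability: a control-state, lower bounds for the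
counters, and a rank. -/
abbrev PosEntry : Type := ℕ × List ℕ × ℕ

namespace PosEntry

/-- The control-state of an entry. -/
abbrev state (x : PosEntry) : ℕ := x.1

/-- The lower bound of an entry for the counter `i`. -/
abbrev bound (x : PosEntry) (i : ℕ) : ℕ := x.2.1.getD i 0

/-- The rank of an entry. -/
abbrev rank (x : PosEntry) : ℕ := x.2.2

end PosEntry

/-- Firing `t` leads from every configuration above `x` to a configuration above `x'`. -/
def PosStep (w : Code) (x : PosEntry) (t : Trans) (x' : PosEntry) : Prop :=
  t.tgt = x'.state ∧ ∀ i < w.dim, x'.bound i + t.dec i ≤ x.bound i + t.inc i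

/-- A certificate for almost-sure reachability: from an entry outside the target one can step to
an entry of smaller rank, and for Player P every step remains above some entry. -/
def IsPosCert (w : Code) (P : List PosEntry) : Prop :=
  (∃ x ∈ P, x.state = w.initState ∧ ∀ i < w.dim, x.bound i ≤ w.initCount.getD i 0) ∧
  ∀ x ∈ P, x.state = w.target ∨
    ((∃ t ∈ w.trans, t.src = x.state ∧ ∃ y ∈ P, w.PosStep x t y ∧ y.rank < x.rank) ∧
      (w.owner x.state = true ∨ ∀ t ∈ w.trans, t.src = x.state → ∃ y ∈ P, w.PosStep x t y))

/-- An entry of a certificate for the failure of almost-sure reachability: a `Region`, given by a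
control-state and bounds, with the coefficients and the offset of every ranking. -/
abbrev NegEntry : Type := ℕ × List ℕ × List (List ℕ × ℕ)

namespace NegEntry

/-- The control-state of an entry. -/
abbrev state (g : NegEntry) : ℕ := g.1

/-- The strict upper bound of an entry for the counter `i`, with `0` for no bound. -/
abbrev bound (g : NegEntry) (i : ℕ) : ℕ := g.2.1.getD i 0

/-- The coefficients of the ranking `j`. -/
abbrev coeff (g : NegEntry) (j i : ℕ) : ℕ := (g.2.2.getD j ([], 0)).1.getD i 0

/-- The offset of the ranking `j`. -/
abbrev offset (g : NegEntry) (j : ℕ) : ℕ := (g.2.2.getD j ([], 0)).2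

end NegEntry

section NegStep

variable (w : Code) (g : NegEntry) (t : Trans) (g' : NegEntry) (j : ℕ)

/-- The total of the positive terms in the change of the ranking `j` along a step. -/
abbrev gain : ℕ := ∑ i ∈ Finset.range w.dim, g.coeff j i * t.inc i + g'.offset j

/-- The total of the negative terms in the change of the ranking `j` along a step. -/
abbrev loss : ℕ := ∑ i ∈ Finset.range w.dim, g.coeff j i * t.dec i + g.offset j

/-- The counterpart of `AffineFamily.IsConstantAlong` for entries. -/
def IsConstantAlong : Prop :=
  (∀ i < w.dim, g.coeff j i = g'.coeff j i) ∧ w.gain g t g' j = w.loss g t j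

/-- The counterpart of `AffineFamily.DecreasesAlong` for entries. -/
def DecreasesAlong : Prop :=
  (∀ i < w.dim, g.coeff j i = g'.coeff j i) ∧ w.gain g t g' j < w.loss g t j

/-- The counterpart of `VASSMDP.CertStep` for entries with `m` rankings. -/
def NegStep (m : ℕ) (acc : Bool) : Prop :=
  t.tgt = g'.state ∧
  (∀ i < w.dim, g'.bound i = 0 ∨
    (g.bound i ≠ 0 ∧ g.bound i + t.inc i ≤ g'.bound i + t.dec i)) ∧
  ((∃ j < m, (∀ k < j, w.IsConstantAlong g t g' k) ∧ w.DecreasesAlong g t g' j) ∨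
    ((∀ j < m, w.IsConstantAlong g t g' j) ∧ acc = false))

/-- The counterpart of `Region.Enabled` for entries, apart from the control-states. -/
def MayFire : Prop :=
  ∀ i < w.dim, g.bound i = 0 ∨ t.dec i < g.bound i + t.inc i

end NegStep

/-- A certificate for the failure of almost-sure reachability: the number of rankings and a list
of entries, the counterpart of `VASSMDP.IsLosingCert`. -/
def IsNegCert (w : Code) (C : ℕ × List NegEntry) : Prop :=
  (∃ g ∈ C.2, g.state = w.initState ∧
    ∀ i < w.dim, g.bound i = 0 ∨ w.initCount.getD i 0 < g.bound i) ∧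
  ∀ g ∈ C.2, g.state < w.numStates ∧ g.state ≠ w.target ∧
    ((∀ t ∈ w.trans, t.src = g.state → w.MayFire g t →
        ∃ g' ∈ C.2, w.NegStep g t g' C.1 false) ∨
      (w.owner g.state = false ∧
        ∃ t ∈ w.trans, t.src = g.state ∧ ∃ g' ∈ C.2, w.NegStep g t g' C.1 true))

section Primrec

lemma primrecPred_wf : PrimrecPred Wf := by
  unfold Wf
  fun_prop

variable {α : Type*} [Primcodable α] {w : α → Code} {x x' : α → PosEntry} {g g' : α → NegEntry}
  {t : α → Trans} {j : α → ℕ}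

@[fun_prop]
lemma primrecPred_posStep (hw : Primrec w) (hx : Primrec x) (ht : Primrec t) (hx' : Primrec x') :
    PrimrecPred fun a => (w a).PosStep (x a) (t a) (x' a) := by
  unfold PosStep
  fun_prop

@[fun_prop]
lemma primrecPred_isConstantAlong (hw : Primrec w) (hg : Primrec g) (ht : Primrec t)
    (hg' : Primrec g') (hj : Primrec j) :
    PrimrecPred fun a => (w a).IsConstantAlong (g a) (t a) (g' a) (j a) := by
  unfold IsConstantAlong
  fun_prop

@[fun_prop]
lemma primrecPred_decreasesAlong (hw : Primrec w) (hg : Primrec g) (ht : Primrec t)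
    (hg' : Primrec g') (hj : Primrec j) :
    PrimrecPred fun a => (w a).DecreasesAlong (g a) (t a) (g' a) (j a) := by
  unfold DecreasesAlong
  fun_prop

@[fun_prop]
lemma primrecPred_negStep {m : α → ℕ} {acc : α → Bool} (hw : Primrec w) (hg : Primrec g)
    (ht : Primrec t) (hg' : Primrec g') (hm : Primrec m) (hacc : Primrec acc) :
    PrimrecPred fun a => (w a).NegStep (g a) (t a) (g' a) (m a) (acc a) := by
  unfold NegStep
  fun_prop

@[fun_prop]
lemma primrecPred_mayFire (hw : Primrec w) (hg : Primrec g) (ht : Primrec t) :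
    PrimrecPred fun a => (w a).MayFire (g a) (t a) := by
  unfold MayFire
  fun_prop

lemma primrecPred_isPosCert : PrimrecPred fun p : Code × List PosEntry => p.1.IsPosCert p.2 := by
  unfold IsPosCert
  fun_prop

lemma primrecPred_isNegCert :
    PrimrecPred fun p : Code × (ℕ × List NegEntry) => p.1.IsNegCert p.2 := by
  unfold IsNegCert
  fun_prop

end Primrec

open VASSMDP

lemma getD_ofFn {α : Type*} {n : ℕ} (f : Fin n → α) (i : Fin n) (a : α) :
    (List.ofFn f).getD i a = f i := by
  simp [List.getD]

lemma forall_lt_iff_forall_fin {d : ℕ} {p : ℕ → Prop} {q : Fin d → Prop}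
    (h : ∀ i : Fin d, p i ↔ q i) : (∀ i < d, p i) ↔ ∀ i, q i :=
  Fin.forall_iff.symm.trans (forall_congr' h)

variable {n d : ℕ} {w : Code} {S : VASSMDP (Fin n) d} {c₀ : Config (Fin n) d} {qF : Fin n}

/-- The code of a transition without its weight. -/
def ofVTrans (t : VTrans (Fin n) d) : ℕ × List ℤ × ℕ :=
  (t.1, List.ofFn t.2.1, t.2.2)

lemma ofVTrans_injective : (ofVTrans (n := n) (d := d)).Injective := fun t t' h => by
  simp only [ofVTrans, Prod.mk.injEq, List.ofFn_inj, Fin.val_inj] at h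
  exact Prod.ext h.1 (Prod.ext h.2.1 h.2.2)

/-- The code of a weighted transition of `S`. -/
def ofTrans (S : VASSMDP (Fin n) d) (t : VTrans (Fin n) d) : Trans :=
  (ofVTrans t, S.τ t)

lemma inc_ofTrans (t : VTrans (Fin n) d) (i : Fin d) : (ofTrans S t).inc i = (t.2.1 i).toNat :=
  congrArg Int.toNat (getD_ofFn _ _ _)

lemma dec_ofTrans (t : VTrans (Fin n) d) (i : Fin d) :
    (ofTrans S t).dec i = (-t.2.1 i).toNat :=
  congrArg (fun z : ℤ => (-z).toNat) (getD_ofFn _ _ _)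

section Encodes

variable (h : Encodes w S c₀ qF)
include h

lemma numStates_eq : w.numStates = n := by
  obtain ⟨L, -, rfl⟩ := h; rfl

lemma dim_eq : w.dim = d := by
  obtain ⟨L, -, rfl⟩ := h; rfl

lemma owner_eq (q : Fin n) : w.owner q = decide (q ∈ S.Q₁) := by
  obtain ⟨L, -, rfl⟩ := h; exact getD_ofFn (fun q => decide (q ∈ S.Q₁)) q false

lemma mem_trans (t' : Trans) : t' ∈ w.trans ↔ ∃ t ∈ S.T, ofTrans S t = t' := by
  obtain ⟨L, hL, rfl⟩ := h
  refine List.mem_map.trans ?_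
  simp only [← hL, List.mem_toFinset, ofTrans, ofVTrans]

lemma initState_eq : w.initState = c₀.state := by
  obtain ⟨L, -, rfl⟩ := h; rfl

lemma initCount_eq : w.initCount = List.ofFn c₀.count := by
  obtain ⟨L, -, rfl⟩ := h; rfl

lemma target_eq : w.target = qF := by
  obtain ⟨L, -, rfl⟩ := h; rfl

end Encodes

/-- The configurations above the lower bounds of an entry. -/
def PosEntry.toSet (x : PosEntry) : Set (Config (Fin n) d) :=
  {c | x.state = c.state ∧ ∀ i : Fin d, x.bound i ≤ c.count i}

lemma init_mem_toSet_iff (h : Encodes w S c₀ qF) {x : PosEntry} :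
    c₀ ∈ x.toSet ↔ x.state = w.initState ∧ ∀ i < w.dim, x.bound i ≤ w.initCount.getD i 0 := by
  rw [initState_eq h, dim_eq h, initCount_eq h]
  exact and_congr_right fun _ =>
    (forall_lt_iff_forall_fin fun i => by rw [getD_ofFn]).symm

lemma posStep_iff (h : Encodes w S c₀ qF) {x x' : PosEntry} {t : VTrans (Fin n) d} :
    w.PosStep x (ofTrans S t) x' ↔ (t.2.2 : ℕ) = x'.state ∧
      ∀ i : Fin d, (x'.bound i : ℤ) ≤ x.bound i + t.2.1 i := by
  rw [PosStep, dim_eq h]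
  refine and_congr_right fun _ => forall_lt_iff_forall_fin fun i => ?_
  rw [inc_ofTrans, dec_ofTrans]
  omega

lemma PosStep.enabled_and_fire_mem (h : Encodes w S c₀ qF) {x x' : PosEntry}
    {t : VTrans (Fin n) d} {c : Config (Fin n) d} (hs : w.PosStep x (ofTrans S t) x')
    (hc : c ∈ x.toSet) (ht : t.1 = c.state) : c.Enabled t ∧ c.fire t ∈ x'.toSet := by
  obtain ⟨htgt, hbound⟩ := (posStep_iff h).1 hs
  refine ⟨⟨ht, fun i => ?_⟩, htgt.symm, fun i => ?_⟩
  all_goals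
    have := hbound i
    have := hc.2 i
    grind [Config.fire]

theorem IsPosCert.mem_winSet (h : Encodes w S c₀ qF) {P : List PosEntry} (hP : w.IsPosCert P) :
    c₀ ∈ S.winSet qF := by
  obtain ⟨⟨x₀, hx₀, hinit⟩, hP⟩ := hP
  let ranked (k : ℕ) : Set (Config (Fin n) d) := {c | ∃ x ∈ P, x.rank = k ∧ c ∈ x.toSet}
  refine le_gfp_lfp_of_ranked (f := S.reachStep qF) (x := ranked) rfl (fun k c hc => ?_) x₀.rank
    ⟨x₀, hx₀, rfl, (init_mem_toSet_iff h).2 hinit⟩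
  obtain ⟨x, hx, rfl, hxc⟩ := hc
  obtain hF | ⟨⟨t', ht', hsrc, x', hx', hs, hlt⟩, hP⟩ := hP x hx
  · exact .inl (Fin.ext (hxc.1.symm.trans (hF.trans (target_eq h))))
  obtain ⟨t, ht, rfl⟩ := (mem_trans h t').1 ht'
  obtain ⟨hen, hmem⟩ := hs.enabled_and_fire_mem h hxc (Fin.ext (hsrc.trans hxc.1))
  have hstep : VStep S.T c (c.fire t) := ⟨t, ht, hen, rfl⟩
  have hfire : c.fire t ∈ ⋃ j < x.rank, ranked j :=
    Set.mem_iUnion₂.2 ⟨_, hlt, x', hx', rfl, hmem⟩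
  by_cases hq : c.state ∈ S.Q₁
  · exact .inr (.inl ⟨hq, _, hstep, .inr (Set.iUnion₂_subset_iUnion _ _ hfire), .inr hfire⟩)
  refine .inr (.inr ⟨hq, ⟨_, hstep, .inr hfire⟩, ?_⟩)
  rintro _ ⟨t, ht, hen, rfl⟩
  obtain howner | hall := hP
  · rw [hxc.1, owner_eq h] at howner
    exact absurd (of_decide_eq_true howner) hq
  obtain ⟨x', hx', hs⟩ := hall _ ((mem_trans h _).2 ⟨t, ht, rfl⟩)
    ((congrArg Fin.val hen.1).trans hxc.1.symm)
  exact .inr (Set.mem_iUnion.2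
    ⟨_, x', hx', rfl, (hs.enabled_and_fire_mem h hxc hen.1).2⟩)

/-- The entry with the lower bounds given by the configuration `c` and with rank `k`. -/
def posEntry (c : Config (Fin n) d) (k : ℕ) : PosEntry := (c.state, List.ofFn c.count, k)

lemma bound_posEntry (c : Config (Fin n) d) (k : ℕ) (i : Fin d) :
    (posEntry c k).bound i = c.count i :=
  getD_ofFn _ _ _

lemma mem_toSet_posEntry {c c' : Config (Fin n) d} {k : ℕ} :
    c' ∈ (posEntry c k).toSet ↔ c ≤ c' :=
  and_congr Fin.ext_iff.symm (forall_congr' fun i => by rw [bound_posEntry])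

lemma posStep_posEntry (h : Encodes w S c₀ qF) {c c' : Config (Fin n) d} {t : VTrans (Fin n) d}
    (ht : c.Enabled t) (hle : c' ≤ c.fire t) (k k' : ℕ) :
    w.PosStep (posEntry c k) (ofTrans S t) (posEntry c' k') := by
  refine (posStep_iff h).2 ⟨congrArg Fin.val hle.1.symm, fun i => ?_⟩
  have hcount : c'.count i ≤ ((c.count i : ℤ) + t.2.1 i).toNat := hle.2 i
  have := ht.2 i
  rw [bound_posEntry, bound_posEntry]
  omega

/-- The entries of rank at most `N` whose lower bounds of rank `k` are the elements of `B k`. -/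
noncomputable def posEntries (B : ℕ → Finset (Config (Fin n) d)) (N : ℕ) : List PosEntry :=
  (List.range (N + 1)).flatMap fun k => (B k).toList.map (posEntry · k)

lemma mem_posEntries {B : ℕ → Finset (Config (Fin n) d)} {N : ℕ} {x : PosEntry} :
    x ∈ posEntries B N ↔ ∃ k ≤ N, ∃ b ∈ B k, posEntry b k = x := by
  simp [posEntries]

lemma exists_mem_posEntries_posStep (h : Encodes w S c₀ qF) {B : ℕ → Finset (Config (Fin n) d)}
    {N k : ℕ} (hk : k ≤ N) (hB : S.winLevel qF k ⊆ upperClosure (B k : Set (Config (Fin n) d)))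
    {c : Config (Fin n) d} {t : VTrans (Fin n) d} (ht : c.Enabled t)
    (hc : c.fire t ∈ S.winLevel qF k) (l : ℕ) :
    ∃ x ∈ posEntries B N, w.PosStep (posEntry c l) (ofTrans S t) x ∧ x.rank = k := by
  obtain ⟨b, hb, hle⟩ := hB hc
  exact ⟨posEntry b k, mem_posEntries.2 ⟨k, hk, b, hb, rfl⟩, posStep_posEntry h ht hle l k, rfl⟩

theorem exists_isPosCert (hS : S.IsOneVASSMDP) (h : Encodes w S c₀ qF) (hc : c₀ ∈ S.winSet qF) :
    ∃ P, w.IsPosCert P := by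
  obtain ⟨N, hN⟩ := hS.exists_winLevel_eq_winSet (qF := qF)
  choose B hBwin hB using fun k => exists_finset_subset_upperClosure (S.winLevel qF k)
  refine ⟨posEntries B N, ?_, fun x hx => ?_⟩
  · obtain ⟨b, hb, hle⟩ := hB N (hN ▸ hc)
    exact ⟨posEntry b N, mem_posEntries.2 ⟨N, le_rfl, b, hb, rfl⟩,
      (init_mem_toSet_iff h).1 (mem_toSet_posEntry.2 hle)⟩
  obtain ⟨k, hk, b, hb, rfl⟩ := mem_posEntries.1 hx
  have hbk := hBwin k hb
  obtain _ | k := k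
  · exact hbk.elim
  have exists_lt {c'} (hstep : VStep S.T b c') (hc' : c' ∈ S.winLevel qF k) :
      ∃ t ∈ w.trans, t.src = b.state ∧
        ∃ x ∈ posEntries B N, w.PosStep (posEntry b (k + 1)) t x ∧ x.rank < k + 1 := by
    obtain ⟨t, ht, hen, rfl⟩ := hstep
    obtain ⟨x, hx, hs, hrank⟩ := exists_mem_posEntries_posStep h (by omega : k ≤ N) (hB k) hen hc' _
    exact ⟨_, (mem_trans h _).2 ⟨t, ht, rfl⟩, congrArg Fin.val hen.1, x, hx, hs, by omega⟩
  rw [winLevel_succ] at hbk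
  obtain hF | ⟨hq, c', hstep, -, hc'⟩ | ⟨hq, ⟨c', hstep, hc'⟩, hall⟩ := hbk
  · exact .inl ((congrArg Fin.val hF).trans (target_eq h).symm)
  · exact .inr ⟨exists_lt hstep hc', .inl ((owner_eq h _).trans (decide_eq_true hq))⟩
  · refine .inr ⟨exists_lt hstep hc', .inr fun t' ht' hsrc => ?_⟩
    obtain ⟨t, ht, rfl⟩ := (mem_trans h _).1 ht'
    have hen : b.Enabled t := hS.enabled_of_state_notMem ht (Fin.ext hsrc) hq
    obtain ⟨x, hx, hs, -⟩ := exists_mem_posEntries_posStep h le_rfl (hB N) hen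
      (hN ▸ hall _ ⟨t, ht, hen, rfl⟩) (k + 1)
    exact ⟨x, hx, hs⟩

open EnergyGame

variable {m : ℕ} {N : Type*} {node : N → NegEntry} {loc : N → Region (Fin n) d}
  {r : Fin m → AffineFamily N (Fin d)} {ν ν' : N} {t : VTrans (Fin n) d} {acc : Bool}

/-- The entries `node ν` describe the regions `loc ν` and the rankings `r`. -/
structure Describes (node : N → NegEntry) (loc : N → Region (Fin n) d)
    (r : Fin m → AffineFamily N (Fin d)) : Prop where
  state : ∀ ν, (node ν).state = (loc ν).state
  bound : ∀ ν (i : Fin d), (node ν).bound i = (loc ν).bound i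
  coeff : ∀ (j : Fin m) ν (i : Fin d), (node ν).coeff j i = (r j).coeff ν i
  offset : ∀ (j : Fin m) ν, (node ν).offset j = (r j).offset ν

section Describes

variable (h : Encodes w S c₀ qF) (hD : Describes node loc r)
include h hD

lemma loss_sub_gain (j : Fin m) :
    (w.loss (node ν) (ofTrans S t) j - w.gain (node ν) (ofTrans S t) (node ν') j : ℤ) =
      (r j).drop ⟨ν, t.2.1, ν', acc⟩ := by
  have mul_split (i : Fin d) : ((r j).coeff ν i : ℤ) * t.2.1 i =
      (r j).coeff ν i * (t.2.1 i).toNat - (r j).coeff ν i * (-t.2.1 i).toNat := by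
    rw [← mul_sub]
    congr 1
    omega
  simp only [gain, loss, dim_eq h, hD.offset, hD.coeff, Finset.sum_range, inc_ofTrans, dec_ofTrans,
    AffineFamily.drop, Edge.drop, mul_split, Finset.sum_sub_distrib, Int.cast_id]
  push_cast
  ring

lemma coeff_eq_iff (j : Fin m) : (∀ i < w.dim, (node ν).coeff j i = (node ν').coeff j i) ↔
    (r j).coeff ν = (r j).coeff ν' := by
  rw [dim_eq h, funext_iff]
  exact forall_lt_iff_forall_fin fun i => by rw [hD.coeff, hD.coeff]

lemma isConstantAlong_iff (j : Fin m) :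
    w.IsConstantAlong (node ν) (ofTrans S t) (node ν') j ↔
      (r j).IsConstantAlong ⟨ν, t.2.1, ν', acc⟩ := by
  refine and_congr (coeff_eq_iff h hD j) ?_
  rw [← loss_sub_gain h hD]
  omega

lemma decreasesAlong_iff (j : Fin m) :
    w.DecreasesAlong (node ν) (ofTrans S t) (node ν') j ↔
      (r j).DecreasesAlong ⟨ν, t.2.1, ν', acc⟩ := by
  refine and_congr (coeff_eq_iff h hD j) ?_
  rw [← loss_sub_gain h hD]
  omega

lemma negStep_iff :
    w.NegStep (node ν) (ofTrans S t) (node ν') m acc ↔ CertStep loc r t ν ν' acc := by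
  rw [NegStep, ← and_assoc]
  refine and_congr (and_congr ?_ ?_) (or_congr ?_ (and_congr_left' ?_))
  · rw [hD.state]
    exact Fin.ext_iff.symm
  · rw [dim_eq h]
    refine forall_lt_iff_forall_fin fun i => ?_
    rw [hD.bound, hD.bound, inc_ofTrans, dec_ofTrans]
    omega
  · refine ⟨fun ⟨j, hj, hlt, hdec⟩ => ⟨⟨j, hj⟩, fun k hk => ?_, ?_⟩,
      fun ⟨j, hlt, hdec⟩ => ⟨j, j.2, fun k hk => ?_, ?_⟩⟩
    · exact (isConstantAlong_iff h hD k).1 (hlt k hk)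
    · exact (decreasesAlong_iff h hD ⟨j, hj⟩).1 hdec
    · exact (isConstantAlong_iff h hD ⟨k, hk.trans j.2⟩).2 (hlt _ hk)
    · exact (decreasesAlong_iff h hD j).2 hdec
  · exact forall_lt_iff_forall_fin fun j => isConstantAlong_iff h hD j

lemma enabled_iff : (loc ν).Enabled t ↔
    (ofTrans S t).src = (node ν).state ∧ w.MayFire (node ν) (ofTrans S t) := by
  rw [MayFire, dim_eq h, hD.state]
  refine and_congr Fin.ext_iff (forall_lt_iff_forall_fin fun i => ?_).symm
  rw [hD.bound, inc_ofTrans, dec_ofTrans]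
  omega

lemma init_mem_region_iff : c₀ ∈ (loc ν).toSet ↔ (node ν).state = w.initState ∧
    ∀ i < w.dim, (node ν).bound i = 0 ∨ w.initCount.getD i 0 < (node ν).bound i := by
  rw [initState_eq h, dim_eq h, initCount_eq h, hD.state]
  refine and_congr (Fin.ext_iff.trans eq_comm) (forall_lt_iff_forall_fin fun i => ?_).symm
  rw [hD.bound, getD_ofFn]

lemma isNegCert_iff {G : List NegEntry} (hG : ∀ g, g ∈ G ↔ ∃ ν, node ν = g) :
    w.IsNegCert (m, G) ↔ (∃ ν, c₀ ∈ (loc ν).toSet) ∧ IsLosingCert S qF loc r := by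
  simp only [IsNegCert, IsLosingCert, hG, mem_trans h, exists_exists_eq_and, forall_exists_index,
    forall_apply_eq_imp_iff, exists_exists_and_eq_and, and_imp, forall_apply_eq_imp_iff₂,
    ← init_mem_region_iff h hD, negStep_iff h hD, enabled_iff h hD]
  refine and_congr_right fun _ => forall_congr' fun ν => ?_
  rw [hD.state, owner_eq h, numStates_eq h, target_eq h, decide_eq_false_iff_not]
  simp only [Fin.is_lt, true_and, ne_eq, Fin.ext_iff, ofTrans, ofVTrans]

end Describes

theorem IsNegCert.notMem_winSet (hS : S.IsOneVASSMDP) (h : Encodes w S c₀ qF)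
    {C : ℕ × List NegEntry} (hC : w.IsNegCert C) : c₀ ∉ S.winSet qF := by
  have state_lt (g : {g // g ∈ C.2}) : g.1.state < n := numStates_eq h ▸ (hC.2 g.1 g.2).1
  have hD : Describes (m := C.1) Subtype.val
      (fun g : {g // g ∈ C.2} => ⟨⟨g.1.state, state_lt g⟩, fun i : Fin d => g.1.bound i⟩)
      fun j => ⟨fun g i => g.1.coeff j i, fun g => g.1.offset j⟩ :=
    ⟨fun _ => rfl, fun _ _ => rfl, fun _ _ _ => rfl, fun _ _ => rfl⟩
  obtain ⟨⟨ν, hν⟩, hcert⟩ := (isNegCert_iff h hD (by simp)).1 hC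
  exact hcert.notMem_winSet hS hν

/-- The entry of the node `ν` of a certificate with regions `loc` and rankings `r`. -/
def negEntry (loc : N → Region (Fin n) d) (r : Fin m → AffineFamily N (Fin d)) (ν : N) :
    NegEntry :=
  ((loc ν).state, List.ofFn (loc ν).bound,
    List.ofFn fun j => (List.ofFn ((r j).coeff ν), (r j).offset ν))

lemma describes_negEntry : Describes (negEntry loc r) loc r where
  state _ := rfl
  bound _ _ := getD_ofFn _ _ _
  coeff j ν i := by rw [NegEntry.coeff, negEntry, getD_ofFn, getD_ofFn]
  offset j ν := by rw [NegEntry.offset, negEntry, getD_ofFn]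

theorem exists_isNegCert (hS : S.IsOneVASSMDP) (h : Encodes w S c₀ qF) (hc : c₀ ∉ S.winSet qF) :
    ∃ C, w.IsNegCert C := by
  obtain ⟨K, loc, m, r, hcert, hmem⟩ := hS.exists_isLosingCert hc
  exact ⟨(m, List.ofFn (negEntry loc r)),
    (isNegCert_iff h describes_negEntry fun _ => List.mem_ofFn).2 ⟨hmem, hcert⟩⟩

end Code

/-! ### Decidability -/

namespace Code

open VASSMDP

section Encodes

variable {n d : ℕ} {w : Code} {S : VASSMDP (Fin n) d} {c₀ : Config (Fin n) d} {qF : Fin n}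

lemma wf_of_encodes (hS : S.IsOneVASSMDP) (h : Encodes w S c₀ qF) : w.Wf := by
  simp only [Wf, mem_trans h, initState_eq h, initCount_eq h, target_eq h, numStates_eq h,
    dim_eq h, forall_exists_index, and_imp, forall_apply_eq_imp_iff₂, List.length_ofFn,
    Fin.is_lt, and_true]
  refine ⟨?_, fun t ht => ⟨t.1.2, List.length_ofFn, t.2.2.2, ?_⟩, fun t _ t' _ htt => ?_⟩
  · obtain ⟨L, -, rfl⟩ := h
    exact List.length_ofFn
  · by_cases hq : t.1 ∈ S.Q₁
    · exact .inl ((owner_eq h t.1).trans (decide_eq_true hq))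
    · refine .inr ⟨S.τ_pos t ht hq, ?_⟩
      simp [ofTrans, ofVTrans, hS.effect_eq_zero ht hq, List.mem_ofFn]
  · exact congrArg S.τ (ofVTrans_injective htt)

end Encodes

lemma exists_ofFn_eq {α : Type*} {l : List α} {n : ℕ} (h : l.length = n) :
    ∃ f : Fin n → α, List.ofFn f = l :=
  h ▸ ⟨l.get, List.ofFn_get l⟩

lemma exists_ofVTrans_eq {n d : ℕ} {x : ℕ × List ℤ × ℕ} (hsrc : x.1 < n)
    (hlen : x.2.1.length = d) (htgt : x.2.2 < n) : ∃ t : VTrans (Fin n) d, ofVTrans t = x := by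
  obtain ⟨z, hz⟩ := exists_ofFn_eq hlen
  exact ⟨(⟨x.1, hsrc⟩, z, ⟨x.2.2, htgt⟩), Prod.ext rfl (Prod.ext hz rfl)⟩

lemma Wf.exists_weight {w : Code} (hw : w.Wf) :
    ∃ τ : ℕ × List ℤ × ℕ → ℕ, ∀ e ∈ w.trans, τ e.1 = e.2 := by
  have hfac : (fun e : {e // e ∈ w.trans} => e.1.2).FactorsThrough fun e => e.1.1 :=
    fun e e' h => hw.2.2.1 e.1 e.2 e'.1 e'.2 h
  exact ⟨_, fun e he => hfac.extend_apply 0 ⟨e, he⟩⟩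

lemma Wf.exists_map_ofVTrans_eq {w : Code} (hw : w.Wf) :
    ∃ L : List (VTrans (Fin w.numStates) w.dim), L.map ofVTrans = w.trans.map Prod.fst := by
  rw [← Set.mem_range, Set.range_list_map]
  refine List.forall_mem_map.2 fun e he => ?_
  obtain ⟨hsrc, hdim, htgt, -⟩ := hw.2.1 e he
  exact exists_ofVTrans_eq hsrc hdim htgt

theorem Wf.exists_encodes {w : Code} (hw : w.Wf) :
    ∃ (n d : ℕ) (S : VASSMDP (Fin n) d) (c₀ : Config (Fin n) d) (qF : Fin n),
      S.IsOneVASSMDP ∧ Encodes w S c₀ qF := by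
  obtain ⟨τ, hτ⟩ := hw.exists_weight
  obtain ⟨L, hL⟩ := hw.exists_map_ofVTrans_eq
  obtain ⟨hlen, htrans, -, hq₀, hcount, hqF⟩ := hw
  obtain ⟨owner, howner⟩ := exists_ofFn_eq hlen
  obtain ⟨v₀, hv₀⟩ := exists_ofFn_eq hcount
  have spec (t) (ht : t ∈ L) (hq : ¬ owner t.1) :
      0 < τ (ofVTrans t) ∧ ∀ z ∈ List.ofFn t.2.1, z = 0 := by
    obtain ⟨e, he, het⟩ := List.mem_map.1 (hL ▸ List.mem_map_of_mem ht)
    rw [← het, hτ e he, show List.ofFn t.2.1 = e.1.2.1 from congrArg (·.2.1) het.symm]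
    refine (htrans e he).2.2.2.resolve_left fun h => hq ?_
    rwa [Code.owner, ← howner, show Trans.src e = t.1 from congrArg (·.1) het, getD_ofFn] at h
  refine ⟨w.numStates, w.dim,
    ⟨Finset.univ.filter (owner ·), L.toFinset, τ ∘ ofVTrans, fun t ht hq => ?_⟩,
    ⟨⟨w.initState, hq₀⟩, v₀⟩, ⟨w.target, hqF⟩, fun t ht hq => ?_, L, rfl, ?_⟩
  · exact (spec t (List.mem_toFinset.1 ht) fun h => hq (by simpa using h)).1
  · have hz := (spec t (List.mem_toFinset.1 ht) fun h => by simp [QP, h] at hq).2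
    exact funext fun i => hz _ (List.mem_ofFn.2 ⟨i, rfl⟩)
  · have hL' : L.map (fun t => (ofVTrans t, τ (ofVTrans t))) = w.trans := calc
      _ = (L.map ofVTrans).map (fun x => (x, τ x)) := List.map_map.symm
      _ = w.trans.map (fun e => (e.1, τ e.1)) := by rw [hL, List.map_map, Function.comp_def]
      _ = w.trans.map id := List.map_congr_left fun e he => Prod.ext rfl (hτ e he)
      _ = w.trans := List.map_id _
    have howner' : List.ofFn (fun q => decide (q ∈ Finset.univ.filter (owner ·))) = w.2.2.1 := by
      simpa only [Finset.mem_filter_univ, Bool.decide_eq_true] using howner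
    refine Prod.ext rfl (Prod.ext rfl (Prod.ext howner'.symm (Prod.ext hL'.symm ?_)))
    exact Prod.ext (Prod.ext rfl hv₀.symm) rfl

theorem almostSureReachability_iff_exists_isPosCert (w : Code) :
    AlmostSureReachability w ↔ ∃ P, w.Wf ∧ w.IsPosCert P := by
  constructor
  · rintro ⟨n, d, S, c₀, qF, hS, h, hc⟩
    rw [hS.almostSureSet_eq_winSet] at hc
    obtain ⟨P, hP⟩ := exists_isPosCert hS h hc
    exact ⟨P, wf_of_encodes hS h, hP⟩
  · rintro ⟨P, hw, hP⟩
    obtain ⟨n, d, S, c₀, qF, hS, h⟩ := hw.exists_encodes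
    exact ⟨n, d, S, c₀, qF, hS, h, hS.almostSureSet_eq_winSet ▸ hP.mem_winSet h⟩

theorem not_almostSureReachability_iff_exists_isNegCert (w : Code) :
    ¬ AlmostSureReachability w ↔ ∃ C, ¬ w.Wf ∨ w.IsNegCert C := by
  constructor
  · intro hw
    by_cases hwf : w.Wf
    · obtain ⟨n, d, S, c₀, qF, hS, h⟩ := hwf.exists_encodes
      obtain ⟨C, hC⟩ := exists_isNegCert hS h fun hc =>
        hw ⟨n, d, S, c₀, qF, hS, h, hS.almostSureSet_eq_winSet ▸ hc⟩
      exact ⟨C, .inr hC⟩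
    · exact ⟨default, .inl hwf⟩
  · rintro ⟨C, hC⟩ ⟨n, d, S, c₀, qF, hS, h, hc⟩
    rw [hS.almostSureSet_eq_winSet] at hc
    obtain hwf | hC := hC
    · exact hwf (wf_of_encodes hS h)
    · exact hC.notMem_winSet hS h hc

theorem computablePred_almostSureReachability : ComputablePred AlmostSureReachability := by
  have hwf {β : Type} [Primcodable β] : PrimrecPred fun p : Code × β => p.1.Wf :=
    primrecPred_wf.comp Primrec.fst
  refine ComputablePred.computable_iff_re_compl_re'.2 ⟨?_, ?_⟩
  · exact (rePred_exists_of_primrecPred (hwf.and primrecPred_isPosCert)).of_eq fun w =>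
      (almostSureReachability_iff_exists_isPosCert w).symm
  · exact (rePred_exists_of_primrecPred (hwf.not.or primrecPred_isNegCert)).of_eq fun w =>
      (not_almostSureReachability_iff_exists_isNegCert w).symm

end Code

theorem mainTheorem2 :
    -- The almost-sure reachability problem for 1-VASS-MDPs is decidable.
    ComputablePred AlmostSureReachability ∧
    -- Characterization of the set of almost surely winning configurations.
    ∀ (Q : Type*) [Fintype Q] [DecidableEq Q] (d : ℕ) (S : VASSMDP Q d) (qF : Q),
      S.IsOneVASSMDP →
      MuForm.InLsv S.QP (MuForm.almostSureForm S.Q₁ S.QP qF) ∧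
      S.almostSureSet qF = MuForm.denot S.T (MuForm.almostSureForm S.Q₁ S.QP qF) ∧
      IsUpperSet (S.almostSureSet qF) ∧
      -- One strategy and one bound for all winning configurations.
      ∃ (N : ℕ) (σ : S.Strategy), ∀ c ∈ S.almostSureSet qF,
        S.playMeasure c σ (VASSMDP.Reach d qF) = 1 ∧
        ∃ ω ∈ S.Outcome c σ, ∃ i ≤ N,
          (ω i).state = qF ∧
          (∀ j ≤ i, ω j ∈ S.almostSureSet qF) ∧
          (∀ j < i, (ω j).state ∈ S.QP → ∀ c', VStep S.T (ω j) c' → c' ∈ S.almostSureSet qF) := by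
  refine ⟨Code.computablePred_almostSureReachability, fun Q _ _ d S qF hS => ?_⟩
  rw [hS.almostSureSet_eq_winSet]
  refine ⟨MuForm.inLsv_almostSureForm _ _ _, (S.denot_almostSureForm qF).symm,
    hS.isUpperSet_winSet, ?_⟩
  obtain ⟨N, hN⟩ := hS.exists_winLevel_eq_winSet (qF := qF)
  refine ⟨N, S.rankStrategy qF, fun c hc => ⟨VASSMDP.playMeasure_rankStrategy hN hc, ?_⟩⟩
  obtain ⟨ω, hω, i, hi, hF, hwin, hsucc⟩ := VASSMDP.exists_outcome_rankStrategy hc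
  exact ⟨ω, hω, i, hi.trans (VASSMDP.winRank_le (hN ▸ hc)), hF, hwin,
    fun j hj hq => hsucc j hj (Finset.mem_sdiff.1 hq).2⟩
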